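/- Let $Solv_3=\{(x,q,t)\in\mathbb R^3\}$ with the multiplication $(x,q,t)(x',q',t')=(e^{t}x'+x,\;e^{-t}q'+q,\;t+t')$, let $\Gamma$ be any lattice of $Solv_3$ (a discrete subgroup of finite covolume), and let $M=\Gamma\backslash Solv_3$. Let $\mathcal F$ be the foliation of $M$ by the orbits of the right action of the subgroup $G=\{q=0\}$. Its leaves carry the metric $e^{-2t}dx^2+dt^2$, which in the coordinate $x+ie^t$ is the Poincaré metric of the upper half-plane. For $z\in M$ and $\rho>0$ let $\beta_\rho(z)$ be the probability measure on $M$ obtained by projecting the normalized hyperbolic area on the disk of radius $\rho$ centered at $z$ in the universal cover of the leaf through $z$. Let $m$ be the probability measure on $M$ induced by the Haar measure $dx\,dq\,dt$. A probability measure $\nu$ on $M$ is called harmonic if $\int_M\Delta_P f\,d\nu=0$ for every $C^2$ function $f:M\to\mathbb R$, where $\Delta_P$ is the leafwise Laplacian. Then $m$ is the unique harmonic probability measure on $M$. The set of $t$-coordinates of the elements of $\Gamma$ is $\tau\mathbb Z$ for some $\tau>0$; let $p:M\to\mathbb R/\tau\mathbb Z$ be the projection induced by $t$. Put $\hat\Phi(t)=\frac2\pi\sqrt{e^{-t}-e^{-2t}}$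 for $t\ge0$ and $\hat\Phi(t)=0$ for $t\le0$. Then $$\Phi(t)=\tau\sum_{k\in\mathbb Z}\hat\Phi(t+k\tau)$$ defines a continuous nonconstant function $\Phi$ on $\mathbb R/\tau\mathbb Z$, and there are points $z_n\in M$ such that $\beta_n(z_n)$ converges weakly, as $n\to\infty$, to the probability measure $\mu=(\Phi\circ p)\,m$. In particular $\mu\neq m$, and $\mu$ is not harmonic. -/

import Mathlib

open MeasureTheory Filter Topology UpperHalfPlane

/-! ### The Lie group `Solv₃` -/

/-- The underlying manifold of `Solv₃` is `ℝ³`, with coordinates `(x, q, t)`. -/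
def Solv : Type := ℝ × ℝ × ℝ

namespace Solv

/-- The point `(x, q, t)`. -/
def mk (x q t : ℝ) : Solv := (x, q, t)

/-- The coordinate `x`. -/
def x (g : Solv) : ℝ := g.1

/-- The coordinate `q`. -/
def q (g : Solv) : ℝ := g.2.1

/-- The coordinate `t`. -/
def t (g : Solv) : ℝ := g.2.2

@[simp] theorem x_mk (a b c : ℝ) : (mk a b c).x = a := rfl
@[simp] theorem q_mk (a b c : ℝ) : (mk a b c).q = b := rfl
@[simp] theorem t_mk (a b c : ℝ) : (mk a b c).t = c := rfl

@[ext] theorem ext {g h : Solv} (hx : g.x = h.x) (hq : g.q = h.q) (ht : g.t = h.t) : g = h :=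
  Prod.ext hx (Prod.ext hq ht)

instance : TopologicalSpace Solv := inferInstanceAs (TopologicalSpace (ℝ × ℝ × ℝ))

instance : MeasurableSpace Solv := inferInstanceAs (MeasurableSpace (ℝ × ℝ × ℝ))

instance : BorelSpace Solv := inferInstanceAs (BorelSpace (ℝ × ℝ × ℝ))

/-- The bi-invariant Haar measure `dx dq dt`. -/
noncomputable instance : MeasureSpace Solv where
  volume := (volume : Measure (ℝ × ℝ × ℝ))

/-- `(x, q, t) (x', q', t') = (e^t x' + x, e^(-t) q' + q, t + t')`. -/
noncomputable instance : Mul Solv where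
  mul g h := mk (Real.exp g.t * h.x + g.x) (Real.exp (-g.t) * h.q + g.q) (g.t + h.t)

noncomputable instance : One Solv where
  one := mk 0 0 0

noncomputable instance : Inv Solv where
  inv g := mk (-(Real.exp (-g.t) * g.x)) (-(Real.exp g.t * g.q)) (-g.t)

@[simp] theorem x_mul (g h : Solv) : (g * h).x = Real.exp g.t * h.x + g.x := rfl
@[simp] theorem q_mul (g h : Solv) : (g * h).q = Real.exp (-g.t) * h.q + g.q := rfl
@[simp] theorem t_mul (g h : Solv) : (g * h).t = g.t + h.t := rfl
@[simp] theorem x_one : (1 : Solv).x = 0 := rfl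
@[simp] theorem q_one : (1 : Solv).q = 0 := rfl
@[simp] theorem t_one : (1 : Solv).t = 0 := rfl
@[simp] theorem x_inv (g : Solv) : (g⁻¹).x = -(Real.exp (-g.t) * g.x) := rfl
@[simp] theorem q_inv (g : Solv) : (g⁻¹).q = -(Real.exp g.t * g.q) := rfl
@[simp] theorem t_inv (g : Solv) : (g⁻¹).t = -g.t := rfl

noncomputable instance : Group Solv where
  mul_assoc a b c := by
    ext
    · simp [Real.exp_add]; ring
    · simp [Real.exp_add]; ring
    · simp; ring
  one_mul a := by ext <;> simp
  mul_one a := by ext <;> simp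
  inv_mul_cancel a := by ext <;> simp

/-- The two-dimensional subgroup `G = {q = 0}`. -/
def affineSubgroup : Subgroup Solv where
  carrier := {g | g.q = 0}
  mul_mem' {a b} ha hb := by
    change (a * b).q = 0
    rw [q_mul, show a.q = 0 from ha, show b.q = 0 from hb, mul_zero, add_zero]
  one_mem' := rfl
  inv_mem' {a} ha := by
    change (a⁻¹).q = 0
    rw [q_inv, show a.q = 0 from ha, mul_zero, neg_zero]

/-- The identification `x + i e^t ↦ (x, 0, t)` of the hyperbolic plane with `G`. -/
noncomputable def ofUpperHalfPlane (w : ℍ) : Solv := mk w.re 0 (Real.log w.im)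

/-- The coordinate `x + i e^t` on the leaf `{q = const}` through `g`; the leafwise metric
`e^(-2t) dx² + dt²` is the Poincaré metric in this coordinate. -/
noncomputable def toUpperHalfPlane (g : Solv) : ℍ := ⟨⟨g.x, Real.exp g.t⟩, Real.exp_pos _⟩

theorem range_ofUpperHalfPlane : Set.range ofUpperHalfPlane = (affineSubgroup : Set Solv) := by
  ext g
  constructor
  · rintro ⟨w, rfl⟩
    rfl
  · intro hg
    refine ⟨toUpperHalfPlane g, ?_⟩
    ext
    · rfl
    · exact (show g.q = 0 from hg).symm
    · exact Real.log_exp _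

/-- For every `g`, the orbit map `w ↦ g * w` of the right action of `G ≅ ℍ` stays in the leaf
`{q = g.q}`. -/
theorem q_mul_ofUpperHalfPlane (g : Solv) (w : ℍ) : (g * ofUpperHalfPlane w).q = g.q := by
  simp [ofUpperHalfPlane]

/-- For every `g`, the orbit map `w ↦ g * w` of the right action of `G ≅ ℍ` is an isometry onto the
leaf through `g` with its Poincaré metric. -/
theorem isometry_mul_ofUpperHalfPlane (g : Solv) :
    Isometry (fun w : ℍ => toUpperHalfPlane (g * ofUpperHalfPlane w)) := by
  have h := (isometry_real_vadd g.x).comp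
    (isometry_pos_mul (⟨Real.exp g.t, Real.exp_pos _⟩ : {r : ℝ // 0 < r}))
  convert h using 1
  funext w
  apply UpperHalfPlane.ext
  apply Complex.ext
  · simp [toUpperHalfPlane, ofUpperHalfPlane, add_comm, Complex.exp_ofReal_re]
  · simp [toUpperHalfPlane, ofUpperHalfPlane, Real.exp_add, Real.exp_log w.im_pos,
      Complex.exp_ofReal_re]

end Solv

/-! ### The quotient `M = Γ \ Solv₃` and its fibration over the circle -/

/-- The quotient `Γ \ Solv₃` by the left action of `Γ`. -/
def SolvQuotient (Γ : Subgroup Solv) : Type := MulAction.orbitRel.Quotient Γ Solv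

namespace SolvQuotient

variable (Γ : Subgroup Solv)

instance : TopologicalSpace (SolvQuotient Γ) :=
  inferInstanceAs (TopologicalSpace (Quotient (MulAction.orbitRel Γ Solv)))

instance : MeasurableSpace (SolvQuotient Γ) := borel _

instance : BorelSpace (SolvQuotient Γ) := ⟨rfl⟩

/-- The covering projection `Solv₃ → Γ \ Solv₃`. -/
noncomputable def proj (g : Solv) : SolvQuotient Γ := Quotient.mk (MulAction.orbitRel Γ Solv) g

/-- The group of `t`-coordinates of elements of `Γ`. -/
def heightGroup : AddSubgroup ℝ where
  carrier := {s | ∃ γ ∈ Γ, γ.t = s}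
  add_mem' := by
    rintro _ _ ⟨a, ha, rfl⟩ ⟨b, hb, rfl⟩
    exact ⟨a * b, Γ.mul_mem ha hb, rfl⟩
  zero_mem' := ⟨1, Γ.one_mem, rfl⟩
  neg_mem' := by
    rintro _ ⟨a, ha, rfl⟩
    exact ⟨a⁻¹, Γ.inv_mem ha, rfl⟩

/-- The bundle projection `p : Γ \ Solv₃ → ℝ / heightGroup Γ` induced by the coordinate `t`. -/
noncomputable def baseProj : SolvQuotient Γ → ℝ ⧸ heightGroup Γ :=
  Quotient.lift (s := MulAction.orbitRel Γ Solv) (fun g => (g.t : ℝ ⧸ heightGroup Γ)) (by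
    rintro a b ⟨γ, rfl⟩
    rw [QuotientAddGroup.eq]
    refine ⟨(γ : Solv)⁻¹, Γ.inv_mem γ.2, ?_⟩
    change -(γ : Solv).t = -((γ : Solv).t + b.t) + b.t
    ring)

/-- The probability measure on `Γ \ Solv₃` induced by the Haar measure `dx dq dt`: the image of the
normalized restriction of `dx dq dt` to a fundamental domain `F` of `Γ`. -/
noncomputable def haarMeasure (F : Set Solv) : Measure (SolvQuotient Γ) :=
  (ProbabilityTheory.cond volume F).map (proj Γ)

/-! ### The foliation by the orbits of `G`, leafwise disks and harmonic measures -/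

/-- The isometric universal covering `ℍ → Γ \ Solv₃` of the leaf through `z`, with the base point
`i` going to `z`. For `z = Γ g` it is `w ↦ Γ g w`, where `ℍ` is identified with `G = {q = 0}`. -/
noncomputable def leafMap : SolvQuotient Γ → ℍ → SolvQuotient Γ :=
  Quotient.lift (s := MulAction.orbitRel Γ Solv)
    (fun g w => proj Γ (g * Solv.ofUpperHalfPlane w)) (by
      rintro a b ⟨γ, rfl⟩
      funext w
      exact Quotient.sound ⟨γ, (mul_assoc (γ : Solv) b (Solv.ofUpperHalfPlane w)).symm⟩)

theorem leafMap_I (z : SolvQuotient Γ) : leafMap Γ z UpperHalfPlane.I = z := by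
  refine Quotient.inductionOn z fun g => ?_
  have h : Solv.ofUpperHalfPlane UpperHalfPlane.I = 1 := by
    ext <;> simp [Solv.ofUpperHalfPlane]
  change proj Γ (g * Solv.ofUpperHalfPlane UpperHalfPlane.I) = proj Γ g
  rw [h, mul_one]

/-- The measure `β_ρ(z)` for `ρ > 0`: the normalized hyperbolic area on the disk of radius `ρ`
centered at `z` in the universal cover of the leaf through `z`, projected to `Γ \ Solv₃`. -/
noncomputable def diskMeasure (ρ : ℝ) (z : SolvQuotient Γ) : Measure (SolvQuotient Γ) :=
  (ProbabilityTheory.cond volume (Metric.ball UpperHalfPlane.I ρ)).map (leafMap Γ z)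

theorem continuous_leafMap (z : SolvQuotient Γ) : Continuous (leafMap Γ z) := by
  refine Quotient.inductionOn z fun g => ?_
  have h1 : Continuous (proj Γ) := continuous_quotient_mk'
  have h2 : Continuous (fun w : ℍ => g * Solv.ofUpperHalfPlane w) := by
    have hl : Continuous (fun w : ℍ => Real.log w.im) :=
      UpperHalfPlane.continuous_im.log fun w => w.im_ne_zero
    exact ((continuous_const.mul UpperHalfPlane.continuous_re).add continuous_const).prodMk
      (((continuous_const.mul continuous_const).add continuous_const).prodMk
        (continuous_const.add hl))
  exact h1.comp h2

theorem isProbabilityMeasure_diskMeasure {ρ : ℝ} (hρ : 0 < ρ) (z : SolvQuotient Γ) :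
    IsProbabilityMeasure (diskMeasure Γ ρ z) := by
  have h1 : (volume : Measure ℍ) (Metric.ball UpperHalfPlane.I ρ) ≠ 0 := by
    rw [UpperHalfPlane.volume_eq_lintegral]
    have himg := UpperHalfPlane.image_coe_ball UpperHalfPlane.I ρ
    intro h0
    rw [himg, lintegral_eq_zero_iff (by fun_prop)] at h0
    have hsub : ∀ z ∈ Metric.ball ((UpperHalfPlane.center UpperHalfPlane.I ρ : ℍ) : ℂ)
        (UpperHalfPlane.I.im * Real.sinh ρ), 0 < z.im := by
      intro z hz
      rw [← himg] at hz
      obtain ⟨w, -, rfl⟩ := hz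
      exact w.im_pos
    have h2 := (ae_restrict_iff' Metric.isOpen_ball.measurableSet).1 h0
    have h3 : volume (Metric.ball ((UpperHalfPlane.center UpperHalfPlane.I ρ : ℍ) : ℂ)
        (UpperHalfPlane.I.im * Real.sinh ρ)) = 0 := by
      refine measure_mono_null (fun z hz => ?_) h2
      simp only [Set.mem_compl_iff, Set.mem_ofPred_eq, Classical.not_imp]
      refine ⟨hz, ?_⟩
      simp [(hsub z hz).ne']
    exact (Metric.measure_ball_pos volume _
      (by simpa using Real.sinh_pos_iff.2 hρ)).ne' h3
  have h2 : (volume : Measure ℍ) (Metric.ball UpperHalfPlane.I ρ) ≠ ⊤ :=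
    ((measure_mono Metric.ball_subset_closedBall).trans_lt
      (isCompact_closedBall _ _).measure_lt_top).ne
  have := ProbabilityTheory.cond_isProbabilityMeasure_of_finite h1 h2
  exact Measure.isProbabilityMeasure_map (continuous_leafMap Γ z).measurable.aemeasurable

/-- The Laplacian `y² (∂²/∂x² + ∂²/∂y²)` of the Poincaré metric on the upper half-plane. -/
noncomputable def hyperbolicLaplacian (u : ℍ → ℝ) (w : ℍ) : ℝ :=
  w.im ^ 2 * Laplacian.laplacian (u ∘ UpperHalfPlane.ofComplex) (w : ℂ)

/-- The leafwise Laplacian of `f` at `z`, computed in the universal cover of the leaf. -/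
noncomputable def leafLaplacian (f : SolvQuotient Γ → ℝ) (z : SolvQuotient Γ) : ℝ :=
  hyperbolicLaplacian (f ∘ leafMap Γ z) UpperHalfPlane.I

/-- `f` is of class `C²`, i.e. its lift to `Solv₃ = ℝ³` is. -/
def IsC2 (f : SolvQuotient Γ → ℝ) : Prop :=
  ContDiff ℝ 2 (fun v : ℝ × ℝ × ℝ => f (proj Γ (Solv.mk v.1 v.2.1 v.2.2)))

/-- A measure on the closed manifold `Γ \ Solv₃` is harmonic if the integrals of the leafwise
Laplacians of all `C²` functions vanish. -/
def IsHarmonic (ν : Measure (SolvQuotient Γ)) : Prop :=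
  ∀ f : SolvQuotient Γ → ℝ, IsC2 Γ f → ∫ z, leafLaplacian Γ f z ∂ν = 0

end SolvQuotient

/-- The function `Φ̂` on `ℝ`, equal to `(2 / π) √(e^(-t) - e^(-2t))` for `t ≥ 0` and to `0` for
`t ≤ 0`. -/
noncomputable def solvProfile (t : ℝ) : ℝ :=
  if 0 ≤ t then 2 / Real.pi * Real.sqrt (Real.exp (-t) - Real.exp (-2 * t)) else 0

/-! The fibres of `p` are covered by 2-tori spanned by a nontrivial element of `Γ ∩ {t = 0}` and its
conjugate. Discreteness forbids nontrivial lattice elements on the coordinate axes of `{t = 0}`, so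
the horocycles (the `x`-direction) are irrational linear flows on these tori. By Weyl, averages of a
continuous `f` along long horocyclic segments converge to the fibrewise mean `fb`, uniformly in the
base point (`IsLatticeData.exists_fiberMean`).

A hyperbolic disk of radius `ρ` around `i` is cut by the lines `t = const` into horocyclic segments.
At height `s` above its lowest point the area density, times `exp (-ρ)`, tends to `π * solvProfile
s`, while the area of the disk is asymptotic to `π * exp ρ` and the segments become long for each
fixed `s > 0`. Hence the mean of `f` over the disk at `z` is asymptotic to `∫ solvProfile s * fb (p
z + s - ρ) ds` (`IsFiberMean.tendsto_integral_diskMeasure`). The profile has a nondegenerate shape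
on the scale of `τ`, so the phase `p z - ρ` matters: choosing base points of height `n` for `ρ = n`
freezes it, and periodizing the profile gives the density `Φ ∘ p`. This density is not constant
because the profile has a square root singularity at `0`.

The measure `m` is harmonic because it is invariant under right translations. For uniqueness, let
`ν` be harmonic. Smoothing continuous functions by kernels that are radial along leaves yields `C²`
functions, and solving the radial Poisson equation with compact support shows that the `ν`-average
of a transversely smoothed function `f` over leafwise disks satisfies the mean value property, so it
equals `∫ f dν` for every radius (`integral_integral_diskMeasure`). By the disk asymptotics this
average is also, up to `o(1)`, a `τ`-periodic function of `ρ`. A convergent periodic function is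
constant, and its mean over a period is the mean of `fb` over the circle, whatever `ν` is
(`integral_eq_of_isRadiallyOrthogonal`). So all harmonic probability measures agree; since `μ ≠ m`,
the limit `μ` cannot be harmonic. -/

namespace Solv

/-! ### The topological group `Solv` and the invariance of its volume -/

instance : T2Space Solv := inferInstanceAs (T2Space (ℝ × ℝ × ℝ))
instance : SecondCountableTopology Solv :=
  inferInstanceAs (SecondCountableTopology (ℝ × ℝ × ℝ))
instance : IsFiniteMeasureOnCompacts (volume : Measure Solv) :=
  inferInstanceAs (IsFiniteMeasureOnCompacts (volume : Measure (ℝ × ℝ × ℝ)))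
instance : (volume : Measure Solv).IsOpenPosMeasure :=
  inferInstanceAs ((volume : Measure (ℝ × ℝ × ℝ)).IsOpenPosMeasure)

theorem continuous_x : Continuous x := continuous_fst
theorem continuous_q : Continuous q := continuous_fst.comp continuous_snd
theorem continuous_t : Continuous t := continuous_snd.comp continuous_snd

theorem continuous_mk {X : Type*} [TopologicalSpace X] {a b c : X → ℝ} (ha : Continuous a)
    (hb : Continuous b) (hc : Continuous c) : Continuous fun y => mk (a y) (b y) (c y) :=
  ha.prodMk (hb.prodMk hc)

theorem mk_eta (g : Solv) : mk g.x g.q g.t = g := rfl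

instance : IsTopologicalGroup Solv where
  continuous_mul := by
    have hx := continuous_x
    have hq := continuous_q
    have ht := continuous_t
    exact continuous_mk (by fun_prop) (by fun_prop) (by fun_prop)
  continuous_inv := by
    have hx := continuous_x
    have hq := continuous_q
    have ht := continuous_t
    exact continuous_mk (by fun_prop) (by fun_prop) (by fun_prop)

theorem _root_.Real.map_volume_affine {a : ℝ} (ha : a ≠ 0) (b : ℝ) :
    Measure.map (fun y => a * y + b) volume = ENNReal.ofReal |a⁻¹| • (volume : Measure ℝ) := by
  have : (fun y : ℝ => a * y + b) = (fun y => y + b) ∘ (fun y => a * y) := rfl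
  rw [this, ← Measure.map_map (by fun_prop) (by fun_prop), Real.map_volume_mul_left ha,
    Measure.map_smul, map_add_right_eq_self]

/-- The dilations of `x` and `q` have inverse factors, so their Jacobians cancel. -/
theorem measurePreserving_mul_left (g : Solv) :
    MeasurePreserving (fun h : Solv => g * h) volume volume := by
  have key : MeasurePreserving (fun v : ℝ × ℝ × ℝ => (Real.exp g.t * v.1 + g.x,
      (Real.exp (-g.t) * v.2.1 + g.q, g.t + v.2.2))) volume volume := by
    refine ⟨by fun_prop, ?_⟩
    have h1 : (fun v : ℝ × ℝ × ℝ => (Real.exp g.t * v.1 + g.x,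
        (Real.exp (-g.t) * v.2.1 + g.q, g.t + v.2.2))) =
        Prod.map (fun y => Real.exp g.t * y + g.x)
          (Prod.map (fun y => Real.exp (-g.t) * y + g.q) (fun y => g.t + y)) := rfl
    rw [h1, Measure.volume_eq_prod, Measure.volume_eq_prod, ← Measure.map_prod_map _ _ (by fun_prop)
      (by fun_prop), ← Measure.map_prod_map _ _ (by fun_prop) (by fun_prop),
      Real.map_volume_affine (Real.exp_ne_zero _), Real.map_volume_affine (Real.exp_ne_zero _),
      map_add_left_eq_self, Measure.prod_smul_left, Measure.prod_smul_left,
      Measure.prod_smul_right, smul_smul, ← ENNReal.ofReal_mul (abs_nonneg _), ← abs_mul,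
      ← mul_inv, ← Real.exp_add]
    simp
  exact key

/-- In coordinates this is a shear: `t` is shifted by a constant, and `q` and `x` by amounts
depending on `t` only. The swaps bring the coordinates into the order in which `skew_product`
applies. -/
theorem measurePreserving_mul_right (g : Solv) :
    MeasurePreserving (fun h : Solv => h * g) volume volume := by
  have k1 : MeasurePreserving (fun v : ℝ × ℝ => (v.1 + g.t, v.2 + Real.exp (-v.1) * g.q))
      volume volume := by
    refine MeasurePreserving.skew_product (measurePreserving_add_right volume g.t)
      (g := fun a b => b + Real.exp (-a) * g.q) (by fun_prop) (.of_forall fun a => ?_)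
    exact map_add_right_eq_self _ _
  have k2 : MeasurePreserving (fun v : ℝ × ℝ => (v.1 + Real.exp (-v.2) * g.q, v.2 + g.t))
      volume volume :=
    (Measure.measurePreserving_swap.comp k1).comp Measure.measurePreserving_swap
  have k3 : MeasurePreserving (fun v : (ℝ × ℝ) × ℝ =>
      ((v.1.1 + Real.exp (-v.1.2) * g.q, v.1.2 + g.t), v.2 + Real.exp (v.1.2) * g.x))
      volume volume := by
    refine MeasurePreserving.skew_product k2
      (g := fun a b => b + Real.exp a.2 * g.x) (by fun_prop) (.of_forall fun a => ?_)
    exact map_add_right_eq_self _ _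
  have k4 : MeasurePreserving (fun v : ℝ × ℝ × ℝ => (v.1 + Real.exp v.2.2 * g.x,
      (v.2.1 + Real.exp (-v.2.2) * g.q, v.2.2 + g.t))) volume volume :=
    (Measure.measurePreserving_swap.comp k3).comp Measure.measurePreserving_swap
  have h : (fun h : Solv => h * g) = fun v : Solv => (show Solv from (v.1 + Real.exp v.2.2 * g.x,
      (v.2.1 + Real.exp (-v.2.2) * g.q, v.2.2 + g.t))) :=
    funext fun v => Solv.ext (add_comm _ _) (add_comm _ _) rfl
  rw [h]
  exact k4

instance : (volume : Measure Solv).IsMulLeftInvariant :=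
  ⟨fun g => (measurePreserving_mul_left g).map_eq⟩
/-- The one-parameter group in the direction of the horocycles. -/
noncomputable def horo (a : ℝ) : Solv := mk a 0 0

/-- The one-parameter group of vertical translations. -/
noncomputable def geo (s : ℝ) : Solv := mk 0 0 s

/-- The one-parameter group transverse to the foliation. -/
noncomputable def trans (b : ℝ) : Solv := mk 0 b 0

theorem continuous_horo : Continuous horo :=
  continuous_mk continuous_id continuous_const continuous_const

theorem continuous_geo : Continuous geo :=
  continuous_mk continuous_const continuous_const continuous_id

theorem continuous_trans : Continuous trans :=
  continuous_mk continuous_const continuous_id continuous_const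

theorem continuous_ofUpperHalfPlane : Continuous ofUpperHalfPlane :=
  continuous_mk UpperHalfPlane.continuous_re continuous_const
    (UpperHalfPlane.continuous_im.log fun w => w.im_ne_zero)

end Solv

/-! ### Consequences of finite covolume -/

namespace SolvQuotient

open Pointwise in
/-- Right translates of fundamental domains are fundamental domains. -/
theorem isFundamentalDomain_preimage_mul_right {Γ : Subgroup Solv} {F : Set Solv}
    (hF : IsFundamentalDomain Γ F (volume : Measure Solv)) (g : Solv) :
    IsFundamentalDomain Γ ((fun h : Solv => h * g) ⁻¹' F) (volume : Measure Solv) := by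
  refine hF.preimage_of_equiv (e := id)
    (Solv.measurePreserving_mul_right g).quasiMeasurePreserving Function.bijective_id ?_
  intro γ h
  exact mul_assoc (γ : Solv) h g

instance (Γ : Subgroup Solv) : SMulInvariantMeasure Γ Solv volume :=
  ⟨fun γ _ hs => (Solv.measurePreserving_mul_left (γ : Solv)).measure_preimage
    hs.nullMeasurableSet⟩

/-- The volume of an invariant set in a fundamental domain does not change under right
translation. -/
theorem volume_inter_preimage_mul_right {Γ : Subgroup Solv} [Countable Γ] {F : Set Solv}
    (hF : IsFundamentalDomain Γ F (volume : Measure Solv)) (g : Solv) {A : Set Solv}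
    (hA : MeasurableSet A) (hinv : ∀ γ ∈ Γ, ∀ h, γ * h ∈ A ↔ h ∈ A) :
    volume ((fun h : Solv => h * g) ⁻¹' A ∩ F) = volume (A ∩ F) := by
  have h1 := isFundamentalDomain_preimage_mul_right hF g
  have hm : Measurable (fun h : Solv => h * g) := (Solv.measurePreserving_mul_right g).measurable
  have h2 := h1.measure_set_eq hF (A := (fun h : Solv => h * g) ⁻¹' A) (hm hA) (by
    intro γ
    ext h
    have := hinv γ γ.2 (h * g)
    rw [← mul_assoc] at this
    exact this)
  rw [← h2, ← Set.preimage_inter, (Solv.measurePreserving_mul_right g).measure_preimage]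
  exact hA.nullMeasurableSet.inter hF.nullMeasurableSet

/-- A group with finite covolume has no invariant function which increases by `1` under some right
translation. -/
theorem not_exists_invariant_translate {Γ : Subgroup Solv} [Countable Γ] {F : Set Solv}
    (hF : IsFundamentalDomain Γ F (volume : Measure Solv)) (hFfin : (volume : Measure Solv) F ≠ ⊤)
    (u : Solv → ℝ) (hu : Measurable u) (hinv : ∀ γ ∈ Γ, ∀ h, u (γ * h) = u h)
    (r : Solv) (hr : ∀ h, u (h * r) = u h + 1) : False := by
  -- The strips `A n` partition the group and are permuted by right translation by `r`, so they cut
  -- `F` into infinitely many pieces of equal volume; finiteness makes `F` null, although countably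
  -- many translates of it cover almost everything.
  set A : ℤ → Set Solv := fun n => u ⁻¹' Set.Ico (n : ℝ) (n + 1) with hAdef
  have hAm : ∀ n, MeasurableSet (A n) := fun n => hu measurableSet_Ico
  have hstep : ∀ n : ℤ, volume (A n ∩ F) = volume (A (n + 1) ∩ F) := by
    intro n
    rw [← volume_inter_preimage_mul_right hF r (hAm (n + 1))]
    · congr 2
      ext h
      simp only [hAdef, Set.mem_preimage, Set.mem_Ico, hr, Int.cast_add, Int.cast_one]
      constructor <;> rintro ⟨h1, h2⟩ <;> constructor <;> linarith
    · intro γ hγ h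
      simp only [hAdef, Set.mem_preimage, hinv γ hγ h]
  have hconst : ∀ n : ℤ, volume (A n ∩ F) = volume (A 0 ∩ F) := by
    intro n
    induction n using Int.induction_on with
    | zero => rfl
    | succ i ih => rw [← hstep, ih]
    | pred i ih => rw [hstep, sub_add_cancel, ih]
  have hdisj : Pairwise (Function.onFun Disjoint fun n => A n) := by
    intro a b hab
    refine Set.disjoint_left.2 fun h ha hb => hab ?_
    simp only [hAdef, Set.mem_preimage, Set.mem_Ico] at ha hb
    have h1 : ⌊u h⌋ = a := Int.floor_eq_iff.2 ha
    have h2 : ⌊u h⌋ = b := Int.floor_eq_iff.2 hb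
    rw [← h1, h2]
  have hunion : (⋃ n, A n) = Set.univ := by
    refine Set.eq_univ_of_forall fun h => Set.mem_iUnion.2 ⟨⌊u h⌋, ?_⟩
    exact ⟨Int.floor_le _, Int.lt_floor_add_one _⟩
  have hsum : volume F = ∑' n, volume (A n ∩ F) := by
    rw [← measure_iUnion₀]
    · rw [← Set.iUnion_inter, hunion, Set.univ_inter]
    · intro a b hab
      exact ((hdisj hab).mono Set.inter_subset_left Set.inter_subset_left).aedisjoint
    · intro n
      exact (hAm n).nullMeasurableSet.inter hF.nullMeasurableSet
  simp only [hconst] at hsum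
  have hzero : volume (A 0 ∩ F) = 0 := by
    by_contra h0
    rw [ENNReal.tsum_const_eq_top_of_ne_zero h0] at hsum
    exact hFfin hsum
  rw [hzero, tsum_zero] at hsum
  have huniv : (volume : Measure Solv) Set.univ = 0 := by
    have := hF.measure_eq_tsum Set.univ
    rw [this]
    simp [hsum]
  exact (Measure.measure_univ_ne_zero.2 (NeZero.ne _)) huniv

end SolvQuotient

/-! ### The structure of lattices -/

namespace Solv

/-- The inclusion of the normal subgroup `{t = 0}`. -/
noncomputable def planeHom : Multiplicative (ℝ × ℝ) →* Solv where
  toFun v := mk v.toAdd.1 v.toAdd.2 0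
  map_one' := rfl
  map_mul' v w := by ext <;> simp [add_comm]

/-- The coordinate `t` as a homomorphism. -/
def heightHom : Solv →* Multiplicative ℝ where
  toFun g := Multiplicative.ofAdd g.t
  map_one' := rfl
  map_mul' _ _ := rfl

theorem t_zpow (g : Solv) (n : ℤ) : (g ^ n).t = n * g.t := by
  have := map_zpow heightHom g n
  have h2 := congrArg Multiplicative.toAdd this
  rw [toAdd_zpow, zsmul_eq_mul] at h2
  exact h2

theorem mk_zpow (a b : ℝ) (n : ℤ) : (mk a b 0) ^ n = mk (n * a) (n * b) 0 := by
  have := map_zpow planeHom (Multiplicative.ofAdd (a, b)) n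
  rw [← ofAdd_zsmul] at this
  simpa [planeHom] using this.symm

theorem mk_mul_mk (a b c d : ℝ) : mk a b 0 * mk c d 0 = mk (a + c) (b + d) 0 := by
  ext <;> simp [add_comm]

theorem conj_mk (g : Solv) (a b : ℝ) :
    g * mk a b 0 * g⁻¹ = mk (Real.exp g.t * a) (Real.exp (-g.t) * b) 0 := by
  ext
  · simp [← mul_assoc, ← Real.exp_add]
  · simp [← mul_assoc, ← Real.exp_add]
  · simp

end Solv

namespace SolvQuotient

open Solv

/-- The data of a lattice in `Solv₃` which the equidistribution theorems use: the length `τ` of the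
base circle, and an element `(a, b, 0)` which, together with its conjugate, spans a lattice of the
fiber. -/
structure IsLatticeData (Γ : Subgroup Solv) (τ a b : ℝ) : Prop where
  pos : 0 < τ
  heightGroup_eq : heightGroup Γ = AddSubgroup.zmultiples τ
  mem : mk a b 0 ∈ Γ
  mem' : mk (Real.exp τ * a) (Real.exp (-τ) * b) 0 ∈ Γ
  a_ne : a ≠ 0
  b_ne : b ≠ 0
  irrational : ∀ k l : ℤ, (k : ℝ) + l * Real.exp (-τ) = 0 → k = 0 ∧ l = 0

theorem exists_isolating {Γ : Subgroup Solv} (hΓ : DiscreteTopology Γ) :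
    ∃ ε > 0, ∀ γ ∈ Γ, |γ.x| < ε → |γ.q| < ε → |γ.t| < ε → γ = 1 := by
  obtain ⟨U, hU, hU1⟩ := (discreteTopology_subtype_iff'.1 hΓ) 1 Γ.one_mem
  have h1 : (1 : Solv) ∈ U := by
    have : (1 : Solv) ∈ U ∩ (Γ : Set Solv) := by rw [hU1]; rfl
    exact this.1
  obtain ⟨ε, hε, hball⟩ := Metric.isOpen_iff.1 (show IsOpen (X := ℝ × ℝ × ℝ) U from hU)
    ((0, 0, 0) : ℝ × ℝ × ℝ) h1
  refine ⟨ε, hε, fun γ hγ hx hq ht => ?_⟩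
  have : γ ∈ U ∩ (Γ : Set Solv) := by
    refine ⟨hball (show ((γ.x, γ.q, γ.t) : ℝ × ℝ × ℝ) ∈ _ from ?_), hγ⟩
    rw [Metric.mem_ball, Prod.dist_eq, Prod.dist_eq, max_lt_iff, max_lt_iff]
    simp only [Real.dist_eq, sub_zero]
    exact ⟨hx, hq, ht⟩
  rw [hU1] at this
  exact this

theorem exists_zpow_small {ε t₀ c : ℝ} (hε : 0 < ε) (ht : t₀ ≠ 0) :
    ∃ n : ℤ, |Real.exp (n * t₀) * c| < ε := by
  have key : ∀ s : ℝ, s < 0 → ∃ n : ℕ, |Real.exp (n * s) * c| < ε := by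
    intro s hs
    have h1 : Tendsto (fun n : ℕ => |Real.exp (n * s) * c|) atTop (𝓝 |0 * c|) := by
      refine ((Real.tendsto_exp_atBot.comp ?_).mul_const c).abs
      exact tendsto_natCast_atTop_atTop.atTop_mul_const_of_neg hs
    rw [zero_mul, abs_zero] at h1
    exact (h1.eventually (gt_mem_nhds hε)).exists
  rcases lt_or_gt_of_ne ht with h | h
  · obtain ⟨n, hn⟩ := key t₀ h
    exact ⟨n, by simpa using hn⟩
  · obtain ⟨n, hn⟩ := key (-t₀) (by linarith)
    exact ⟨-n, by simpa using hn⟩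

/-- Conjugation by powers of `γ₀` contracts each axis of the plane `t = 0` in one of the two time
directions, so a nontrivial element on an axis would have nontrivial conjugates arbitrarily close to
`1`. -/
theorem coords_ne_zero {Γ : Subgroup Solv} (hΓ : DiscreteTopology Γ) {γ₀ : Solv} (hγ₀ : γ₀ ∈ Γ)
    (ht : γ₀.t ≠ 0) {a b : ℝ} (hv : mk a b 0 ∈ Γ) : (a = 0 → b = 0) ∧ (b = 0 → a = 0) := by
  obtain ⟨ε, hε, hiso⟩ := exists_isolating hΓ
  have hconj : ∀ n : ℤ, mk (Real.exp (n * γ₀.t) * a) (Real.exp (-(n * γ₀.t)) * b) 0 ∈ Γ := by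
    intro n
    have := Γ.mul_mem (Γ.mul_mem (Γ.zpow_mem hγ₀ n) hv) (Γ.inv_mem (Γ.zpow_mem hγ₀ n))
    rwa [conj_mk, t_zpow] at this
  constructor
  · rintro rfl
    obtain ⟨n, hn⟩ := exists_zpow_small (c := b) hε ht
    have := hiso _ (hconj (-n)) (by simpa using hε) (by simpa using hn) (by simpa using hε)
    simpa using congrArg Solv.q this
  · rintro rfl
    obtain ⟨n, hn⟩ := exists_zpow_small (c := a) hε ht
    have := hiso _ (hconj n) (by simpa using hn) (by simpa using hε) (by simpa using hε)
    simpa using congrArg Solv.x this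

theorem exists_isLatticeData {Γ : Subgroup Solv} (hΓ : DiscreteTopology Γ) {F : Set Solv}
    (hF : IsFundamentalDomain Γ F (volume : Measure Solv))
    (hFfin : (volume : Measure Solv) F ≠ ⊤) : ∃ τ a b, IsLatticeData Γ τ a b := by
  have hcount : Countable Γ := countable_of_Lindelof_of_discrete
  obtain ⟨ε, hε, hiso⟩ := exists_isolating hΓ
  -- some element has a nonzero height
  obtain ⟨γ₀, hγ₀, ht₀⟩ : ∃ γ₀ ∈ Γ, γ₀.t ≠ 0 := by
    by_contra! h
    refine not_exists_invariant_translate hF hFfin Solv.t Solv.continuous_t.measurable ?_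
      (geo 1) (fun h => rfl)
    intro γ hγ g
    rw [t_mul, h γ hγ, zero_add]
  -- some nontrivial element has height zero
  obtain ⟨v, hv, hvt, hv1⟩ : ∃ v ∈ Γ, v.t = 0 ∧ v ≠ 1 := by
    by_contra! h
    have hne : Real.exp γ₀.t - 1 ≠ 0 := by
      rw [sub_ne_zero, Ne, Real.exp_eq_one_iff]
      exact ht₀
    -- Commutators have height zero, so under `h` the group is commutative. Then all its elements
    -- share the fixed point `-p` of the affine action of `γ₀` on the `x`-axis, and `exp (-t) * (x +
    -- p)` is an invariant function which `horo 1` increases by `1`.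
    set p := γ₀.x / (Real.exp γ₀.t - 1) with hp
    have hcomm : ∀ γ ∈ Γ, γ.x = p * (Real.exp γ.t - 1) := by
      intro γ hγ
      have h1 := h (γ * γ₀ * (γ₀ * γ)⁻¹)
        (Γ.mul_mem (Γ.mul_mem hγ hγ₀) (Γ.inv_mem (Γ.mul_mem hγ₀ hγ))) (by simp; ring)
      have h2 := congrArg Solv.x (mul_inv_eq_one.1 h1)
      simp only [x_mul] at h2
      rw [hp]
      field_simp
      linarith
    refine not_exists_invariant_translate hF hFfin (fun g => Real.exp (-g.t) * (g.x + p)) ?_ ?_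
      (horo 1) ?_
    · have hx := Solv.continuous_x
      have ht := Solv.continuous_t
      exact (by fun_prop : Continuous fun g : Solv => Real.exp (-g.t) * (g.x + p)).measurable
    · intro γ hγ g
      simp only [t_mul, x_mul, hcomm γ hγ, neg_add, Real.exp_add]
      have : Real.exp (-γ.t) * Real.exp γ.t = 1 := by rw [← Real.exp_add]; simp
      linear_combination (Real.exp (-g.t) * (g.x + p)) * this
    · intro g
      simp only [horo, t_mul, t_mk, x_mul, x_mk, add_zero, mul_one]
      have : Real.exp (-g.t) * Real.exp g.t = 1 := by rw [← Real.exp_add]; simp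
      linear_combination this
  obtain ⟨a, b, rfl⟩ : ∃ a b, v = mk a b 0 := ⟨v.x, v.q, by ext <;> simp [hvt]⟩
  have hab := coords_ne_zero hΓ hγ₀ ht₀ hv
  have ha : a ≠ 0 := by
    intro h
    exact hv1 (by ext <;> simp [h, hab.1 h])
  have hb : b ≠ 0 := fun h => ha (hab.2 h)
  have hconj : ∀ γ ∈ Γ, mk (Real.exp γ.t * a) (Real.exp (-γ.t) * b) 0 ∈ Γ := by
    intro γ hγ
    have := Γ.mul_mem (Γ.mul_mem hγ hv) (Γ.inv_mem hγ)
    rwa [conj_mk] at this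
  -- the heights are discrete
  obtain ⟨δ, hδ, hsmall⟩ : ∃ δ > 0, ∀ s : ℝ, |s| < δ →
      |Real.exp s * a - a| < ε ∧ |Real.exp (-s) * b - b| < ε := by
    have h1 : Tendsto (fun s : ℝ => |Real.exp s * a - a|) (𝓝 0) (𝓝 |Real.exp 0 * a - a|) :=
      Continuous.tendsto (by fun_prop) 0
    have h2 : Tendsto (fun s : ℝ => |Real.exp (-s) * b - b|) (𝓝 0) (𝓝 |Real.exp (-0) * b - b|) :=
      Continuous.tendsto (f := fun s : ℝ => |Real.exp (-s) * b - b|) (by fun_prop) 0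
    simp only [Real.exp_zero, one_mul, sub_self, abs_zero, neg_zero] at h1 h2
    obtain ⟨δ, hδ, h⟩ := Metric.eventually_nhds_iff.1
      ((h1.eventually (gt_mem_nhds hε)).and (h2.eventually (gt_mem_nhds hε)))
    exact ⟨δ, hδ, fun s hs => h (by simpa [Real.dist_eq] using hs)⟩
  have hdisc : ∀ s ∈ heightGroup Γ, |s| < δ → s = 0 := by
    rintro _ ⟨γ, hγ, rfl⟩ hs
    -- The commutator of `γ` with `(a, b, 0)` is too close to `1` to be nontrivial, and `a ≠ 0` then
    -- forces `exp γ.t = 1`.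
    have h1 := Γ.mul_mem (hconj γ hγ) (Γ.inv_mem hv)
    have h2 : (mk a b 0)⁻¹ = mk (-a) (-b) 0 := by ext <;> simp
    rw [h2, mk_mul_mk] at h1
    obtain ⟨h3, h4⟩ := hsmall _ hs
    have h5 := hiso _ h1 (by simpa [sub_eq_add_neg] using h3) (by simpa [sub_eq_add_neg] using h4)
      (by simpa using hε)
    have h6 : Real.exp γ.t * a + -a = 0 := by simpa using congrArg Solv.x h5
    have h7 : Real.exp γ.t = 1 := by
      have : (Real.exp γ.t - 1) * a = 0 := by linarith
      rcases mul_eq_zero.1 this with h | h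
      · linarith
      · exact absurd h ha
    exact Real.exp_eq_one_iff _ |>.1 h7
  obtain ⟨c, hc⟩ := AddSubgroup.cyclic_of_isolated_zero (H := heightGroup Γ) hδ
    (Set.disjoint_left.2 fun s hs hs' => by
      have := hdisc s hs (by rw [abs_of_pos hs'.1]; exact hs'.2)
      exact hs'.1.ne' this)
  rw [← AddSubgroup.zmultiples_eq_closure] at hc
  have hc0 : c ≠ 0 := by
    rintro rfl
    rw [AddSubgroup.zmultiples_zero_eq_bot] at hc
    have : γ₀.t ∈ heightGroup Γ := ⟨γ₀, hγ₀, rfl⟩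
    rw [hc] at this
    exact ht₀ this
  have hτ : heightGroup Γ = AddSubgroup.zmultiples |c| := by
    rcases abs_choice c with h | h
    · rw [h, hc]
    · rw [h, hc, AddSubgroup.zmultiples_neg]
  obtain ⟨γ₁, hγ₁, hγ₁t⟩ : |c| ∈ heightGroup Γ := by
    rw [hτ]; exact AddSubgroup.mem_zmultiples _
  have hv2 := hconj γ₁ hγ₁
  rw [hγ₁t] at hv2
  have hpos : 0 < |c| := abs_pos.2 hc0
  refine ⟨|c|, a, b, hpos, hτ, hv, hv2, ha, hb, fun k l hkl => ?_⟩
  -- This element has `q`-coordinate `b * (k + l * exp (-τ)) = 0`, so its `x`-coordinate vanishes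
  -- too, giving `k + l * exp τ = 0`; the two relations differ by `l * (exp τ - exp (-τ))`.
  have h1 := Γ.mul_mem (Γ.zpow_mem hv k) (Γ.zpow_mem hv2 l)
  rw [mk_zpow, mk_zpow, mk_mul_mk] at h1
  have h2 := (coords_ne_zero hΓ hγ₀ ht₀ h1).2 (by linear_combination b * hkl)
  have h3 : (k : ℝ) + l * Real.exp |c| = 0 := by
    have : a * (k + l * Real.exp |c|) = 0 := by linear_combination h2
    exact (mul_eq_zero.1 this).resolve_left ha
  have h4 : (l : ℝ) * (Real.exp |c| - Real.exp (-|c|)) = 0 := by linear_combination h3 - hkl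
  have h5 : Real.exp (-|c|) < Real.exp |c| := Real.exp_lt_exp.2 (by linarith)
  have h6 : (l : ℝ) = 0 := (mul_eq_zero.1 h4).resolve_right (by linarith)
  rw [h6] at hkl
  exact ⟨by simpa using hkl, by exact_mod_cast h6⟩

/-- A compact set meeting every orbit. -/
noncomputable def cell (τ a b : ℝ) : Set Solv :=
  (fun p : ℝ × ℝ × ℝ => mk (a * (p.1 + p.2.1 * Real.exp τ)) (b * (p.1 + p.2.1 * Real.exp (-τ)))
    p.2.2) '' (Set.Icc 0 1 ×ˢ Set.Icc 0 1 ×ˢ Set.Icc 0 τ)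

theorem isCompact_cell (τ a b : ℝ) : IsCompact (cell τ a b) := by
  refine (isCompact_Icc.prod (isCompact_Icc.prod isCompact_Icc)).image ?_
  exact continuous_mk (by fun_prop) (by fun_prop) (by fun_prop)

namespace IsLatticeData

variable {Γ : Subgroup Solv} {τ a b : ℝ}

theorem exp_sub_ne (h : IsLatticeData Γ τ a b) : Real.exp τ - Real.exp (-τ) ≠ 0 :=
  sub_ne_zero.2 (Real.exp_lt_exp.2 (by linarith [h.pos])).ne'

theorem exists_mul_mem_height (h : IsLatticeData Γ τ a b) (g : Solv) :
    ∃ γ ∈ Γ, (γ * g).t ∈ Set.Icc 0 τ := by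
  obtain ⟨γ, hγ, hγt⟩ : -(⌊g.t / τ⌋ * τ) ∈ heightGroup Γ := by
    rw [h.heightGroup_eq]
    exact ⟨-⌊g.t / τ⌋, by simp⟩
  refine ⟨γ, hγ, ?_⟩
  rw [t_mul, hγt]
  have h1 := Int.floor_le (g.t / τ)
  have h2 := Int.lt_floor_add_one (g.t / τ)
  rw [le_div_iff₀ h.pos] at h1
  rw [div_lt_iff₀ h.pos] at h2
  constructor <;> linarith

theorem exists_mul_mem_cell (h : IsLatticeData Γ τ a b) (g : Solv) :
    ∃ γ ∈ Γ, γ * g ∈ cell τ a b := by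
  obtain ⟨γ, hγ, hγt⟩ := h.exists_mul_mem_height g
  set g' := γ * g with hg'
  have hne := h.exp_sub_ne
  have ha := h.a_ne
  have hb := h.b_ne
  -- `α` and `β` are the coordinates of `(g'.x, g'.q)` in the basis `(a, b)`, `(exp τ * a, exp (-τ)
  -- * b)`; their integer parts are removed by lattice elements of height zero.
  set β := (g'.x / a - g'.q / b) / (Real.exp τ - Real.exp (-τ)) with hβ
  set α := g'.x / a - β * Real.exp τ with hα
  have h1 : a * (α + β * Real.exp τ) = g'.x := by rw [hα]; field_simp; ring
  have h2 : b * (α + β * Real.exp (-τ)) = g'.q := by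
    have : β * (Real.exp τ - Real.exp (-τ)) = g'.x / a - g'.q / b := by
      rw [hβ, div_mul_cancel₀ _ hne]
    have h3 : α + β * Real.exp (-τ) = g'.q / b := by rw [hα]; linear_combination -this
    rw [h3]; field_simp
  have hm := Γ.mul_mem (Γ.zpow_mem h.mem (-⌊α⌋)) (Γ.zpow_mem h.mem' (-⌊β⌋))
  rw [mk_zpow, mk_zpow, mk_mul_mk] at hm
  refine ⟨_, Γ.mul_mem hm hγ, (Int.fract α, Int.fract β, g'.t), ⟨⟨Int.fract_nonneg _,
    (Int.fract_lt_one _).le⟩, ⟨Int.fract_nonneg _, (Int.fract_lt_one _).le⟩, hγt⟩, ?_⟩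
  rw [mul_assoc, ← hg']
  have f1 := Int.floor_add_fract α
  have f2 := Int.floor_add_fract β
  clear_value α β
  ext
  · simp; linear_combination h1 + a * f1 + a * Real.exp τ * f2
  · simp; linear_combination h2 + b * f1 + b * Real.exp (-τ) * f2
  · simp

end IsLatticeData

end SolvQuotient

/-! ### Topology, right translations and invariant measure of `M` -/

namespace SolvQuotient

open Solv

variable {Γ : Subgroup Solv}

theorem isOpenQuotientMap_proj (Γ : Subgroup Solv) : IsOpenQuotientMap (proj Γ) :=
  MulAction.isOpenQuotientMap_quotientMk

theorem continuous_proj (Γ : Subgroup Solv) : Continuous (proj Γ) :=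
  (isOpenQuotientMap_proj Γ).continuous

theorem surjective_proj (Γ : Subgroup Solv) : Function.Surjective (proj Γ) :=
  (isOpenQuotientMap_proj Γ).surjective

theorem proj_mul {γ : Solv} (hγ : γ ∈ Γ) (g : Solv) : proj Γ (γ * g) = proj Γ g :=
  Quotient.sound ⟨⟨γ, hγ⟩, rfl⟩

instance : SecondCountableTopology (SolvQuotient Γ) :=
  ContinuousConstSMul.secondCountableTopology (Γ := Γ) (T := Solv)

instance [DiscreteTopology Γ] : T2Space (SolvQuotient Γ) := by
  have h := Subgroup.properlyDiscontinuousSMul_of_tendsto_cofinite Γ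
    (Subgroup.tendsto_coe_cofinite_of_discrete Γ ⟨inferInstance⟩)
  exact inferInstanceAs (T2Space (Quotient (MulAction.orbitRel Γ Solv)))

theorem IsLatticeData.compactSpace {τ a b : ℝ} (h : IsLatticeData Γ τ a b) :
    CompactSpace (SolvQuotient Γ) := by
  refine ⟨?_⟩
  convert (isCompact_cell τ a b).image (continuous_proj Γ)
  refine (Set.eq_univ_of_forall fun z => ?_).symm
  obtain ⟨g, rfl⟩ := surjective_proj Γ z
  obtain ⟨γ, hγ, hg⟩ := h.exists_mul_mem_cell g
  exact ⟨_, hg, proj_mul hγ g⟩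

/-- The right translations of `Γ \ Solv₃`. -/
noncomputable def rmul : SolvQuotient Γ → Solv → SolvQuotient Γ :=
  Quotient.lift (s := MulAction.orbitRel Γ Solv) (fun g h => proj Γ (g * h)) (by
    rintro a b ⟨γ, rfl⟩
    funext h
    exact Quotient.sound ⟨γ, (mul_assoc (γ : Solv) b h).symm⟩)

@[simp] theorem rmul_proj (g h : Solv) : rmul (proj Γ g) h = proj Γ (g * h) := rfl

@[simp] theorem rmul_one (z : SolvQuotient Γ) : rmul z 1 = z := by
  obtain ⟨g, rfl⟩ := surjective_proj Γ z
  rw [rmul_proj, mul_one]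

theorem rmul_rmul (z : SolvQuotient Γ) (g h : Solv) : rmul (rmul z g) h = rmul z (g * h) := by
  obtain ⟨k, rfl⟩ := surjective_proj Γ z
  simp [mul_assoc]

theorem leafMap_eq (z : SolvQuotient Γ) (w : ℍ) :
    leafMap Γ z w = rmul z (ofUpperHalfPlane w) := by
  obtain ⟨g, rfl⟩ := surjective_proj Γ z
  rfl

theorem continuous_rmul : Continuous fun p : SolvQuotient Γ × Solv => rmul p.1 p.2 := by
  have h := ((isOpenQuotientMap_proj Γ).prodMap (IsOpenQuotientMap.id (X := Solv))).isQuotientMap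
  rw [h.continuous_iff]
  exact (continuous_proj Γ).comp (continuous_fst.mul continuous_snd)

@[fun_prop]
theorem _root_.Continuous.rmul {X : Type*} [TopologicalSpace X] {f : X → SolvQuotient Γ}
    {g : X → Solv} (hf : Continuous f) (hg : Continuous g) :
    Continuous fun y => SolvQuotient.rmul (f y) (g y) :=
  continuous_rmul.comp (hf.prodMk hg)

@[simp] theorem baseProj_proj (g : Solv) : baseProj Γ (proj Γ g) = (g.t : ℝ ⧸ heightGroup Γ) := rfl

theorem baseProj_rmul (z : SolvQuotient Γ) (g : Solv) :
    baseProj Γ (rmul z g) = baseProj Γ z + (g.t : ℝ ⧸ heightGroup Γ) := by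
  obtain ⟨k, rfl⟩ := surjective_proj Γ z
  rw [rmul_proj, baseProj_proj, baseProj_proj, t_mul, QuotientAddGroup.mk_add]

theorem continuous_baseProj : Continuous (baseProj Γ) := by
  rw [(isOpenQuotientMap_proj Γ).isQuotientMap.continuous_iff]
  exact (continuous_quotient_mk' (s := QuotientAddGroup.leftRel (heightGroup Γ))).comp
    Solv.continuous_t

section Haar

variable {F : Set Solv}

theorem haarMeasure_apply {A : Set (SolvQuotient Γ)} (hA : MeasurableSet A) :
    haarMeasure Γ F A = (volume F)⁻¹ * volume (proj Γ ⁻¹' A ∩ F) := by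
  have hA' := (continuous_proj Γ).measurable hA
  rw [haarMeasure, Measure.map_apply (continuous_proj Γ).measurable hA, ProbabilityTheory.cond,
    Measure.smul_apply, Measure.restrict_apply hA', smul_eq_mul]

theorem isProbabilityMeasure_haarMeasure [Countable Γ]
    (hF : IsFundamentalDomain Γ F (volume : Measure Solv))
    (hFfin : (volume : Measure Solv) F ≠ ⊤) : IsProbabilityMeasure (haarMeasure Γ F) := by
  have h0 : (volume : Measure Solv) F ≠ 0 := hF.measure_ne_zero (NeZero.ne _)
  have := ProbabilityTheory.cond_isProbabilityMeasure_of_finite h0 hFfin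
  exact Measure.isProbabilityMeasure_map (continuous_proj Γ).measurable.aemeasurable

theorem measurePreserving_rmul [Countable Γ]
    (hF : IsFundamentalDomain Γ F (volume : Measure Solv)) (g : Solv) :
    MeasurePreserving (fun z => rmul z g) (haarMeasure Γ F) (haarMeasure Γ F) := by
  have hc : Continuous fun z : SolvQuotient Γ => rmul z g := by fun_prop
  refine ⟨hc.measurable, ?_⟩
  ext A hA
  rw [Measure.map_apply hc.measurable hA, haarMeasure_apply (hc.measurable hA),
    haarMeasure_apply hA,
    ← volume_inter_preimage_mul_right hF g ((continuous_proj Γ).measurable hA)]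
  · rfl
  · intro γ hγ h
    rw [Set.mem_preimage, Set.mem_preimage, proj_mul hγ]

end Haar

/-- Right invariance of a measure on `Γ \ Solv₃`. -/
def IsRightInvariant (m : Measure (SolvQuotient Γ)) : Prop :=
  ∀ g : Solv, MeasurePreserving (fun z => rmul z g) m m

theorem IsRightInvariant.integral_rmul {m : Measure (SolvQuotient Γ)} (hm : IsRightInvariant m)
    {f : SolvQuotient Γ → ℝ} (hf : Continuous f) (g : Solv) :
    ∫ z, f (rmul z g) ∂m = ∫ z, f z ∂m := by
  have h := (hm g).map_eq
  conv_rhs => rw [← h]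
  rw [integral_map (hm g).measurable.aemeasurable hf.aestronglyMeasurable]

theorem exists_bound [CompactSpace (SolvQuotient Γ)] {f : SolvQuotient Γ → ℝ}
    (hf : Continuous f) : ∃ B, ∀ z, |f z| ≤ B := by
  obtain ⟨B, hB⟩ := isCompact_univ.exists_bound_of_continuousOn hf.continuousOn
  exact ⟨B, fun z => hB z trivial⟩

end SolvQuotient

/-! ### Second differences and the five point Laplacian -/

/-- A symmetric second difference is a second derivative at an intermediate point. -/
theorem exists_second_difference {φ φ' φ'' : ℝ → ℝ} {s : ℝ} (hs : 0 < s)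
    (h1 : ∀ r, |r| ≤ s → HasDerivAt φ (φ' r) r) (h2 : ∀ r, |r| ≤ s → HasDerivAt φ' (φ'' r) r) :
    ∃ r, |r| ≤ s ∧ φ s + φ (-s) - 2 * φ 0 = s ^ 2 * φ'' r := by
  have hG : ∀ r ∈ Set.Icc 0 s, HasDerivAt (fun r => φ r + φ (-r)) (φ' r - φ' (-r)) r := by
    intro r hr
    have ha := h1 r (by rw [abs_of_nonneg hr.1]; exact hr.2)
    have hb := (h1 (-r) (by rw [abs_neg, abs_of_nonneg hr.1]; exact hr.2)).scomp r (hasDerivAt_neg r)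
    exact (ha.add hb).congr_deriv (by simp [sub_eq_add_neg])
  have hcont : ContinuousOn (fun r => φ r + φ (-r)) (Set.Icc 0 s) :=
    fun r hr => (hG r hr).continuousAt.continuousWithinAt
  -- Cauchy's mean value theorem for `φ r + φ (-r)` against `r ^ 2`, then the ordinary one for `φ'`
  -- on `[-ξ, ξ]`.
  obtain ⟨ξ, hξ, h⟩ := exists_ratio_hasDerivAt_eq_ratio_slope (fun r => φ r + φ (-r))
    (fun r => φ' r - φ' (-r)) hs hcont (fun r hr => hG r ⟨hr.1.le, hr.2.le⟩) (fun r => r ^ 2)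
    (fun r => 2 * r) (by fun_prop) (fun r _ => by simpa using hasDerivAt_pow 2 r)
  obtain ⟨η, hη, h'⟩ := exists_hasDerivAt_eq_slope φ' φ'' (show -ξ < ξ by linarith [hξ.1])
    (fun r hr => (h2 r (abs_le.2 ⟨by linarith [hr.1, hξ.2], by linarith [hr.2, hξ.2]⟩)).continuousAt.continuousWithinAt)
    (fun r hr => h2 r (abs_le.2 ⟨by linarith [hr.1, hξ.2], by linarith [hr.2, hξ.2]⟩))
  refine ⟨η, abs_le.2 ⟨by linarith [hη.1, hξ.2], by linarith [hη.2, hξ.2]⟩, ?_⟩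
  have hξ0 : ξ ≠ 0 := hξ.1.ne'
  rw [h']
  simp only [neg_zero] at h
  have e1 : s ^ 2 * (φ' ξ - φ' (-ξ)) = (φ s + φ (-s) - (φ 0 + φ 0)) * (2 * ξ) := by
    linear_combination h
  rw [sub_neg_eq_add, ← two_mul, ← mul_div_assoc, e1]
  field_simp
  ring

section SecondDifference

variable {E : Type*} [NormedAddCommGroup E] [NormedSpace ℝ E]

theorem ContDiffOn.exists_second_difference {W : E → ℝ} {S : Set E} (hS : IsOpen S)
    (hW : ContDiffOn ℝ 2 W S) {p e : E} {s : ℝ} (hs : 0 < s)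
    (hp : ∀ r : ℝ, |r| ≤ s → p + r • e ∈ S) :
    ∃ r : ℝ, |r| ≤ s ∧ W (p + s • e) + W (p - s • e) - 2 * W p =
      s ^ 2 * fderiv ℝ (fderiv ℝ W) (p + r • e) e e := by
  have hline : ∀ r : ℝ, HasDerivAt (fun r : ℝ => p + r • e) e r := fun r => by
    simpa using ((hasDerivAt_id r).smul_const e).const_add p
  have hat : ∀ x ∈ S, ContDiffAt ℝ 2 W x := fun x hx => hW.contDiffAt (hS.mem_nhds hx)
  obtain ⟨r, hr, h⟩ := _root_.exists_second_difference (φ := fun r : ℝ => W (p + r • e))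
    (φ' := fun r => fderiv ℝ W (p + r • e) e)
    (φ'' := fun r => fderiv ℝ (fderiv ℝ W) (p + r • e) e e) hs
    (fun r hr => ((hat _ (hp r hr)).differentiableAt (by norm_num)).hasFDerivAt.comp_hasDerivAt r
      (hline r))
    (fun r hr => by
      have h1 : ContDiffAt ℝ 1 (fderiv ℝ W) (p + r • e) :=
        (hat _ (hp r hr)).fderiv_right (by norm_num)
      have h2 := (h1.differentiableAt (by norm_num)).hasFDerivAt.comp_hasDerivAt r (hline r)
      exact h2.clm_apply (hasDerivAt_const r e) |>.congr_deriv (by simp))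
  refine ⟨r, hr, ?_⟩
  simpa [sub_eq_add_neg] using h

theorem ContDiffOn.continuousOn_fderiv_fderiv {W : E → ℝ} {S : Set E} (hS : IsOpen S)
    (hW : ContDiffOn ℝ 2 W S) (e : E) :
    ContinuousOn (fun x => fderiv ℝ (fderiv ℝ W) x e e) S := by
  have h1 : ContDiffOn ℝ 1 (fderiv ℝ W) S := hW.fderiv_of_isOpen hS (by norm_num)
  have h2 : ContDiffOn ℝ 0 (fderiv ℝ (fderiv ℝ W)) S := h1.fderiv_of_isOpen hS (by norm_num)
  exact (h2.continuousOn.clm_apply continuousOn_const).clm_apply continuousOn_const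

theorem ContDiffAt.tendsto_second_difference {W : E → ℝ} {p : E} (hW : ContDiffAt ℝ 2 W p)
    (e : E) : Tendsto (fun s : ℝ => (W (p + s • e) + W (p - s • e) - 2 * W p) / s ^ 2) (𝓝[>] 0)
      (𝓝 (fderiv ℝ (fderiv ℝ W) p e e)) := by
  obtain ⟨U, hU, hWU⟩ := hW.contDiffOn (m := 2) le_rfl (by simp)
  obtain ⟨S, hSU, hS, hpS⟩ := mem_nhds_iff.1 (by simpa using hU : U ∈ 𝓝 p)
  have hWS := hWU.mono hSU
  have hc : ContinuousAt (fun r : ℝ => fderiv ℝ (fderiv ℝ W) (p + r • e) e e) 0 := by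
    have h1 := (hWS.continuousOn_fderiv_fderiv hS e).continuousAt (hS.mem_nhds hpS)
    exact ContinuousAt.comp (f := fun r : ℝ => p + r • e) (x := (0 : ℝ)) (by simpa using h1)
      (by fun_prop)
  have hmem : ∀ᶠ r : ℝ in 𝓝 0, p + r • e ∈ S := by
    have : ContinuousAt (fun r : ℝ => p + r • e) 0 := by fun_prop
    exact this (by simpa using hS.mem_nhds hpS)
  rw [Metric.tendsto_nhds]
  intro ε hε
  have h2 := (Metric.tendsto_nhds.1 hc ε hε).and hmem
  obtain ⟨δ, hδ, h3⟩ := Metric.eventually_nhds_iff.1 h2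
  filter_upwards [self_mem_nhdsWithin, nhdsWithin_le_nhds (Metric.ball_mem_nhds (0 : ℝ) hδ)]
    with s hs hsδ
  have hs0 : (0 : ℝ) < s := hs
  have hsδ' : s < δ := by simpa [abs_of_pos hs0] using hsδ
  obtain ⟨r, hr, h⟩ := hWS.exists_second_difference hS hs0 (e := e) (p := p) (fun r hr =>
    (h3 (by simpa using hr.trans_lt hsδ')).2)
  rw [h, mul_div_cancel_left₀ _ (by positivity)]
  simpa using (h3 (y := r) (by simpa using hr.trans_lt hsδ')).1

end SecondDifference

/-- The five point approximation of the Laplacian of a function on `ℂ`. -/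
noncomputable def fivePoint (u : ℂ → ℝ) (w : ℂ) (s : ℝ) : ℝ :=
  (u (w + s) + u (w - s) + u (w + s * Complex.I) + u (w - s * Complex.I) - 4 * u w) / s ^ 2

theorem fivePoint_eq (u : ℂ → ℝ) (w : ℂ) (s : ℝ) : fivePoint u w s =
    (u (w + s • 1) + u (w - s • 1) - 2 * u w) / s ^ 2 +
      (u (w + s • Complex.I) + u (w - s • Complex.I) - 2 * u w) / s ^ 2 := by
  rw [← add_div, fivePoint]
  simp only [Complex.real_smul, mul_one]
  ring

theorem tendsto_fivePoint {u : ℂ → ℝ} {w : ℂ} (hu : ContDiffAt ℝ 2 u w) :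
    Tendsto (fivePoint u w) (𝓝[>] 0) (𝓝 (Laplacian.laplacian u w)) := by
  have h := (hu.tendsto_second_difference 1).add (hu.tendsto_second_difference Complex.I)
  rw [InnerProductSpace.laplacian_eq_iteratedFDeriv_complexPlane]
  simp only [iteratedFDeriv_two_apply]
  exact h.congr fun s => (fivePoint_eq u w s).symm

/-- Each second difference quotient is an actual second derivative at an intermediate point, and
these points stay in the compact set `K ×ˢ closedBall w δ`. The bound feeds dominated convergence as
`s → 0`. -/
theorem exists_bound_fivePoint {E : Type*} [NormedAddCommGroup E] [NormedSpace ℝ E]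
    {W : E × ℂ → ℝ} {S : Set (E × ℂ)} (hS : IsOpen S) (hW : ContDiffOn ℝ 2 W S) {K : Set E}
    (hK : IsCompact K) {w : ℂ} {δ : ℝ} (hKS : K ×ˢ Metric.closedBall w δ ⊆ S) :
    ∃ B, ∀ p ∈ K, ∀ s, 0 < s → s ≤ δ → |fivePoint (fun w => W (p, w)) w s| ≤ B := by
  have key : ∀ e : ℂ, ‖e‖ = 1 → ∃ B, ∀ p ∈ K, ∀ s : ℝ, 0 < s → s ≤ δ →
      |(W (p, w + s • e) + W (p, w - s • e) - 2 * W (p, w)) / s ^ 2| ≤ B := by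
    intro e he
    obtain ⟨B, hB⟩ := (hK.prod (isCompact_closedBall w δ)).exists_bound_of_continuousOn
      ((hW.continuousOn_fderiv_fderiv hS ((0 : E), e)).mono hKS)
    refine ⟨B, fun p hp s hs hsδ => ?_⟩
    have hmem : ∀ r : ℝ, |r| ≤ s → (p, w) + r • ((0 : E), e) ∈ K ×ˢ Metric.closedBall w δ := by
      intro r hr
      refine ⟨by simpa using hp, ?_⟩
      simpa [he] using hr.trans hsδ
    obtain ⟨r, hr, h⟩ := hW.exists_second_difference hS hs (fun r hr => hKS (hmem r hr))
    have h' : W (p, w + s • e) + W (p, w - s • e) - 2 * W (p, w) =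
        s ^ 2 * fderiv ℝ (fderiv ℝ W) ((p, w) + r • ((0 : E), e)) (0, e) (0, e) := by
      simpa using h
    rw [h', mul_div_cancel_left₀ _ (by positivity)]
    exact hB _ (hmem r hr)
  obtain ⟨B₁, hB₁⟩ := key 1 (by simp)
  obtain ⟨B₂, hB₂⟩ := key Complex.I (by simp)
  refine ⟨B₁ + B₂, fun p hp s hs hsδ => ?_⟩
  rw [fivePoint_eq]
  exact (abs_add_le _ _).trans (add_le_add (hB₁ p hp s hs hsδ) (hB₂ p hp s hs hsδ))

/-! ### Leafwise Laplacians and harmonicity of the invariant measure -/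

namespace SolvQuotient

open Solv

variable {Γ : Subgroup Solv}

/-- A `C²` function in the coordinate `w` of the leaves. -/
noncomputable def leafChart (f : SolvQuotient Γ → ℝ) (p : (ℝ × ℝ × ℝ) × ℂ) : ℝ :=
  f (proj Γ (mk (Real.exp p.1.2.2 * p.2.re + p.1.1) p.1.2.1 (p.1.2.2 + Real.log p.2.im)))

theorem isOpen_im_pos {E : Type*} [TopologicalSpace E] : IsOpen {p : E × ℂ | 0 < p.2.im} :=
  isOpen_lt continuous_const (Complex.continuous_im.comp continuous_snd)

theorem IsC2.contDiffOn_leafChart {f : SolvQuotient Γ → ℝ} (hf : IsC2 Γ f) :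
    ContDiffOn ℝ 2 (leafChart f) {p | 0 < p.2.im} := by
  have hre : ContDiff ℝ 2 Complex.re := Complex.reCLM.contDiff
  have him : ContDiff ℝ 2 Complex.im := Complex.imCLM.contDiff
  have hlog : ContDiffOn ℝ 2 (fun p : (ℝ × ℝ × ℝ) × ℂ => Real.log p.2.im) {p | 0 < p.2.im} :=
    (him.comp contDiff_snd).contDiffOn.log fun p hp => (show 0 < p.2.im from hp).ne'
  have h1 : ContDiffOn ℝ 2 (fun p : (ℝ × ℝ × ℝ) × ℂ =>
      ((Real.exp p.1.2.2 * p.2.re + p.1.1, p.1.2.1, p.1.2.2 + Real.log p.2.im) : ℝ × ℝ × ℝ))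
      {p | 0 < p.2.im} := by
    have h2 : ContDiff ℝ 2 (fun p : (ℝ × ℝ × ℝ) × ℂ => p.2.re) := hre.comp contDiff_snd
    refine ContDiffOn.prodMk (ContDiff.contDiffOn (by fun_prop))
      (ContDiffOn.prodMk (ContDiff.contDiffOn (by fun_prop)) (ContDiffOn.add
      (ContDiff.contDiffOn (by fun_prop)) hlog))
  exact ContDiff.comp_contDiffOn (g := fun v : ℝ × ℝ × ℝ => f (proj Γ (Solv.mk v.1 v.2.1 v.2.2)))
    hf h1

theorem leafChart_eq (f : SolvQuotient Γ → ℝ) (g : Solv) {w : ℂ} (hw : 0 < w.im) :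
    leafChart f ((g.x, g.q, g.t), w) = f (leafMap Γ (proj Γ g) ⟨w, hw⟩) := by
  rw [leafMap_eq, rmul_proj, leafChart]
  congr 2
  ext <;> simp [ofUpperHalfPlane, UpperHalfPlane.re, UpperHalfPlane.im]

theorem comp_leafMap_eventuallyEq (f : SolvQuotient Γ → ℝ) (g : Solv) :
    (f ∘ leafMap Γ (proj Γ g)) ∘ UpperHalfPlane.ofComplex =ᶠ[𝓝 Complex.I]
      fun w => leafChart f ((g.x, g.q, g.t), w) := by
  have : ∀ᶠ w : ℂ in 𝓝 Complex.I, 0 < w.im :=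
    (isOpen_lt continuous_const Complex.continuous_im).mem_nhds (by simp)
  filter_upwards [this] with w hw
  rw [leafChart_eq f g hw, Function.comp_apply, Function.comp_apply,
    UpperHalfPlane.ofComplex_apply_of_im_pos hw]

/-- The five point approximation of the leafwise Laplacian. -/
noncomputable def leafFivePoint (f : SolvQuotient Γ → ℝ) (z : SolvQuotient Γ) (s : ℝ) : ℝ :=
  (f (rmul z (horo s)) + f (rmul z (horo (-s))) + f (rmul z (geo (Real.log (1 + s)))) +
    f (rmul z (geo (Real.log (1 - s)))) - 4 * f z) / s ^ 2

/-- The points `i ± s` and `(1 ± s) i` correspond to right translation by `horo (± s)` and `geo (log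
(1 ± s))`. The Laplacian thus becomes a limit of combinations of right translates. -/
theorem leafFivePoint_eq (f : SolvQuotient Γ → ℝ) (g : Solv) (s : ℝ) :
    leafFivePoint f (proj Γ g) s =
      fivePoint (fun w => leafChart f ((g.x, g.q, g.t), w)) Complex.I s := by
  have e1 : g * horo s = mk (Real.exp g.t * s + g.x) g.q g.t := by ext <;> simp [horo]
  have e2 : g * horo (-s) = mk (Real.exp g.t * (-s) + g.x) g.q g.t := by ext <;> simp [horo]
  have e3 : ∀ r, g * geo r = mk g.x g.q (g.t + r) := fun r => by ext <;> simp [geo]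
  rw [leafFivePoint, fivePoint]
  simp only [rmul_proj, leafChart, e1, e2, e3]
  simp [sub_eq_add_neg, mk_eta]

theorem IsC2.tendsto_leafFivePoint {f : SolvQuotient Γ → ℝ} (hf : IsC2 Γ f)
    (z : SolvQuotient Γ) :
    Tendsto (leafFivePoint f z) (𝓝[>] 0) (𝓝 (leafLaplacian Γ f z)) := by
  obtain ⟨g, rfl⟩ := surjective_proj Γ z
  have h1 : ContDiffAt ℝ 2 (fun w => leafChart f ((g.x, g.q, g.t), w)) Complex.I := by
    have := hf.contDiffOn_leafChart.contDiffAt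
      (isOpen_im_pos.mem_nhds (show (0 : ℝ) < ((g.x, g.q, g.t), Complex.I).2.im by simp))
    exact this.comp Complex.I (f := fun w : ℂ => ((g.x, g.q, g.t), w)) (by fun_prop)
  have h2 := tendsto_fivePoint h1
  rw [leafLaplacian, hyperbolicLaplacian]
  have h3 : Laplacian.laplacian ((f ∘ leafMap Γ (proj Γ g)) ∘ UpperHalfPlane.ofComplex)
      (UpperHalfPlane.I : ℂ) =
      Laplacian.laplacian (fun w => leafChart f ((g.x, g.q, g.t), w)) Complex.I :=
    (InnerProductSpace.laplacian_congr_nhds (comp_leafMap_eventuallyEq f g)).eq_of_nhds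
  rw [h3]
  simp only [UpperHalfPlane.I_im, one_pow, one_mul]
  exact h2.congr fun s => (leafFivePoint_eq f g s).symm

theorem IsC2.exists_bound_leafFivePoint {τ a b : ℝ} (h : IsLatticeData Γ τ a b)
    {f : SolvQuotient Γ → ℝ} (hf : IsC2 Γ f) :
    ∃ B, ∀ z, ∀ s, 0 < s → s ≤ 1 / 2 → |leafFivePoint f z s| ≤ B := by
  have hK : IsCompact (show Set (ℝ × ℝ × ℝ) from cell τ a b) := isCompact_cell τ a b
  obtain ⟨B, hB⟩ := exists_bound_fivePoint isOpen_im_pos hf.contDiffOn_leafChart hK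
    (w := Complex.I) (δ := 1 / 2) (by
      rintro ⟨p, w⟩ ⟨-, hw⟩
      have h1 : |(w - Complex.I).im| ≤ 1 / 2 :=
        (Complex.abs_im_le_norm _).trans (by simpa [dist_eq_norm] using hw)
      simp only [Complex.sub_im, Complex.I_im] at h1
      show 0 < w.im
      linarith [(abs_le.1 h1).1])
  refine ⟨B, fun z s hs hs' => ?_⟩
  obtain ⟨g, rfl⟩ := surjective_proj Γ z
  obtain ⟨γ, hγ, hg⟩ := h.exists_mul_mem_cell g
  rw [← proj_mul hγ g, leafFivePoint_eq]
  exact hB _ hg s hs hs'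

theorem IsC2.continuous {f : SolvQuotient Γ → ℝ} (hf : IsC2 Γ f) : Continuous f := by
  rw [(isOpenQuotientMap_proj Γ).isQuotientMap.continuous_iff]
  exact ContDiff.continuous (𝕜 := ℝ) hf

/-- Integrals of leafwise Laplacians are limits of integrals of five point approximations. -/
theorem IsC2.tendsto_integral_leafFivePoint {τ a b : ℝ} (h : IsLatticeData Γ τ a b)
    {f : SolvQuotient Γ → ℝ} (hf : IsC2 Γ f) (ν : Measure (SolvQuotient Γ)) [IsFiniteMeasure ν] :
    Tendsto (fun s => ∫ z, leafFivePoint f z s ∂ν) (𝓝[>] 0)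
      (𝓝 (∫ z, leafLaplacian Γ f z ∂ν)) := by
  obtain ⟨B, hB⟩ := hf.exists_bound_leafFivePoint h
  have hc := hf.continuous
  refine tendsto_integral_filter_of_dominated_convergence (fun _ => B) ?_ ?_
    (integrable_const B) (.of_forall fun z => hf.tendsto_leafFivePoint z)
  · refine .of_forall fun s => Continuous.aestronglyMeasurable ?_
    unfold leafFivePoint
    fun_prop
  · filter_upwards [self_mem_nhdsWithin, nhdsWithin_le_nhds (Iic_mem_nhds
      (show (0 : ℝ) < 1 / 2 by norm_num))] with s hs hs'
    exact .of_forall fun z => hB z s hs hs'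

/-- Translates of `f` all have the same integral, so each five point quotient already has integral
zero. -/
theorem IsRightInvariant.isHarmonic {τ a b : ℝ} (h : IsLatticeData Γ τ a b)
    {m : Measure (SolvQuotient Γ)} [IsFiniteMeasure m] (hm : IsRightInvariant m) :
    IsHarmonic Γ m := by
  intro f hf
  have := h.compactSpace
  have hc := hf.continuous
  refine tendsto_nhds_unique (hf.tendsto_integral_leafFivePoint h m) ?_
  refine tendsto_const_nhds.congr fun s => ?_
  obtain ⟨B, hB⟩ := exists_bound hc
  have hi : ∀ g : Solv, Integrable (fun z => f (rmul z g)) m := fun g =>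
    Integrable.of_bound (C := B) (Continuous.aestronglyMeasurable (by fun_prop))
      (.of_forall fun z => hB _)
  have hi' : Integrable f m := by simpa using hi 1
  have h2 : ∀ g₁ g₂ : Solv, Integrable (fun z => f (rmul z g₁) + f (rmul z g₂)) m :=
    fun _ _ => (hi _).add (hi _)
  have h3 : ∀ g₁ g₂ g₃ : Solv,
      Integrable (fun z => f (rmul z g₁) + f (rmul z g₂) + f (rmul z g₃)) m :=
    fun _ _ _ => (h2 _ _).add (hi _)
  have h4 : ∀ g₁ g₂ g₃ g₄ : Solv, Integrable
      (fun z => f (rmul z g₁) + f (rmul z g₂) + f (rmul z g₃) + f (rmul z g₄)) m :=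
    fun _ _ _ _ => (h3 _ _ _).add (hi _)
  unfold leafFivePoint
  rw [integral_div, integral_sub (h4 _ _ _ _) (hi'.const_mul 4), integral_add (h3 _ _ _) (hi _),
    integral_add (h2 _ _) (hi _), integral_add (hi _) (hi _), integral_const_mul]
  simp only [hm.integral_rmul hc]
  ring

end SolvQuotient

/-! ### Weyl equidistribution on the 2-torus -/

/-- Averages of a function along the orbit segments of a linear flow on the torus. -/
noncomputable def torusAvg (ω : Fin 2 → ℝ) (H : C(UnitAddTorus (Fin 2), ℂ))
    (θ : UnitAddTorus (Fin 2)) (L : ℝ) : ℂ :=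
  ((2 * L)⁻¹ : ℝ) • ∫ ξ in -L..L, H (θ + fun i => ((ξ * ω i : ℝ) : UnitAddCircle))

theorem continuous_torusFlow (ω : Fin 2 → ℝ) (θ : UnitAddTorus (Fin 2)) :
    Continuous fun ξ : ℝ => θ + fun i => ((ξ * ω i : ℝ) : UnitAddCircle) := by
  refine continuous_const.add (continuous_pi fun i => ?_)
  exact (AddCircle.continuous_mk' (1 : ℝ)).comp (by fun_prop)

theorem torusAvg_add (ω : Fin 2 → ℝ) (H K : C(UnitAddTorus (Fin 2), ℂ)) (θ) (L : ℝ) :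
    torusAvg ω (H + K) θ L = torusAvg ω H θ L + torusAvg ω K θ L := by
  simp only [torusAvg, ContinuousMap.add_apply]
  rw [intervalIntegral.integral_add, smul_add]
  · exact (H.continuous.comp (continuous_torusFlow ω θ)).intervalIntegrable _ _
  · exact (K.continuous.comp (continuous_torusFlow ω θ)).intervalIntegrable _ _

theorem torusAvg_smul (ω : Fin 2 → ℝ) (c : ℂ) (H : C(UnitAddTorus (Fin 2), ℂ)) (θ) (L : ℝ) :
    torusAvg ω (c • H) θ L = c * torusAvg ω H θ L := by
  simp only [torusAvg, ContinuousMap.smul_apply, smul_eq_mul, intervalIntegral.integral_const_mul,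
    Complex.real_smul]
  ring

theorem norm_torusAvg_le (ω : Fin 2 → ℝ) (H : C(UnitAddTorus (Fin 2), ℂ)) (θ) {L : ℝ}
    (hL : 0 < L) : ‖torusAvg ω H θ L‖ ≤ ‖H‖ := by
  have h := intervalIntegral.norm_integral_le_of_norm_le_const (a := -L) (b := L) (C := ‖H‖)
    (f := fun ξ => H (θ + fun i => ((ξ * ω i : ℝ) : UnitAddCircle)))
    (fun ξ _ => H.norm_coe_le_norm _)
  rw [torusAvg, norm_smul, Real.norm_eq_abs, abs_of_pos (by positivity)]
  rw [sub_neg_eq_add, abs_of_pos (by linarith)] at h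
  calc (2 * L)⁻¹ * _ ≤ (2 * L)⁻¹ * (‖H‖ * (L + L)) := by gcongr
    _ = ‖H‖ := by field_simp; ring

/-- Along an orbit the character is a pure exponential of nonzero frequency, whose integral over any
interval is bounded; dividing by the length gives `O(1 / L)` uniformly in `θ`. -/
theorem torusAvg_mFourier (ω : Fin 2 → ℝ) {n : Fin 2 → ℤ}
    (hn : (n 0 : ℝ) * ω 0 + n 1 * ω 1 ≠ 0) :
    ∃ C, ∀ θ L, 0 < L → ‖torusAvg ω (UnitAddTorus.mFourier n) θ L‖ ≤ C / L := by
  set s : ℝ := n 0 * ω 0 + n 1 * ω 1 with hs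
  set c : ℂ := 2 * Real.pi * Complex.I * s with hc
  have hc0 : c ≠ 0 := by
    simp [hc, Real.pi_ne_zero, hn]
  refine ⟨1 / ‖c‖, fun θ L hL => ?_⟩
  have h1 : ∀ ξ : ℝ, UnitAddTorus.mFourier n (θ + fun i => ((ξ * ω i : ℝ) : UnitAddCircle)) =
      UnitAddTorus.mFourier n θ * Complex.exp (c * ξ) := by
    intro ξ
    simp only [UnitAddTorus.mFourier, ContinuousMap.coe_mk, Fin.prod_univ_two, Pi.add_apply,
      fourier_apply, smul_add, AddCircle.toCircle_add, Circle.coe_mul]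
    rw [← fourier_apply, ← fourier_apply, ← fourier_apply, ← fourier_apply, fourier_coe_apply,
      fourier_coe_apply, mul_mul_mul_comm, ← Complex.exp_add]
    congr 2
    simp only [hc, hs]
    push_cast
    ring
  have h2 : ‖UnitAddTorus.mFourier n θ‖ ≤ 1 :=
    ((UnitAddTorus.mFourier n).norm_coe_le_norm θ).trans_eq UnitAddTorus.mFourier_norm
  have h3 : ∀ x : ℝ, ‖Complex.exp (c * x)‖ = 1 := by
    intro x
    rw [Complex.norm_exp]
    simp [hc]
  simp only [torusAvg, h1, intervalIntegral.integral_const_mul]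
  rw [integral_exp_mul_complex hc0, norm_smul, norm_mul, norm_div, Real.norm_eq_abs,
    abs_of_pos (by positivity)]
  have h4 : ‖Complex.exp (c * (L : ℝ)) - Complex.exp (c * ((-L : ℝ) : ℂ))‖ ≤ 2 :=
    (norm_sub_le _ _).trans (by rw [h3, h3]; norm_num)
  calc (2 * L)⁻¹ * (_ * (_ / ‖c‖)) ≤ (2 * L)⁻¹ * (1 * (2 / ‖c‖)) := by gcongr
    _ = 1 / ‖c‖ / L := by
      have := norm_ne_zero_iff.2 hc0
      field_simp

/-- Orbit averages converge uniformly, to a limit which does not depend on the orbit. -/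
def TorusEquidistributed (ω : Fin 2 → ℝ) (H : C(UnitAddTorus (Fin 2), ℂ)) : Prop :=
  ∀ ε > 0, ∃ L₀ > 0, ∀ L ≥ L₀, ∀ L' ≥ L₀, ∀ θ θ', ‖torusAvg ω H θ L - torusAvg ω H θ' L'‖ ≤ ε

/-- Averaging does not increase the sup norm, whatever `θ` and `L`, so the property is closed under
uniform limits. Trigonometric polynomials, which are dense, then suffice. -/
theorem TorusEquidistributed.of_near {ω : Fin 2 → ℝ} {H : C(UnitAddTorus (Fin 2), ℂ)}
    (h : ∀ ε > 0, ∃ K, TorusEquidistributed ω K ∧ ‖H - K‖ ≤ ε) : TorusEquidistributed ω H := by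
  intro ε hε
  obtain ⟨K, hK, hHK⟩ := h (ε / 3) (by positivity)
  obtain ⟨L₀, hL₀, hL⟩ := hK (ε / 3) (by positivity)
  refine ⟨L₀, hL₀, fun L h1 L' h2 θ θ' => ?_⟩
  have e : ∀ θ L, torusAvg ω H θ L = torusAvg ω K θ L + torusAvg ω (H - K) θ L := fun θ L => by
    rw [← torusAvg_add, add_sub_cancel]
  rw [e, e, add_sub_add_comm]
  have h3 := hL L h1 L' h2 θ θ'
  have h4 := (norm_torusAvg_le ω (H - K) θ (hL₀.trans_le h1)).trans hHK
  have h5 := (norm_torusAvg_le ω (H - K) θ' (hL₀.trans_le h2)).trans hHK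
  have h6 := norm_add_le (torusAvg ω K θ L - torusAvg ω K θ' L')
    (torusAvg ω (H - K) θ L - torusAvg ω (H - K) θ' L')
  have h7 := norm_sub_le (torusAvg ω (H - K) θ L) (torusAvg ω (H - K) θ' L')
  linarith

/-- Weyl equidistribution for irrational linear flows on the torus. -/
theorem torusEquidistributed {ω : Fin 2 → ℝ}
    (hω : ∀ n : Fin 2 → ℤ, (n 0 : ℝ) * ω 0 + n 1 * ω 1 = 0 → n = 0)
    (H : C(UnitAddTorus (Fin 2), ℂ)) : TorusEquidistributed ω H := by
  have hspan : ∀ K ∈ Submodule.span ℂ (Set.range (UnitAddTorus.mFourier (d := Fin 2))),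
      TorusEquidistributed ω K := by
    intro K hK
    induction hK using Submodule.span_induction with
    | mem K hK =>
      obtain ⟨n, rfl⟩ := hK
      by_cases hn : n = 0
      · subst hn
        intro ε hε
        refine ⟨1, one_pos, fun L hL L' hL' θ θ' => ?_⟩
        have : ∀ θ L, 1 ≤ L → torusAvg ω (UnitAddTorus.mFourier 0) θ L = 1 := by
          intro θ L hL
          rw [UnitAddTorus.mFourier_zero, torusAvg]
          simp only [ContinuousMap.one_apply, intervalIntegral.integral_const, smul_smul]
          have h0 : L ≠ 0 := by positivity
          have : (2 * L)⁻¹ * (L - -L) = 1 := by field_simp; ring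
          rw [this, one_smul]
        rw [this θ L hL, this θ' L' hL', sub_self, norm_zero]
        exact hε.le
      · obtain ⟨C, hC⟩ := torusAvg_mFourier ω (fun h => hn (hω n h))
        intro ε hε
        have hC0 : 0 ≤ C := by
          have := (norm_nonneg _).trans (hC 0 1 one_pos)
          simpa using this
        refine ⟨2 * (C + 1) / ε, by positivity, fun L hL L' hL' θ θ' => ?_⟩
        have hlow : (0 : ℝ) < 2 * (C + 1) / ε := by positivity
        have key : ∀ θ L, L ≥ 2 * (C + 1) / ε →
            ‖torusAvg ω (UnitAddTorus.mFourier n) θ L‖ ≤ ε / 2 := by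
          intro θ L hL
          have hLp := hlow.trans_le hL
          refine (hC θ L hLp).trans ?_
          rw [ge_iff_le, div_le_iff₀ hε] at hL
          rw [div_le_iff₀ hLp]
          linarith
        have := norm_sub_le (torusAvg ω (UnitAddTorus.mFourier n) θ L)
          (torusAvg ω (UnitAddTorus.mFourier n) θ' L')
        linarith [key θ L hL, key θ' L' hL']
    | zero =>
      intro ε hε
      refine ⟨1, one_pos, fun L hL L' hL' θ θ' => ?_⟩
      simp only [torusAvg, ContinuousMap.zero_apply, intervalIntegral.integral_zero, smul_zero,
        sub_self, norm_zero]
      exact hε.le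
    | add H K _ _ hH hK =>
      intro ε hε
      obtain ⟨L₁, hL₁, h₁⟩ := hH (ε / 2) (by positivity)
      obtain ⟨L₂, hL₂, h₂⟩ := hK (ε / 2) (by positivity)
      refine ⟨max L₁ L₂, lt_max_of_lt_left hL₁, fun L hL L' hL' θ θ' => ?_⟩
      rw [torusAvg_add, torusAvg_add, add_sub_add_comm]
      have := norm_add_le (torusAvg ω H θ L - torusAvg ω H θ' L')
        (torusAvg ω K θ L - torusAvg ω K θ' L')
      linarith [h₁ L (le_of_max_le_left hL) L' (le_of_max_le_left hL') θ θ',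
        h₂ L (le_of_max_le_right hL) L' (le_of_max_le_right hL') θ θ']
    | smul c H _ hH =>
      intro ε hε
      obtain ⟨L₀, hL₀, h⟩ := hH (ε / (‖c‖ + 1)) (by positivity)
      refine ⟨L₀, hL₀, fun L hL L' hL' θ θ' => ?_⟩
      rw [torusAvg_smul, torusAvg_smul, ← mul_sub, norm_mul]
      calc ‖c‖ * _ ≤ (‖c‖ + 1) * (ε / (‖c‖ + 1)) := by
            gcongr
            · linarith
            · exact h L hL L' hL' θ θ'
        _ = ε := by field_simp
  refine .of_near fun ε hε => ?_
  have hH : H ∈ (Submodule.span ℂ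
      (Set.range (UnitAddTorus.mFourier (d := Fin 2)))).topologicalClosure := by
    rw [UnitAddTorus.span_mFourier_closure_eq_top]; trivial
  obtain ⟨K, hK, hd⟩ := Metric.mem_closure_iff.1 hH ε hε
  exact ⟨K, hspan K hK, by rw [← dist_eq_norm]; exact hd.le⟩

/-! ### Uniform equidistribution of horocycles in the fibres -/

namespace SolvQuotient

open Solv

variable {Γ : Subgroup Solv} {τ a b : ℝ}

/-- The covering of `M` by `torus × ℝ`. -/
noncomputable def cellMap (Γ : Subgroup Solv) (τ a b : ℝ) (p : (Fin 2 → ℝ) × ℝ) :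
    SolvQuotient Γ :=
  proj Γ (mk (a * (p.1 0 + p.1 1 * Real.exp τ)) (b * (p.1 0 + p.1 1 * Real.exp (-τ))) p.2)

theorem continuous_cellMap : Continuous (cellMap Γ τ a b) :=
  (continuous_proj Γ).comp (continuous_mk (by fun_prop) (by fun_prop) (by fun_prop))

/-- The covering of the torus bundle by the product of the torus and the line. -/
noncomputable def torusProj : C((Fin 2 → ℝ) × ℝ, UnitAddTorus (Fin 2) × ℝ) where
  toFun := Prod.map (fun v i => (v i : UnitAddCircle)) id
  continuous_toFun := ((IsOpenQuotientMap.piMap fun _ =>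
    QuotientAddGroup.isOpenQuotientMap_mk).prodMap IsOpenQuotientMap.id).continuous

theorem isQuotientMap_torusProj : IsQuotientMap torusProj :=
  ((IsOpenQuotientMap.piMap fun _ => QuotientAddGroup.isOpenQuotientMap_mk).prodMap
    IsOpenQuotientMap.id).isQuotientMap

/-- Integer translations of the torus coordinates are left multiplications by products of powers of
the two given elements of `Γ`. -/
theorem IsLatticeData.factorsThrough (h : IsLatticeData Γ τ a b) :
    Function.FactorsThrough (cellMap Γ τ a b) torusProj := by
  rintro ⟨v, s⟩ ⟨w, s'⟩ hvw
  obtain ⟨h1, h2⟩ := Prod.ext_iff.1 hvw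
  obtain rfl : s = s' := h2
  have h3 : ∀ i, ∃ k : ℤ, v i = k + w i := by
    intro i
    have := congrFun h1 i
    obtain ⟨k, hk⟩ := AddSubgroup.mem_zmultiples_iff.1 (QuotientAddGroup.eq.1 this)
    refine ⟨-k, ?_⟩
    have hk' : (k : ℝ) = -v i + w i := by simpa using hk
    push_cast
    linarith
  obtain ⟨k, hk⟩ := h3 0
  obtain ⟨l, hl⟩ := h3 1
  have hm := Γ.mul_mem (Γ.zpow_mem h.mem k) (Γ.zpow_mem h.mem' l)
  rw [mk_zpow, mk_zpow, mk_mul_mk] at hm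
  rw [cellMap, cellMap, ← proj_mul hm (Solv.mk (a * (w 0 + w 1 * Real.exp τ)) _ _)]
  congr 1
  ext
  · simp only [hk, hl, x_mk, x_mul, t_mk, Real.exp_zero, one_mul]; ring
  · simp only [hk, hl, q_mk, q_mul, t_mk, neg_zero, Real.exp_zero, one_mul]; ring
  · simp

/-- The parametrization of the fibers by the torus. -/
noncomputable def IsLatticeData.torusMap (h : IsLatticeData Γ τ a b) :
    C(UnitAddTorus (Fin 2) × ℝ, SolvQuotient Γ) :=
  isQuotientMap_torusProj.lift ⟨cellMap Γ τ a b, continuous_cellMap⟩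
    h.factorsThrough

theorem IsLatticeData.torusMap_apply (h : IsLatticeData Γ τ a b) (v : Fin 2 → ℝ) (s : ℝ) :
    h.torusMap (fun i => (v i : UnitAddCircle), s) = cellMap Γ τ a b (v, s) :=
  DFunLike.congr_fun (isQuotientMap_torusProj.lift_comp
    ⟨cellMap Γ τ a b, continuous_cellMap⟩ h.factorsThrough) (v, s)

/-- The direction of the horocycles in the torus. -/
noncomputable def slope (τ a : ℝ) : Fin 2 → ℝ :=
  ![-(Real.exp (-τ) / (a * (Real.exp τ - Real.exp (-τ)))), 1 / (a * (Real.exp τ - Real.exp (-τ)))]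

/-- The slope solves `v 0 + v 1 * exp τ = 1 / a` and `v 0 + v 1 * exp (-τ) = 0`: it is the vector of
displacement `1` in `x` and `0` in `q`. A resonance reads `n 1 - n 0 * exp (-τ) = 0`, which
`irrational` excludes. -/
theorem IsLatticeData.slope_irrational (h : IsLatticeData Γ τ a b) (n : Fin 2 → ℤ)
    (hn : (n 0 : ℝ) * slope τ a 0 + n 1 * slope τ a 1 = 0) : n = 0 := by
  have ha := h.a_ne
  have he := h.exp_sub_ne
  simp only [slope, Matrix.cons_val_zero, Matrix.cons_val_one] at hn
  field_simp at hn
  obtain ⟨h1, h2⟩ := h.irrational (n 1) (-n 0) (by push_cast; linarith)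
  ext i
  fin_cases i
  · simpa using h2
  · exact h1

theorem IsLatticeData.torusMap_flow (h : IsLatticeData Γ τ a b) (g : Solv) :
    ∃ θ, ∀ ξ : ℝ, rmul (proj Γ g) (horo ξ) =
      h.torusMap (θ + fun i => (((Real.exp g.t * ξ) * slope τ a i : ℝ) : UnitAddCircle), g.t) := by
  have ha := h.a_ne
  have hb := h.b_ne
  have he := h.exp_sub_ne
  -- The base point consists of the coordinates of `(g.x, g.q)` in the lattice basis. The speed `exp
  -- g.t` appears because `g * horo ξ` moves `x` by `exp g.t * ξ`.
  refine ⟨fun i => ((![(g.q / b * Real.exp τ - g.x / a * Real.exp (-τ)) /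
    (Real.exp τ - Real.exp (-τ)), (g.x / a - g.q / b) / (Real.exp τ - Real.exp (-τ))] i : ℝ) :
    UnitAddCircle), fun ξ => ?_⟩
  have := h.torusMap_apply (fun i => ![(g.q / b * Real.exp τ - g.x / a * Real.exp (-τ)) /
    (Real.exp τ - Real.exp (-τ)), (g.x / a - g.q / b) / (Real.exp τ - Real.exp (-τ))] i +
      (Real.exp g.t * ξ) * slope τ a i) g.t
  simp only [AddCircle.coe_add] at this
  refine Eq.trans ?_ this.symm
  rw [rmul_proj, cellMap]
  congr 1
  ext
  · simp only [horo, slope, x_mul, x_mk, Matrix.cons_val_zero, Matrix.cons_val_one]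
    field_simp
    ring
  · simp only [horo, slope, q_mul, q_mk, Matrix.cons_val_zero, Matrix.cons_val_one]
    field_simp
    ring
  · simp [horo]

end SolvQuotient

namespace SolvQuotient

open Solv

variable {Γ : Subgroup Solv} {τ a b : ℝ}

/-- Averages along segments of horocycles. -/
noncomputable def horoAvg (f : SolvQuotient Γ → ℝ) (z : SolvQuotient Γ) (L : ℝ) : ℝ :=
  (2 * L)⁻¹ * ∫ ξ in -L..L, f (rmul z (horo ξ))

theorem continuous_rmul_horo (z : SolvQuotient Γ) : Continuous fun ξ : ℝ => rmul z (horo ξ) :=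
  continuous_const.rmul continuous_horo

theorem abs_horoAvg_le {f : SolvQuotient Γ → ℝ} {B : ℝ} (hB : ∀ z, |f z| ≤ B)
    (z : SolvQuotient Γ) (L : ℝ) : |horoAvg f z L| ≤ B := by
  have hB0 : 0 ≤ B := (abs_nonneg _).trans (hB z)
  have h := intervalIntegral.norm_integral_le_of_norm_le_const (a := -L) (b := L) (C := B)
    (f := fun ξ => f (rmul z (horo ξ))) (fun ξ _ => hB _)
  rw [sub_neg_eq_add, ← two_mul, Real.norm_eq_abs] at h
  rw [horoAvg, abs_mul, abs_inv]
  rcases eq_or_ne L 0 with rfl | hL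
  · simpa using hB0
  · have : 0 < |2 * L| := abs_pos.2 (by simpa using hL)
    calc |2 * L|⁻¹ * _ ≤ |2 * L|⁻¹ * (B * |2 * L|) := by gcongr
      _ = B := by field_simp

theorem horoAvg_const (c : ℝ) (z : SolvQuotient Γ) {L : ℝ} (hL : 0 < L) :
    horoAvg (fun _ => c) z L = c := by
  simp only [horoAvg, intervalIntegral.integral_const, smul_eq_mul]
  field_simp
  ring

/-- The restriction of a function to the fibers, as functions on the torus. -/
noncomputable def IsLatticeData.fiberFun (h : IsLatticeData Γ τ a b)
    (f : C(SolvQuotient Γ, ℝ)) : C(ℝ, C(UnitAddTorus (Fin 2), ℂ)) :=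
  ContinuousMap.curry ⟨fun p : ℝ × UnitAddTorus (Fin 2) => (f (h.torusMap (p.2, p.1)) : ℂ),
    by fun_prop⟩

theorem IsLatticeData.horoAvg_eq (h : IsLatticeData Γ τ a b) (f : C(SolvQuotient Γ, ℝ))
    (g : Solv) : ∃ θ, ∀ L, (horoAvg f (proj Γ g) L : ℂ) =
      torusAvg (slope τ a) (h.fiberFun f g.t) θ (Real.exp g.t * L) := by
  obtain ⟨θ, hθ⟩ := h.torusMap_flow g
  refine ⟨θ, fun L => ?_⟩
  have h1 := intervalIntegral.integral_comp_mul_left (a := -L) (b := L)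
    (fun ξ : ℝ => h.fiberFun f g.t (θ + fun i => ((ξ * slope τ a i : ℝ) : UnitAddCircle)))
    (Real.exp_ne_zero g.t)
  have h2 : (fun ξ : ℝ => h.fiberFun f g.t
      (θ + fun i => (((Real.exp g.t * ξ) * slope τ a i : ℝ) : UnitAddCircle))) =
      fun ξ => (f (rmul (proj Γ g) (horo ξ)) : ℂ) := by
    funext ξ
    rw [hθ ξ]
    rfl
  rw [h2, intervalIntegral.integral_ofReal, mul_neg] at h1
  rw [torusAvg, horoAvg, Complex.ofReal_mul, h1, Complex.real_smul, Complex.real_smul,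
    ← mul_assoc, ← Complex.ofReal_mul]
  congr 2
  rw [← mul_inv]
  ring_nf

/-- The fibre functions vary continuously with `t` in the sup norm, so a threshold for `t` works
with a worse `ε` near `t`, and `[0, τ]` is compact. -/
theorem IsLatticeData.uniform_torusAvg (h : IsLatticeData Γ τ a b) (f : C(SolvQuotient Γ, ℝ))
    {ε : ℝ} (hε : 0 < ε) : ∃ L₀ > 0, ∀ t ∈ Set.Icc 0 τ, ∀ L ≥ L₀, ∀ L' ≥ L₀, ∀ θ θ',
      ‖torusAvg (slope τ a) (h.fiberFun f t) θ L -
        torusAvg (slope τ a) (h.fiberFun f t) θ' L'‖ ≤ ε := by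
  refine (isCompact_Icc (a := (0 : ℝ)) (b := τ)).induction_on (p := fun S => ∃ L₀ > 0, ∀ t ∈ S,
    ∀ L ≥ L₀, ∀ L' ≥ L₀, ∀ θ θ', ‖torusAvg (slope τ a) (h.fiberFun f t) θ L -
      torusAvg (slope τ a) (h.fiberFun f t) θ' L'‖ ≤ ε) ?_ ?_ ?_ ?_
  · exact ⟨1, one_pos, fun t ht => absurd ht (Set.notMem_empty t)⟩
  · intro s t hst ht
    obtain ⟨L₀, hL₀, H⟩ := ht
    exact ⟨L₀, hL₀, fun r hr => H r (hst hr)⟩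
  · intro s t hs ht
    obtain ⟨L₁, hL₁, H₁⟩ := hs
    obtain ⟨L₂, hL₂, H₂⟩ := ht
    refine ⟨max L₁ L₂, lt_max_of_lt_left hL₁, fun r hr L hL L' hL' θ θ' => ?_⟩
    rcases hr with hr | hr
    · exact H₁ r hr L (le_of_max_le_left hL) L' (le_of_max_le_left hL') θ θ'
    · exact H₂ r hr L (le_of_max_le_right hL) L' (le_of_max_le_right hL') θ θ'
  · intro t ht
    have hε3 : 0 < ε / 3 := by positivity
    refine ⟨{s | ‖h.fiberFun f s - h.fiberFun f t‖ < ε / 3}, mem_nhdsWithin_of_mem_nhds ?_, ?_⟩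
    · have := Metric.tendsto_nhds.1 ((h.fiberFun f).continuous.tendsto t) (ε / 3) hε3
      simp only [dist_eq_norm] at this
      exact this
    · obtain ⟨L₀, hL₀, H⟩ := torusEquidistributed h.slope_irrational (h.fiberFun f t) (ε / 3) hε3
      refine ⟨L₀, hL₀, fun s hs L hL L' hL' θ θ' => ?_⟩
      have e : ∀ θ L, torusAvg (slope τ a) (h.fiberFun f s) θ L =
          torusAvg (slope τ a) (h.fiberFun f t) θ L +
          torusAvg (slope τ a) (h.fiberFun f s - h.fiberFun f t) θ L := fun θ L => by
        rw [← torusAvg_add, add_sub_cancel]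
      rw [e, e, add_sub_add_comm]
      have hs' : ‖h.fiberFun f s - h.fiberFun f t‖ < ε / 3 := hs
      have h3 := H L hL L' hL' θ θ'
      have h4 := norm_torusAvg_le (slope τ a) (h.fiberFun f s - h.fiberFun f t) θ (hL₀.trans_le hL)
      have h5 := norm_torusAvg_le (slope τ a) (h.fiberFun f s - h.fiberFun f t) θ'
        (hL₀.trans_le hL')
      refine (norm_add_le _ _).trans ?_
      have h7 := norm_sub_le (torusAvg (slope τ a) (h.fiberFun f s - h.fiberFun f t) θ L)
        (torusAvg (slope τ a) (h.fiberFun f s - h.fiberFun f t) θ' L')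
      linarith

theorem IsLatticeData.horoAvg_cauchy (h : IsLatticeData Γ τ a b) (f : C(SolvQuotient Γ, ℝ))
    {ε : ℝ} (hε : 0 < ε) : ∃ L₀ > 0, ∀ L ≥ L₀, ∀ L' ≥ L₀, ∀ g g' : Solv, g.t = g'.t →
      |horoAvg f (proj Γ g) L - horoAvg f (proj Γ g') L'| ≤ ε := by
  obtain ⟨L₀, hL₀, H⟩ := h.uniform_torusAvg f hε
  refine ⟨L₀, hL₀, fun L hL L' hL' g g' hgg' => ?_⟩
  obtain ⟨γ, hγ, ht⟩ := h.exists_mul_mem_height g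
  rw [← proj_mul hγ g, ← proj_mul hγ g']
  obtain ⟨θ, hθ⟩ := h.horoAvg_eq f (γ * g)
  obtain ⟨θ', hθ'⟩ := h.horoAvg_eq f (γ * g')
  have e : (γ * g').t = (γ * g).t := by simp [hgg']
  -- After moving the height into `[0, τ]`, a segment of parameter `L` has parameter `exp t * L ≥ L`
  -- in the torus, so the threshold survives.
  have h1 : (1 : ℝ) ≤ Real.exp (γ * g).t := Real.one_le_exp ht.1
  rw [← Real.norm_eq_abs, ← Complex.norm_real, Complex.ofReal_sub, hθ, hθ', e]
  exact H _ ht _ (by nlinarith) _ (by nlinarith) θ θ'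

/-- The mean of a function over the fibers of `M` over the circle: horocycles are uniformly
equidistributed in the fibers. -/
theorem IsLatticeData.exists_fiberMean (h : IsLatticeData Γ τ a b) (f : C(SolvQuotient Γ, ℝ)) :
    ∃ fb : C(ℝ ⧸ heightGroup Γ, ℝ), ∀ ε > 0, ∃ L₀ > 0, ∀ L ≥ L₀, ∀ z,
      |horoAvg f z L - fb (baseProj Γ z)| ≤ ε := by
  have hcauchy : ∀ t, CauchySeq fun n : ℕ => horoAvg f (proj Γ (geo t)) n := by
    intro t
    rw [Metric.cauchySeq_iff']
    intro ε hε
    obtain ⟨L₀, hL₀, H⟩ := h.horoAvg_cauchy f (half_pos hε)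
    obtain ⟨N, hN⟩ := exists_nat_ge L₀
    refine ⟨N, fun n hn => ?_⟩
    have := H n (hN.trans (by exact_mod_cast hn)) N hN (geo t) (geo t) rfl
    exact this.trans_lt (half_lt_self hε)
  choose F hF using fun t => cauchySeq_tendsto_of_complete (hcauchy t)
  have key : ∀ ε > 0, ∃ L₀ > 0, ∀ L ≥ L₀, ∀ g : Solv,
      |horoAvg f (proj Γ g) L - F g.t| ≤ ε := by
    intro ε hε
    obtain ⟨L₀, hL₀, H⟩ := h.horoAvg_cauchy f hε
    refine ⟨L₀, hL₀, fun L hL g => ?_⟩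
    refine le_of_tendsto ((tendsto_const_nhds.sub (hF g.t)).abs) ?_
    filter_upwards [tendsto_natCast_atTop_atTop.eventually_ge_atTop L₀] with n hn
    exact H L hL n hn g (geo g.t) rfl
  have hper : ∀ γ ∈ Γ, ∀ t, F (γ.t + t) = F t := by
    intro γ hγ t
    -- `geo t` and `γ * geo t` project to the same point of `M`, so one horocyclic average
    -- approximates both values of `F`.
    have h0 : ∀ ε > 0, |F t - F (γ.t + t)| ≤ ε := by
      intro ε hε
      obtain ⟨L₀, hL₀, H⟩ := key (ε / 2) (half_pos hε)
      have h1 := H L₀ le_rfl (geo t)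
      have h2 := H L₀ le_rfl (γ * geo t)
      rw [proj_mul hγ] at h2
      have e1 : (geo t).t = t := rfl
      have e2 : (γ * geo t).t = γ.t + t := rfl
      rw [e1] at h1
      rw [e2] at h2
      rw [abs_le] at *
      constructor <;> linarith [h1.1, h1.2, h2.1, h2.2]
    have h1 : |F t - F (γ.t + t)| ≤ 0 := le_of_forall_pos_le_add fun ε hε => by
      simpa using h0 ε hε
    linarith [abs_nonpos_iff.1 h1]
  have hcont : Continuous F := by
    have hu : TendstoUniformly (fun (n : ℕ) t => horoAvg f (proj Γ (geo t)) n) F atTop := by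
      rw [Metric.tendstoUniformly_iff]
      intro ε hε
      obtain ⟨L₀, hL₀, H⟩ := key (ε / 2) (half_pos hε)
      filter_upwards [tendsto_natCast_atTop_atTop.eventually_ge_atTop L₀] with n hn t
      rw [dist_comm]
      exact (H n hn (geo t)).trans_lt (half_lt_self hε)
    refine hu.continuous (Frequently.of_forall fun n => ?_)
    have hc : Continuous fun p : ℝ × ℝ => f (rmul (proj Γ (geo p.1)) (horo p.2)) :=
      f.continuous.comp ((((continuous_proj Γ).comp continuous_geo).comp continuous_fst).rmul
        (continuous_horo.comp continuous_snd))
    exact continuous_const.mul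
      (intervalIntegral.continuous_parametric_intervalIntegral_of_continuous' hc _ _)
  refine ⟨⟨Quotient.lift (s := QuotientAddGroup.leftRel (heightGroup Γ)) F ?_,
    hcont.quotient_lift _⟩, ?_⟩
  · intro s t hst
    obtain ⟨γ, hγ, hγt⟩ := QuotientAddGroup.leftRel_apply.1 hst
    rw [show t = γ.t + s by linarith, hper γ hγ]
  · intro ε hε
    obtain ⟨L₀, hL₀, H⟩ := key ε hε
    refine ⟨L₀, hL₀, fun L hL z => ?_⟩
    obtain ⟨g, rfl⟩ := surjective_proj Γ z
    exact H L hL g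

end SolvQuotient

/-! ### The profile and its periodization -/

/-- For `t < 0` the radicand is negative and `Real.sqrt` returns `0`, so no case distinction is
needed. -/
theorem solvProfile_eq (t : ℝ) :
    solvProfile t = 2 / Real.pi * Real.sqrt (Real.exp (-t) - Real.exp (-2 * t)) := by
  rw [solvProfile]
  split_ifs with h
  · rfl
  · rw [Real.sqrt_eq_zero_of_nonpos, mul_zero]
    rw [sub_nonpos]
    exact Real.exp_le_exp.2 (by linarith)

theorem continuous_solvProfile : Continuous solvProfile := by
  rw [funext solvProfile_eq]
  fun_prop

theorem solvProfile_nonneg (t : ℝ) : 0 ≤ solvProfile t := by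
  rw [solvProfile_eq]
  positivity

theorem solvProfile_of_nonpos {t : ℝ} (ht : t ≤ 0) : solvProfile t = 0 := by
  rw [solvProfile_eq, Real.sqrt_eq_zero_of_nonpos, mul_zero]
  rw [sub_nonpos]
  exact Real.exp_le_exp.2 (by linarith)

theorem solvProfile_le (t : ℝ) : solvProfile t ≤ Real.exp (-(|t| / 2)) := by
  rcases le_total t 0 with ht | ht
  · rw [solvProfile_of_nonpos ht]; positivity
  · rw [solvProfile_eq, abs_of_nonneg ht]
    have h1 : 2 / Real.pi ≤ 1 := (div_le_one Real.pi_pos).2 (by linarith [Real.pi_gt_three])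
    have h2 : Real.sqrt (Real.exp (-t) - Real.exp (-2 * t)) ≤ Real.exp (-(t / 2)) := by
      rw [Real.sqrt_le_left (by positivity), ← Real.exp_nat_mul]
      have := Real.exp_pos (-2 * t)
      have e : ((2 : ℕ) : ℝ) * -(t / 2) = -t := by push_cast; ring
      rw [e]
      linarith
    calc _ ≤ 1 * Real.exp (-(t / 2)) := by gcongr
      _ = _ := one_mul _

/-- On `t ≥ 0`, `exp (t / 2) * solvProfile t` is a multiple of `√(1 - exp (-t))`, which is
nondecreasing. The bound limits the decrease of the periodization when `t` grows by `ε`. -/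
theorem solvProfile_add_ge (t : ℝ) {ε : ℝ} (hε : 0 ≤ ε) :
    Real.exp (-(ε / 2)) * solvProfile t ≤ solvProfile (t + ε) := by
  rcases le_total t 0 with ht | ht
  · rw [solvProfile_of_nonpos ht, mul_zero]
    exact solvProfile_nonneg _
  · rw [solvProfile_eq, solvProfile_eq, mul_left_comm]
    gcongr
    refine Real.le_sqrt_of_sq_le ?_
    have h0 : 0 ≤ Real.exp (-t) - Real.exp (-2 * t) :=
      sub_nonneg.2 (Real.exp_le_exp.2 (by linarith))
    rw [mul_pow, Real.sq_sqrt h0, ← Real.exp_nat_mul]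
    have e : ((2 : ℕ) : ℝ) * -(ε / 2) = -ε := by push_cast; ring
    rw [e, mul_sub, ← Real.exp_add, ← Real.exp_add, show -(t + ε) = -ε + -t by ring]
    gcongr
    linarith

theorem integrable_solvProfile_and_integral :
    Integrable solvProfile ∧ ∫ t, solvProfile t = 1 := by
  -- With `v = √(exp s - 1)` this is `(2 / π) * (arctan v - v / (1 + v ^ 2))`, whose `v`-derivative
  -- is `(2 / π) * 2 v ^ 2 / (1 + v ^ 2) ^ 2`, the profile times `ds / dv`.
  set A : ℝ → ℝ := fun s => 2 / Real.pi * (Real.arctan (Real.sqrt (Real.exp s - 1)) -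
    Real.sqrt (Real.exp s - 1) * Real.exp (-s)) with hA
  have hcont : Continuous A := by fun_prop
  have hder : ∀ s ∈ Set.Ioi (0 : ℝ), HasDerivAt A (solvProfile s) s := by
    intro s hs
    have hs' : 0 < Real.exp s - 1 := by
      have := Real.one_lt_exp_iff.2 hs
      linarith
    have hv0 := Real.sqrt_pos.2 hs'
    have h1 : HasDerivAt (fun s => Real.sqrt (Real.exp s - 1))
        (Real.exp s / (2 * Real.sqrt (Real.exp s - 1))) s :=
      ((Real.hasDerivAt_exp s).sub_const 1).sqrt hs'.ne'
    have h2 : HasDerivAt (fun s : ℝ => Real.exp (-s)) (-Real.exp (-s)) s := by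
      simpa using (hasDerivAt_neg s).exp
    have h3 := ((h1.arctan).sub (h1.mul h2)).const_mul (2 / Real.pi)
    refine h3.congr_deriv ?_
    rw [solvProfile_eq]
    have e1 : Real.exp (-s) - Real.exp (-2 * s) = (Real.exp s - 1) * (Real.exp (-s)) ^ 2 := by
      have : Real.exp s * Real.exp (-s) = 1 := by rw [← Real.exp_add]; simp
      rw [← Real.exp_nat_mul]
      rw [show ((2 : ℕ) : ℝ) * -s = -s + -s by push_cast; ring, show -2 * s = -s + -s by ring,
        Real.exp_add]
      linear_combination -Real.exp (-s) * this
    rw [e1, Real.sqrt_mul hs'.le, Real.sqrt_sq (Real.exp_pos _).le, Real.sq_sqrt hs'.le]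
    set v := Real.sqrt (Real.exp s - 1)
    have e2 : v ^ 2 = Real.exp s - 1 := Real.sq_sqrt hs'.le
    rw [Real.exp_neg]
    have e3 : Real.exp s = 1 + v ^ 2 := by linarith
    rw [e3]
    have : (1 + v ^ 2) ≠ 0 := by positivity
    rw [add_sub_cancel]
    field_simp
    ring
  have hlim : Tendsto A atTop (𝓝 1) := by
    have hsq : Tendsto (fun s => Real.sqrt (Real.exp s - 1)) atTop atTop :=
      Real.tendsto_sqrt_atTop.comp (tendsto_atTop_add_const_right _ _ Real.tendsto_exp_atTop)
    have h1 : Tendsto (fun s => Real.arctan (Real.sqrt (Real.exp s - 1))) atTop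
        (𝓝 (Real.pi / 2)) :=
      (tendsto_nhds_of_tendsto_nhdsWithin Real.tendsto_arctan_atTop).comp hsq
    have h2 : Tendsto (fun s => Real.sqrt (Real.exp s - 1) * Real.exp (-s)) atTop (𝓝 0) := by
      have h3 : Tendsto (fun s : ℝ => Real.exp (-(s / 2))) atTop (𝓝 0) :=
        Real.tendsto_exp_atBot.comp (tendsto_neg_atTop_atBot.comp
          (tendsto_id.atTop_div_const (by norm_num)))
      refine squeeze_zero (fun s => by positivity) (fun s => ?_) h3
      have h4 : Real.sqrt (Real.exp s - 1) ≤ Real.exp (s / 2) := by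
        rw [Real.sqrt_le_left (by positivity), ← Real.exp_nat_mul]
        have e : ((2 : ℕ) : ℝ) * (s / 2) = s := by push_cast; ring
        rw [e]
        linarith
      calc _ ≤ Real.exp (s / 2) * Real.exp (-s) := by gcongr
        _ = _ := by rw [← Real.exp_add]; ring_nf
    have h3 := (h1.sub h2).const_mul (2 / Real.pi)
    have e : 2 / Real.pi * (Real.pi / 2 - 0) = 1 := by
      have := Real.pi_ne_zero
      field_simp
      ring
    rwa [e] at h3
  have hA0 : A 0 = 0 := by simp [hA]
  have hint : IntegrableOn solvProfile (Set.Ioi 0) :=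
    integrableOn_Ioi_deriv_of_nonneg hcont.continuousWithinAt hder
      (fun s _ => solvProfile_nonneg s) hlim
  have hval : ∫ s in Set.Ioi 0, solvProfile s = 1 := by
    rw [integral_Ioi_of_hasDerivAt_of_nonneg hcont.continuousWithinAt hder
      (fun s _ => solvProfile_nonneg s) hlim, hA0, sub_zero]
  have hsupp : ∀ s ∉ Set.Ioi (0 : ℝ), solvProfile s = 0 := fun s hs =>
    solvProfile_of_nonpos (not_lt.1 hs)
  refine ⟨(integrableOn_iff_integrable_of_support_subset fun s hs => ?_).1 hint, ?_⟩
  · by_contra h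
    exact hs (hsupp s h)
  · rw [← hval, setIntegral_eq_integral_of_forall_compl_eq_zero hsupp]

theorem integrable_solvProfile : Integrable solvProfile := integrable_solvProfile_and_integral.1

theorem integral_solvProfile : ∫ t, solvProfile t = 1 := integrable_solvProfile_and_integral.2

section Periodization

variable {τ : ℝ}

/-- The terms of the periodization of `solvProfile`. -/
noncomputable def periodTerm (τ : ℝ) (k : ℤ) : C(ℝ, ℝ) where
  toFun t := τ * solvProfile (t + k * τ)
  continuous_toFun := continuous_const.mul (continuous_solvProfile.comp (by fun_prop))

theorem summable_exp_abs_int (hτ : 0 < τ) : Summable fun k : ℤ => Real.exp (-(|(k : ℝ)| * τ / 2)) := by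
  have h : Summable fun n : ℕ => Real.exp (n * -(τ / 2)) :=
    Real.summable_exp_nat_mul_iff.2 (by linarith)
  refine Summable.of_nat_of_neg (h.congr fun n => ?_) (h.congr fun n => ?_)
  · simp; ring
  · simp; ring

theorem abs_periodTerm_le (hτ : 0 < τ) {A t : ℝ} (ht : |t| ≤ A) (k : ℤ) :
    |periodTerm τ k t| ≤ τ * Real.exp (A / 2) * Real.exp (-(|(k : ℝ)| * τ / 2)) := by
  have h1 : |(k : ℝ)| * τ ≤ |t + k * τ| + A := by
    have := abs_sub (t + k * τ) t
    rw [add_sub_cancel_left, abs_mul, abs_of_pos hτ] at this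
    linarith
  change |τ * solvProfile (t + k * τ)| ≤ _
  rw [abs_of_nonneg (mul_nonneg hτ.le (solvProfile_nonneg _)), mul_assoc, ← Real.exp_add]
  gcongr
  refine (solvProfile_le _).trans (Real.exp_le_exp.2 ?_)
  linarith

theorem summable_restrict_periodTerm (hτ : 0 < τ) (K : TopologicalSpace.Compacts ℝ) :
    Summable fun k : ℤ => ‖(periodTerm τ k).restrict (K : Set ℝ)‖ := by
  obtain ⟨A, hA⟩ := K.isCompact.exists_bound_of_continuousOn (f := fun t : ℝ => t) (by fun_prop)
  refine Summable.of_nonneg_of_le (fun _ => norm_nonneg _) (fun k => ?_)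
    ((summable_exp_abs_int hτ).mul_left (τ * Real.exp (A / 2)))
  rw [ContinuousMap.norm_le _ (by positivity)]
  rintro ⟨t, ht⟩
  exact abs_periodTerm_le hτ (hA t ht) k

/-- The periodization of `solvProfile`. -/
noncomputable def periodProfile (τ : ℝ) : C(ℝ, ℝ) := ∑' k, periodTerm τ k

theorem hasSum_periodProfile (hτ : 0 < τ) (t : ℝ) :
    HasSum (fun k : ℤ => τ * solvProfile (t + k * τ)) (periodProfile τ t) :=
  ContinuousMap.hasSum_apply
    (ContinuousMap.summable_of_locally_summable_norm (summable_restrict_periodTerm hτ)).hasSum t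

theorem periodProfile_nonneg (hτ : 0 < τ) (t : ℝ) : 0 ≤ periodProfile τ t :=
  (hasSum_periodProfile hτ t).nonneg fun _ => mul_nonneg hτ.le (solvProfile_nonneg _)

theorem periodProfile_add_period (hτ : 0 < τ) (t : ℝ) :
    periodProfile τ (t + τ) = periodProfile τ t := by
  have h := (Equiv.addRight (1 : ℤ)).hasSum_iff.2 (hasSum_periodProfile hτ t)
  refine (hasSum_periodProfile hτ (t + τ)).unique (h.congr_fun fun k => ?_)
  simp only [Function.comp_apply, Equiv.coe_addRight, Int.cast_add, Int.cast_one]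
  ring_nf

/-- From `0` to `ε` the summand `k = 0` gains order `√ε`, while by `solvProfile_add_ge` the other
summands together lose only `O(ε)`; so the sum has infinite right slope at `0`. -/
theorem periodProfile_not_const (hτ : 0 < τ) (c : ℝ) (hc : ∀ t, periodProfile τ t = c) :
    False := by
  have hc0 : 0 ≤ c := hc 0 ▸ periodProfile_nonneg hτ 0
  have key : ∀ ε, 0 < ε → τ * solvProfile ε ≤ c * (ε / 2) := by
    intro ε hε
    have h := (hasSum_periodProfile hτ ε).sub
      ((hasSum_periodProfile hτ 0).mul_left (Real.exp (-(ε / 2))))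
    -- All summands of `h` are nonnegative, so their sum dominates the one with `k = 0`, which is `τ
    -- * solvProfile ε`.
    have h1 := le_hasSum h 0 (fun k _ => by
      have := mul_le_mul_of_nonneg_left (solvProfile_add_ge (k * τ) hε.le) hτ.le
      rw [zero_add, add_comm ε]
      linarith)
    simp only [Int.cast_zero, zero_mul, add_zero, solvProfile_of_nonpos le_rfl, mul_zero,
      sub_zero, hc] at h1
    have h2 := Real.add_one_le_exp (-(ε / 2))
    nlinarith
  -- Take `ε = r ^ 2` and use `solvProfile (r ^ 2) ≥ r / π`; letting `r → 0` is then absurd.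
  have key2 : ∀ r, 0 < r → r ≤ 1 / 2 → τ / Real.pi ≤ c / 2 * r := by
    intro r hr hr2
    have h1 := key (r ^ 2) (by positivity)
    have hr1 : r ^ 2 ≤ 1 / 4 := by nlinarith
    have h2 : r / 2 ≤ Real.sqrt (Real.exp (-r ^ 2) - Real.exp (-2 * r ^ 2)) := by
      refine Real.le_sqrt_of_sq_le ?_
      have e1 := Real.add_one_le_exp (-r ^ 2)
      have e2 := Real.add_one_le_exp (r ^ 2)
      have e3 : Real.exp (r ^ 2) * Real.exp (-r ^ 2) = 1 := by rw [← Real.exp_add]; simp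
      have e4 : Real.exp (-2 * r ^ 2) = Real.exp (-r ^ 2) * Real.exp (-r ^ 2) := by
        rw [← Real.exp_add]; ring_nf
      have e5 : Real.exp (-r ^ 2) ≤ 1 - r ^ 2 / 2 := by
        have := Real.exp_pos (-r ^ 2)
        nlinarith [mul_le_mul_of_nonneg_right e2 this.le]
      rw [e4]
      nlinarith
    rw [solvProfile_eq] at h1
    have h3 : τ * (2 / Real.pi * (r / 2)) ≤ c * (r ^ 2 / 2) :=
      (mul_le_mul_of_nonneg_left (mul_le_mul_of_nonneg_left h2
        (by have := Real.pi_pos; positivity)) hτ.le).trans h1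
    have h4 : τ / Real.pi * r ≤ c / 2 * r * r := by
      calc τ / Real.pi * r = τ * (2 / Real.pi * (r / 2)) := by ring
        _ ≤ _ := h3
        _ = _ := by ring
    exact le_of_mul_le_mul_right h4 hr
  have hlim : Tendsto (fun r : ℝ => c / 2 * r) (𝓝[>] 0) (𝓝 (c / 2 * 0)) :=
    (Continuous.tendsto (by fun_prop) 0).mono_left nhdsWithin_le_nhds
  rw [mul_zero] at hlim
  have := ge_of_tendsto hlim (b := τ / Real.pi) (by
    filter_upwards [self_mem_nhdsWithin, nhdsWithin_le_nhds (Iic_mem_nhds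
      (show (0 : ℝ) < 1 / 2 by norm_num))] with r h1 h2
    exact key2 r h1 h2)
  have h2 : 0 < τ / Real.pi := div_pos hτ Real.pi_pos
  linarith

/-- Integrals against the periodization. -/
theorem integral_solvProfile_mul (hτ : 0 < τ) {φ : ℝ → ℝ} (hφ : Continuous φ)
    (hper : ∀ t, φ (t + τ) = φ t) :
    τ * ∫ s, solvProfile s * φ s = ∫ s in (0 : ℝ)..τ, periodProfile τ s * φ s := by
  have hperz : ∀ (k : ℤ) t, φ (t + k * τ) = φ t := fun k t => by
    have : Function.Periodic φ τ := hper
    simpa using this.int_mul k t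
  obtain ⟨B, hB⟩ : ∃ B, ∀ t, |φ t| ≤ B := by
    obtain ⟨B, hB⟩ := isCompact_Icc.exists_bound_of_continuousOn
      (hφ.continuousOn (s := Set.Icc 0 (0 + τ)))
    refine ⟨B, fun t => ?_⟩
    obtain ⟨y, hy, h⟩ := Function.Periodic.exists_mem_Ico (f := φ) hper hτ t 0
    rw [h]
    exact hB y ⟨hy.1, hy.2.le⟩
  have hint : Integrable fun s => solvProfile s * φ s :=
    integrable_solvProfile.mul_bdd (c := B) hφ.aestronglyMeasurable (.of_forall hB)
  -- The line is cut into unit intervals after the rescaling `s = τ * x`; by periodicity of `φ` only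
  -- the profile sees the shifts.
  have h1 := (hint.comp_mul_left' hτ.ne').hasSum_intervalIntegral_comp_add_int
  have e1 : ∀ k : ℤ, ∫ x in (0 : ℝ)..1, solvProfile (τ * (x + k)) * φ (τ * (x + k)) =
      τ⁻¹ * ∫ x in (0 : ℝ)..τ, solvProfile (x + k * τ) * φ x := by
    intro k
    have := intervalIntegral.integral_comp_mul_left (a := 0) (b := 1)
      (fun x => solvProfile (x + k * τ) * φ (x + k * τ)) hτ.ne'
    simp only [mul_zero, mul_one, smul_eq_mul] at this
    simp only [hperz] at this
    rw [← this]
    refine intervalIntegral.integral_congr fun x _ => ?_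
    rw [show τ * (x + k) = τ * x + k * τ by ring, hperz]
  rw [Measure.integral_comp_mul_left (fun s => solvProfile s * φ s), abs_of_pos (inv_pos.2 hτ),
    smul_eq_mul] at h1
  simp only [e1] at h1
  have h2 := h1.mul_left (τ * τ)
  let fk : ℤ → C(ℝ, ℝ) := fun k => periodTerm τ k * ⟨φ, hφ⟩
  have h3 : HasSum (fun k : ℤ => ∫ x in (0 : ℝ)..τ, fk k x)
      (∫ x in (0 : ℝ)..τ, ∑' k, fk k x) := by
    refine intervalIntegral.hasSum_intervalIntegral_of_summable_norm ?_
    let K : TopologicalSpace.Compacts ℝ := ⟨Set.uIcc 0 τ, isCompact_uIcc⟩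
    refine Summable.of_nonneg_of_le (fun _ => norm_nonneg _) (fun k => ?_)
      ((summable_restrict_periodTerm hτ K).mul_right
        ‖(⟨φ, hφ⟩ : C(ℝ, ℝ)).restrict (K : Set ℝ)‖)
    exact norm_mul_le ((periodTerm τ k).restrict (K : Set ℝ))
      ((⟨φ, hφ⟩ : C(ℝ, ℝ)).restrict (K : Set ℝ))
  have e2 : ∀ x, ∑' k, fk k x = periodProfile τ x * φ x := fun x =>
    ((hasSum_periodProfile hτ x).mul_right (φ x)).tsum_eq
  simp only [e2] at h3
  have e3 : τ * τ * (τ⁻¹ * ∫ s, solvProfile s * φ s) = τ * ∫ s, solvProfile s * φ s := by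
    field_simp
  rw [e3] at h2
  refine h2.unique (h3.congr_fun fun k => ?_)
  have : τ * τ * (τ⁻¹ * ∫ x in (0 : ℝ)..τ, solvProfile (x + k * τ) * φ x) =
    τ * ∫ x in (0 : ℝ)..τ, solvProfile (x + k * τ) * φ x := by field_simp
  rw [this, ← intervalIntegral.integral_const_mul]
  refine intervalIntegral.integral_congr fun x _ => ?_
  change τ * (solvProfile (x + k * τ) * φ x) = τ * solvProfile (x + k * τ) * φ x
  ring

end Periodization

/-! ### Fibrewise means and the invariant measure -/

namespace SolvQuotient

open Solv

variable {Γ : Subgroup Solv} {τ a b : ℝ}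

/-- `fb` is the function of the fiberwise means of `f`: horocycles are uniformly equidistributed. -/
def IsFiberMean (f : SolvQuotient Γ → ℝ) (fb : C(ℝ ⧸ heightGroup Γ, ℝ)) : Prop :=
  ∀ ε > 0, ∃ L₀ > 0, ∀ L ≥ L₀, ∀ z, |horoAvg f z L - fb (baseProj Γ z)| ≤ ε

/-- Inserted into the disk asymptotics, this case yields the growth of the area of disks. -/
theorem isFiberMean_one : IsFiberMean (Γ := Γ) (fun _ => 1) 1 := by
  intro ε hε
  refine ⟨1, one_pos, fun L hL z => ?_⟩
  rw [horoAvg_const _ _ (by linarith : 0 < L)]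
  simpa using hε.le

theorem IsFiberMean.abs_le {f : SolvQuotient Γ → ℝ} {fb : C(ℝ ⧸ heightGroup Γ, ℝ)}
    (hfb : IsFiberMean f fb) {B : ℝ} (hB : ∀ z, |f z| ≤ B) (y : ℝ ⧸ heightGroup Γ) :
    |fb y| ≤ B := by
  obtain ⟨t, rfl⟩ := QuotientAddGroup.mk_surjective y
  refine le_of_forall_pos_le_add fun ε hε => ?_
  obtain ⟨L₀, -, H⟩ := hfb ε hε
  have h1 := H L₀ le_rfl (proj Γ (geo t))
  have h2 := abs_horoAvg_le hB (proj Γ (geo t)) L₀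
  have h3 : baseProj Γ (proj Γ (geo t)) = (t : ℝ ⧸ heightGroup Γ) := rfl
  rw [h3] at h1
  rw [_root_.abs_le] at *
  constructor <;> linarith [h1.1, h1.2, h2.1, h2.2]

theorem integral_interval_swap [CompactSpace (SolvQuotient Γ)] {m : Measure (SolvQuotient Γ)}
    [IsFiniteMeasure m] {f : ℝ → SolvQuotient Γ → ℝ} (hf : Continuous (Function.uncurry f))
    (c d : ℝ) : ∫ s in c..d, ∫ z, f s z ∂m = ∫ z, (∫ s in c..d, f s z) ∂m := by
  refine intervalIntegral_integral_swap ?_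
  obtain ⟨B, hB⟩ := ((isCompact_uIcc (a := c) (b := d)).prod
    (isCompact_univ (X := SolvQuotient Γ))).exists_bound_of_continuousOn hf.continuousOn
  have : IsFiniteMeasure (volume.restrict (Set.uIoc c d)) :=
    ⟨by rw [Measure.restrict_apply_univ]; exact measure_Ioc_lt_top⟩
  refine Integrable.of_bound (C := B) hf.aestronglyMeasurable ?_
  have h1 : ∀ᵐ s ∂(volume.restrict (Set.uIoc c d)), s ∈ Set.uIoc c d :=
    ae_restrict_mem measurableSet_uIoc
  filter_upwards [Measure.quasiMeasurePreserving_fst.ae h1] with p hp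
  exact hB p ⟨Set.uIoc_subset_uIcc hp, trivial⟩

theorem integrable_of_continuous [CompactSpace (SolvQuotient Γ)] {m : Measure (SolvQuotient Γ)}
    [IsFiniteMeasure m] {f : SolvQuotient Γ → ℝ} (hf : Continuous f) : Integrable f m := by
  obtain ⟨B, hB⟩ := exists_bound hf
  exact Integrable.of_bound (C := B) hf.aestronglyMeasurable (.of_forall hB)

theorem continuous_coe : Continuous fun t : ℝ => (t : ℝ ⧸ heightGroup Γ) :=
  QuotientAddGroup.isOpenQuotientMap_mk.continuous

theorem IsLatticeData.coe_add_period (h : IsLatticeData Γ τ a b) (t : ℝ) :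
    ((t + τ : ℝ) : ℝ ⧸ heightGroup Γ) = t := by
  rw [QuotientAddGroup.eq, h.heightGroup_eq]
  exact ⟨-1, by simp⟩

/-- The invariant measure projects to the normalized length on the circle. -/
theorem IsLatticeData.integral_baseProj (h : IsLatticeData Γ τ a b)
    {m : Measure (SolvQuotient Γ)} [IsProbabilityMeasure m] (hm : IsRightInvariant m)
    (φ : C(ℝ ⧸ heightGroup Γ, ℝ)) :
    τ * ∫ z, φ (baseProj Γ z) ∂m = ∫ s in (0 : ℝ)..τ, φ (s : ℝ ⧸ heightGroup Γ) := by
  have := h.compactSpace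
  have hp := continuous_baseProj (Γ := Γ)
  -- Invariance under `geo s` rotates the circle; averaging over a full turn replaces `φ` by its
  -- mean.
  have h1 : ∀ s : ℝ, ∫ z, φ (baseProj Γ z) ∂m =
      ∫ z, φ (baseProj Γ z + (s : ℝ ⧸ heightGroup Γ)) ∂m := by
    intro s
    rw [← hm.integral_rmul (f := fun z => φ (baseProj Γ z)) (by fun_prop) (geo s)]
    simp only [baseProj_rmul]
    rfl
  have h2 : τ * ∫ z, φ (baseProj Γ z) ∂m =
      ∫ s in (0 : ℝ)..τ, ∫ z, φ (baseProj Γ z + (s : ℝ ⧸ heightGroup Γ)) ∂m := by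
    simp only [← h1, intervalIntegral.integral_const, sub_zero, smul_eq_mul]
  have hc : Continuous fun s : ℝ => (s : ℝ ⧸ heightGroup Γ) := continuous_coe
  rw [h2, integral_interval_swap (by unfold Function.uncurry; fun_prop)]
  have h3 : ∀ z, ∫ s in (0 : ℝ)..τ, φ (baseProj Γ z + (s : ℝ ⧸ heightGroup Γ)) =
      ∫ s in (0 : ℝ)..τ, φ (s : ℝ ⧸ heightGroup Γ) := by
    intro z
    obtain ⟨t, ht⟩ := QuotientAddGroup.mk_surjective (baseProj Γ z)
    have hper : Function.Periodic (fun s : ℝ => φ (s : ℝ ⧸ heightGroup Γ)) τ := fun s => by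
      simp only [h.coe_add_period]
    have e1 := hper.intervalIntegral_add_eq t 0
    rw [zero_add] at e1
    rw [← e1, ← ht]
    have e2 := intervalIntegral.integral_comp_add_left (a := 0) (b := τ)
      (fun s : ℝ => φ (s : ℝ ⧸ heightGroup Γ)) t
    rw [add_zero] at e2
    exact e2
  simp [h3]

/-- Integrals against functions on the circle only depend on the fiberwise means. -/
theorem IsFiberMean.integral_mul [CompactSpace (SolvQuotient Γ)]
    {m : Measure (SolvQuotient Γ)} [IsProbabilityMeasure m] (hm : IsRightInvariant m)
    {f : SolvQuotient Γ → ℝ} (hf : Continuous f) {fb : C(ℝ ⧸ heightGroup Γ, ℝ)}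
    (hfb : IsFiberMean f fb) (φ : C(ℝ ⧸ heightGroup Γ, ℝ)) :
    ∫ z, φ (baseProj Γ z) * f z ∂m = ∫ z, φ (baseProj Γ z) * fb (baseProj Γ z) ∂m := by
  have hp := continuous_baseProj (Γ := Γ)
  have hh := continuous_horo
  obtain ⟨B, hB⟩ := exists_bound (f := fun z => φ (baseProj Γ z)) (by fun_prop)
  have hB0 : 0 ≤ B + 1 := by
    by_contra hneg
    have hz := (abs_nonneg _).trans (hB (proj Γ 1))
    linarith
  have hjoint : Continuous fun p : ℝ × SolvQuotient Γ => f (rmul p.2 (horo p.1)) :=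
    hf.comp (continuous_snd.rmul (hh.comp continuous_fst))
  have hbase : ∀ (z : SolvQuotient Γ) ξ, baseProj Γ (rmul z (horo ξ)) = baseProj Γ z :=
    fun z ξ => by rw [baseProj_rmul]; simp [horo]
  -- Right translation by `horo ξ` preserves both `m` and the base coordinate, so `f` may be
  -- replaced by its horocyclic averages, which are uniformly close to `fb ∘ baseProj`.
  have h1 : ∀ L, 0 < L → ∫ z, φ (baseProj Γ z) * f z ∂m =
      ∫ z, φ (baseProj Γ z) * horoAvg f z L ∂m := by
    intro L hL
    have h2 : ∀ z, φ (baseProj Γ z) * horoAvg f z L =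
        (2 * L)⁻¹ * ∫ ξ in -L..L, φ (baseProj Γ z) * f (rmul z (horo ξ)) := by
      intro z
      rw [intervalIntegral.integral_const_mul, horoAvg]
      ring
    simp only [h2]
    rw [integral_const_mul, ← integral_interval_swap
      (f := fun ξ z => φ (baseProj Γ z) * f (rmul z (horo ξ)))]
    · have h3 : ∀ ξ : ℝ, ∫ z, φ (baseProj Γ z) * f (rmul z (horo ξ)) ∂m =
          ∫ z, φ (baseProj Γ z) * f z ∂m := by
        intro ξ
        rw [← hm.integral_rmul (f := fun z => φ (baseProj Γ z) * f z) (by fun_prop) (horo ξ)]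
        simp only [hbase]
      simp only [h3, intervalIntegral.integral_const, smul_eq_mul]
      field_simp
      ring
    · have : Continuous fun p : ℝ × SolvQuotient Γ => φ (baseProj Γ p.2) :=
        φ.continuous.comp (hp.comp continuous_snd)
      exact this.mul hjoint
  have hcav : ∀ L, Continuous fun z : SolvQuotient Γ => horoAvg f z L := fun L =>
    continuous_const.mul (intervalIntegral.continuous_parametric_intervalIntegral_of_continuous'
      (f := fun (z : SolvQuotient Γ) ξ => f (rmul z (horo ξ)))
      (hjoint.comp continuous_swap) _ _)
  have h4 : |∫ z, φ (baseProj Γ z) * f z ∂m - ∫ z, φ (baseProj Γ z) * fb (baseProj Γ z) ∂m| ≤ 0 := by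
    refine le_of_forall_pos_le_add fun ε hε => ?_
    obtain ⟨L₀, hL₀, H⟩ := hfb (ε / (B + 2)) (by apply div_pos hε; linarith)
    have hc1 : Continuous fun z => φ (baseProj Γ z) * horoAvg f z L₀ :=
      (φ.continuous.comp hp).mul (hcav L₀)
    rw [h1 L₀ hL₀, ← integral_sub (integrable_of_continuous hc1)
      (integrable_of_continuous (by fun_prop)), zero_add]
    have hle : ∀ z, ‖φ (baseProj Γ z) * horoAvg f z L₀ -
        φ (baseProj Γ z) * fb (baseProj Γ z)‖ ≤ ε := by
      intro z
      rw [← mul_sub, norm_mul]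
      have e1 : ‖φ (baseProj Γ z)‖ ≤ B + 2 := by
        have := hB z
        rw [Real.norm_eq_abs]
        linarith
      calc _ ≤ (B + 2) * (ε / (B + 2)) := by
            gcongr
            · linarith
            · exact H L₀ le_rfl z
        _ = ε := mul_div_cancel₀ _ (by linarith)
    have hfin := norm_integral_le_of_norm_le_const (μ := m) (.of_forall hle)
    rwa [probReal_univ, mul_one] at hfin
  exact sub_eq_zero.1 (abs_nonpos_iff.1 h4)

end SolvQuotient

/-! ### The hyperbolic plane in horocyclic coordinates -/

namespace UpperHalfPlane

/-- Horocyclic coordinates `x + i e^t` on the upper half-plane. -/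
noncomputable def horocyclic (p : ℝ × ℝ) : ℍ := ⟨⟨p.1, Real.exp p.2⟩, Real.exp_pos _⟩

@[simp] theorem horocyclic_re (p : ℝ × ℝ) : (horocyclic p).re = p.1 := rfl
@[simp] theorem horocyclic_im (p : ℝ × ℝ) : (horocyclic p).im = Real.exp p.2 := rfl

theorem continuous_horocyclic : Continuous horocyclic := by
  rw [UpperHalfPlane.isEmbedding_coe.continuous_iff]
  have : Continuous fun p : ℝ × ℝ => Complex.equivRealProdCLM.symm (p.1, Real.exp p.2) := by
    fun_prop
  exact this

theorem injective_horocyclic : Function.Injective horocyclic := by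
  intro p q h
  have h1 : p.1 = q.1 := congrArg UpperHalfPlane.re h
  have h2 : Real.exp p.2 = Real.exp q.2 := congrArg UpperHalfPlane.im h
  exact Prod.ext h1 (Real.exp_injective h2)

theorem measurableEmbedding_horocyclic : MeasurableEmbedding horocyclic :=
  continuous_horocyclic.measurableEmbedding injective_horocyclic

/-- With `y = exp t`, the area `dx dy / y ^ 2` becomes `exp (-t) dx dt`. -/
theorem volume_eq_map_horocyclic : (volume : Measure ℍ) =
    ((volume : Measure (ℝ × ℝ)).withDensity
      fun p => ((Real.exp (-p.2)).toNNReal : ENNReal)).map horocyclic := by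
  ext s hs
  have hms : MeasurableSet (horocyclic ⁻¹' s) := continuous_horocyclic.measurable hs
  rw [Measure.map_apply continuous_horocyclic.measurable hs, withDensity_apply _ hms,
    volume_eq_lintegral, ← lintegral_indicator
      (measurableEmbedding_coe.measurableSet_image.mpr hs), ← lintegral_indicator hms]
  set G : ℂ → ENNReal := ((↑) '' s : Set ℂ).indicator fun z => ↑((1 / ‖z.im‖₊) ^ 2 : NNReal)
    with hG
  have hGm : Measurable G := by
    refine Measurable.indicator ?_ (measurableEmbedding_coe.measurableSet_image.mpr hs)
    fun_prop
  rw [← Complex.volume_preserving_equiv_real_prod.symm.lintegral_comp hGm]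
  rw [Measure.volume_eq_prod, lintegral_prod _ (by
    exact (hGm.comp Complex.measurableEquivRealProd.symm.measurable).aemeasurable),
    lintegral_prod _ (by
      refine (Measurable.indicator ?_ hms).aemeasurable
      fun_prop)]
  refine lintegral_congr fun x => ?_
  have h1 : ∫⁻ y : ℝ, G (Complex.measurableEquivRealProd.symm (x, y)) =
      ∫⁻ y in Set.Ioi (0 : ℝ), G (Complex.measurableEquivRealProd.symm (x, y)) := by
    rw [← lintegral_indicator measurableSet_Ioi]
    refine lintegral_congr fun y => ?_
    by_cases hy : y ∈ Set.Ioi (0 : ℝ)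
    · rw [Set.indicator_of_mem hy]
    · rw [Set.indicator_of_notMem hy, hG, Set.indicator_of_notMem]
      rintro ⟨w, -, hw⟩
      have h0 : (w : ℂ).im = y := congrArg Complex.im hw
      exact hy (h0 ▸ w.im_pos : 0 < y)
  have h2 := lintegral_image_eq_lintegral_abs_deriv_mul (s := Set.univ) MeasurableSet.univ
    (fun t _ => (Real.hasDerivAt_exp t).hasDerivWithinAt) Real.exp_injective.injOn
    (fun y => G (Complex.measurableEquivRealProd.symm (x, y)))
  rw [Set.image_univ, Real.range_exp] at h2
  rw [h1, h2, setLIntegral_univ]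
  refine lintegral_congr fun t => ?_
  have e : (Complex.measurableEquivRealProd.symm (x, Real.exp t) : ℂ) = horocyclic (x, t) := rfl
  by_cases ht : horocyclic (x, t) ∈ s
  · rw [Set.indicator_of_mem (by exact ht), hG, Set.indicator_of_mem (by
      exact ⟨_, ht, e.symm⟩), e]
    rw [← ENNReal.ofReal_coe_nnreal, ENNReal.ofNNReal_toNNReal, ← ENNReal.ofReal_mul (abs_nonneg _)]
    congr 1
    have : (horocyclic (x, t) : ℂ).im = Real.exp t := rfl
    rw [this]
    push_cast
    rw [Real.norm_eq_abs, abs_of_pos (Real.exp_pos t), Real.exp_neg]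
    field_simp
  · rw [Set.indicator_of_notMem (by exact ht), hG, Set.indicator_of_notMem, mul_zero]
    rintro ⟨w, hw, hw'⟩
    rw [e] at hw'
    exact ht (UpperHalfPlane.ext hw' ▸ hw)

theorem integral_horocyclic (u : ℍ → ℝ) :
    ∫ w, u w = ∫ p : ℝ × ℝ, Real.exp (-p.2) * u (horocyclic p) := by
  rw [volume_eq_map_horocyclic, measurableEmbedding_horocyclic.integral_map,
    integral_withDensity_eq_integral_smul (by fun_prop)]
  refine integral_congr_ae (.of_forall fun p => ?_)
  simp [NNReal.smul_def, (Real.exp_pos _).le]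

theorem integrable_horocyclic_iff (u : ℍ → ℝ) :
    Integrable u ↔ Integrable fun p : ℝ × ℝ => Real.exp (-p.2) * u (horocyclic p) := by
  rw [volume_eq_map_horocyclic, measurableEmbedding_horocyclic.integrable_map_iff,
    integrable_withDensity_iff_integrable_smul (by fun_prop)]
  refine integrable_congr (.of_forall fun p => ?_)
  simp [NNReal.smul_def, (Real.exp_pos _).le]

/-- The hyperbolic cosine of the distance to `i`, in horocyclic coordinates. -/
noncomputable def coshDist (x t : ℝ) : ℝ := (x ^ 2 + Real.exp t ^ 2 + 1) / (2 * Real.exp t)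

theorem cosh_dist_horocyclic (p : ℝ × ℝ) :
    Real.cosh (dist (horocyclic p) UpperHalfPlane.I) = coshDist p.1 p.2 := by
  rw [UpperHalfPlane.cosh_dist, Complex.dist_eq, ← Complex.normSq_eq_norm_sq,
    Complex.normSq_apply, coshDist]
  simp only [Complex.sub_re, Complex.sub_im, UpperHalfPlane.coe_re, UpperHalfPlane.coe_im,
    horocyclic_re, horocyclic_im, UpperHalfPlane.I_re, UpperHalfPlane.I_im]
  field_simp
  ring

theorem horocyclic_mem_ball_iff {ρ : ℝ} (hρ : 0 ≤ ρ) (p : ℝ × ℝ) :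
    horocyclic p ∈ Metric.ball UpperHalfPlane.I ρ ↔ coshDist p.1 p.2 < Real.cosh ρ := by
  rw [Metric.mem_ball, ← cosh_dist_horocyclic, Real.cosh_lt_cosh, abs_of_nonneg dist_nonneg, abs_of_nonneg hρ]

end UpperHalfPlane

/-! ### Asymptotics of means over large disks -/

namespace SolvQuotient

open Solv

variable {Γ : Subgroup Solv} {τ a b : ℝ}

theorem ofUpperHalfPlane_horocyclic (x t : ℝ) :
    ofUpperHalfPlane (horocyclic (x, t)) = mk x 0 t := by
  ext
  · rfl
  · rfl
  · exact Real.log_exp t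

/-- Half the Euclidean length of the slice at height `t` of the disk of radius `ρ` around `i`. -/
noncomputable def sliceRadius (ρ t : ℝ) : ℝ :=
  Real.sqrt (2 * Real.exp t * Real.cosh ρ - Real.exp t ^ 2 - 1)

/-- This includes heights which the disk does not reach: there the radicand is at most `0`,
`sliceRadius` is `0` and the interval is empty. -/
theorem coshDist_lt_iff (ρ x t : ℝ) : coshDist x t < Real.cosh ρ ↔
    x ∈ Set.Ioo (-sliceRadius ρ t) (sliceRadius ρ t) := by
  rw [coshDist, div_lt_iff₀ (by positivity), Set.mem_Ioo, ← abs_lt, sliceRadius,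
    Real.lt_sqrt (abs_nonneg x), sq_abs]
  constructor <;> intro h <;> linarith

/-- The substitution `x = exp t * ξ` turns Euclidean half-length `ℓ` into length `exp (-t) * ℓ`
along the horocycle. -/
theorem integral_slice (f : SolvQuotient Γ → ℝ) (z : SolvQuotient Γ) (t ℓ : ℝ) :
    ∫ x in -ℓ..ℓ, f (leafMap Γ z (horocyclic (x, t))) =
      2 * ℓ * horoAvg f (rmul z (geo t)) (Real.exp (-t) * ℓ) := by
  have h1 : ∀ ξ : ℝ, f (rmul (rmul z (geo t)) (horo ξ)) =
      f (leafMap Γ z (horocyclic (Real.exp t * ξ, t))) := by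
    intro ξ
    rw [leafMap_eq, rmul_rmul, ofUpperHalfPlane_horocyclic]
    congr 2
    ext <;> simp [geo, horo]
  simp only [horoAvg, h1]
  have h2 := intervalIntegral.integral_comp_mul_left (a := -(Real.exp (-t) * ℓ))
    (b := Real.exp (-t) * ℓ) (fun x => f (leafMap Γ z (horocyclic (x, t)))) (Real.exp_ne_zero t)
  have h3 : Real.exp t * (Real.exp (-t) * ℓ) = ℓ := by
    rw [← mul_assoc, ← Real.exp_add]; simp
  rw [mul_neg, h3, smul_eq_mul] at h2
  rw [h2]
  rcases eq_or_ne ℓ 0 with rfl | hℓ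
  · simp
  · rw [Real.exp_neg]
    field_simp

theorem integral_ball (f : C(SolvQuotient Γ, ℝ)) (z : SolvQuotient Γ) {ρ : ℝ} (hρ : 0 ≤ ρ) :
    ∫ w in Metric.ball UpperHalfPlane.I ρ, f (leafMap Γ z w) =
      ∫ t, 2 * Real.exp (-t) * sliceRadius ρ t *
        horoAvg f (rmul z (geo t)) (Real.exp (-t) * sliceRadius ρ t) := by
  set u : ℍ → ℝ := (Metric.ball UpperHalfPlane.I ρ).indicator fun w => f (leafMap Γ z w) with hu
  have hint : Integrable u := by
    rw [hu, integrable_indicator_iff Metric.isOpen_ball.measurableSet]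
    exact ((f.continuous.comp (continuous_leafMap Γ z)).continuousOn.integrableOn_compact
      (isCompact_closedBall UpperHalfPlane.I ρ)).mono_set Metric.ball_subset_closedBall
  rw [← integral_indicator Metric.isOpen_ball.measurableSet, integral_horocyclic,
    Measure.volume_eq_prod, integral_prod_symm _ ((integrable_horocyclic_iff u).1 hint)]
  refine integral_congr_ae (.of_forall fun t => ?_)
  simp only
  have h1 : ∀ x, u (horocyclic (x, t)) = (Set.Ioo (-sliceRadius ρ t) (sliceRadius ρ t)).indicator
      (fun x => f (leafMap Γ z (horocyclic (x, t)))) x := by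
    intro x
    have h2 := horocyclic_mem_ball_iff hρ (x, t)
    rw [coshDist_lt_iff] at h2
    by_cases h : x ∈ Set.Ioo (-sliceRadius ρ t) (sliceRadius ρ t)
    · rw [hu, Set.indicator_of_mem h, Set.indicator_of_mem (h2.2 h)]
    · rw [hu, Set.indicator_of_notMem h, Set.indicator_of_notMem (mt h2.1 h)]
  have hpos : 0 ≤ sliceRadius ρ t := Real.sqrt_nonneg _
  rw [integral_const_mul]
  simp only [h1]
  rw [integral_indicator measurableSet_Ioo, ← integral_Ioc_eq_integral_Ioo,
    ← intervalIntegral.integral_of_le (by linarith), integral_slice]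
  ring

/-- The density of the height of the disk of radius `ρ`, measured from its lowest point. -/
noncomputable def diskKernel (ρ s : ℝ) : ℝ :=
  2 * Real.exp (-s) * Real.sqrt ((Real.exp s - 1) * (1 - Real.exp (s - 2 * ρ)))

/-- The disk extends from `t = -ρ` to `t = ρ`; the two factors vanish at these ends `s = 0` and `s =
2 * ρ`. Only the first survives as `ρ → ∞`. -/
theorem sliceRadius_sub (ρ s : ℝ) : sliceRadius ρ (s - ρ) =
    Real.sqrt ((Real.exp s - 1) * (1 - Real.exp (s - 2 * ρ))) := by
  rw [sliceRadius, Real.cosh_eq]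
  congr 1
  have e1 : Real.exp ρ * Real.exp (-ρ) = 1 := by rw [← Real.exp_add]; simp
  rw [show s - 2 * ρ = s + -ρ + -ρ by ring, show s - ρ = s + -ρ by ring, Real.exp_add,
    Real.exp_add, Real.exp_add]
  linear_combination Real.exp s * e1

theorem exp_neg_mul_slice (ρ s : ℝ) :
    Real.exp (-ρ) * (2 * Real.exp (-(s - ρ)) * sliceRadius ρ (s - ρ)) = diskKernel ρ s := by
  rw [sliceRadius_sub, diskKernel, show -(s - ρ) = -s + ρ by ring, Real.exp_add]
  have e1 : Real.exp (-ρ) * Real.exp ρ = 1 := by rw [← Real.exp_add]; simp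
  linear_combination 2 * Real.exp (-s) *
    Real.sqrt ((Real.exp s - 1) * (1 - Real.exp (s - 2 * ρ))) * e1

theorem diskKernel_nonneg (ρ s : ℝ) : 0 ≤ diskKernel ρ s := by
  rw [diskKernel]; positivity

theorem pi_mul_solvProfile (s : ℝ) :
    Real.pi * solvProfile s = 2 * Real.exp (-s) * Real.sqrt (Real.exp s - 1) := by
  rw [solvProfile_eq]
  have e1 : Real.exp (-s) - Real.exp (-2 * s) = (Real.exp (-s)) ^ 2 * (Real.exp s - 1) := by
    have : Real.exp s * Real.exp (-s) = 1 := by rw [← Real.exp_add]; simp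
    rw [show -2 * s = -s + -s by ring, Real.exp_add]
    linear_combination -Real.exp (-s) * this
  rw [e1, Real.sqrt_mul (by positivity), Real.sqrt_sq (Real.exp_pos _).le]
  have := Real.pi_ne_zero
  field_simp

/-- The limit of the kernels also dominates them, and it is integrable. -/
theorem diskKernel_le {ρ : ℝ} (hρ : 0 ≤ ρ) (s : ℝ) : diskKernel ρ s ≤ Real.pi * solvProfile s := by
  rw [pi_mul_solvProfile, diskKernel]
  refine mul_le_mul_of_nonneg_left ?_ (by positivity)
  rcases le_total s 0 with hs | hs
  · have h1 : 0 ≤ 1 - Real.exp (s - 2 * ρ) := by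
      rw [sub_nonneg, Real.exp_le_one_iff]; linarith
    have h2 : Real.exp s - 1 ≤ 0 := by rw [sub_nonpos, Real.exp_le_one_iff]; exact hs
    rw [Real.sqrt_eq_zero_of_nonpos (mul_nonpos_of_nonpos_of_nonneg h2 h1)]
    exact Real.sqrt_nonneg _
  · have h2 : 0 ≤ Real.exp s - 1 := by rw [sub_nonneg]; exact Real.one_le_exp hs
    refine Real.sqrt_le_sqrt (mul_le_of_le_one_right h2 ?_)
    linarith [Real.exp_pos (s - 2 * ρ)]

theorem tendsto_one_sub_exp (s : ℝ) :
    Tendsto (fun ρ : ℝ => 1 - Real.exp (s - 2 * ρ)) atTop (𝓝 1) := by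
  have h : Tendsto (fun ρ : ℝ => Real.exp (s - 2 * ρ)) atTop (𝓝 0) := by
    refine Real.tendsto_exp_atBot.comp ?_
    have := tendsto_neg_atTop_atBot.comp (tendsto_id.const_mul_atTop (show (0 : ℝ) < 2 by norm_num))
    exact (tendsto_atBot_add_const_left _ s this).congr fun ρ => by simp [sub_eq_add_neg]
  simpa using h.const_sub 1

theorem tendsto_diskKernel (s : ℝ) :
    Tendsto (fun ρ => diskKernel ρ s) atTop (𝓝 (Real.pi * solvProfile s)) := by
  rw [pi_mul_solvProfile]
  have h := (((tendsto_one_sub_exp s).const_mul (Real.exp s - 1)).sqrt).const_mul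
    (2 * Real.exp (-s))
  rw [mul_one] at h
  exact h

theorem tendsto_sliceLength {s : ℝ} (hs : 0 < s) :
    Tendsto (fun ρ => Real.exp (-(s - ρ)) * sliceRadius ρ (s - ρ)) atTop atTop := by
  simp only [sliceRadius_sub]
  have h := (((tendsto_one_sub_exp s).const_mul (Real.exp s - 1)).sqrt)
  rw [mul_one] at h
  refine Tendsto.atTop_mul_pos (Real.sqrt_pos.2 ?_) ?_ h
  · linarith [Real.one_lt_exp_iff.2 hs]
  · refine Real.tendsto_exp_atTop.comp ?_
    exact (tendsto_atTop_add_const_left _ (-s) tendsto_id).congr fun ρ => by simp; ring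

/-- The factor `(2 * L)⁻¹` breaks continuity at `L = 0`; the integral itself is a difference of
continuous functions of the endpoint. -/
theorem measurable_horoAvg {f : SolvQuotient Γ → ℝ} (hf : Continuous f) :
    Measurable fun p : SolvQuotient Γ × ℝ => horoAvg f p.1 p.2 := by
  have hjoint : Continuous (Function.uncurry fun (p : SolvQuotient Γ × ℝ) (ξ : ℝ) =>
      f (rmul p.1 (horo ξ))) :=
    hf.comp ((continuous_fst.comp continuous_fst).rmul (continuous_horo.comp continuous_snd))
  have h1 := intervalIntegral.continuous_parametric_intervalIntegral_of_continuous
    (a₀ := 0) (μ := volume) hjoint continuous_snd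
  have h2 := intervalIntegral.continuous_parametric_intervalIntegral_of_continuous
    (a₀ := 0) (μ := volume) hjoint continuous_snd.neg
  have h3 : (fun p : SolvQuotient Γ × ℝ => horoAvg f p.1 p.2) = fun p => (2 * p.2)⁻¹ *
      ((∫ ξ in (0 : ℝ)..p.2, f (rmul p.1 (horo ξ))) -
        ∫ ξ in (0 : ℝ)..-p.2, f (rmul p.1 (horo ξ))) := by
    funext p
    have hi : ∀ c d : ℝ, IntervalIntegrable (fun ξ => f (rmul p.1 (horo ξ))) volume c d :=
      fun c d => (hf.comp (continuous_rmul_horo p.1)).intervalIntegrable c d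
    rw [horoAvg, intervalIntegral.integral_interval_sub_left (hi _ _) (hi _ _)]
  rw [h3]
  exact (measurable_snd.const_mul 2).inv.mul (h1.measurable.sub h2.measurable)

/-- The integral of a function over a large disk is asymptotic to the integral of its fiberwise
means against the profile. -/
theorem IsFiberMean.tendsto_integral_ball [CompactSpace (SolvQuotient Γ)]
    {f : C(SolvQuotient Γ, ℝ)} {fb : C(ℝ ⧸ heightGroup Γ, ℝ)} (hfb : IsFiberMean f fb)
    (z : ℝ → SolvQuotient Γ) :
    Tendsto (fun ρ => Real.exp (-ρ) *
      (∫ w in Metric.ball UpperHalfPlane.I ρ, f (leafMap Γ (z ρ) w)) -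
      Real.pi * ∫ s, solvProfile s * fb (baseProj Γ (z ρ) + ((s - ρ : ℝ) : ℝ ⧸ heightGroup Γ)))
      atTop (𝓝 0) := by
  obtain ⟨B, hB⟩ := exists_bound f.continuous
  have hB0 : 0 ≤ B := (abs_nonneg _).trans (hB (z 0))
  have hfbB := hfb.abs_le hB
  have hc : Continuous fun s : ℝ => (s : ℝ ⧸ heightGroup Γ) := continuous_coe
  set I₁ : ℝ → ℝ → ℝ := fun ρ s => diskKernel ρ s * horoAvg f (rmul (z ρ) (geo (s - ρ)))
    (Real.exp (-(s - ρ)) * sliceRadius ρ (s - ρ)) with hI₁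
  set I₂ : ℝ → ℝ → ℝ := fun ρ s => Real.pi * (solvProfile s *
    fb (baseProj Γ (z ρ) + ((s - ρ : ℝ) : ℝ ⧸ heightGroup Γ))) with hI₂
  have hdom : Integrable fun s => Real.pi * solvProfile s * B :=
    (integrable_solvProfile.const_mul _).mul_const _
  have hm₁ : ∀ ρ, AEStronglyMeasurable (I₁ ρ) := by
    intro ρ
    have hk : Continuous (diskKernel ρ) := by unfold diskKernel; fun_prop
    have hs : Continuous fun s => Real.exp (-(s - ρ)) * sliceRadius ρ (s - ρ) := by
      unfold sliceRadius; fun_prop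
    have hg : Continuous fun s => rmul (z ρ) (geo (s - ρ)) :=
      continuous_const.rmul (continuous_geo.comp (continuous_id.sub continuous_const))
    exact (hk.measurable.mul
      ((measurable_horoAvg f.continuous).comp (hg.prodMk hs).measurable)).aestronglyMeasurable
  have hm₂ : ∀ ρ, AEStronglyMeasurable (I₂ ρ) := by
    intro ρ
    have hk := continuous_solvProfile
    exact (by fun_prop : Continuous (I₂ ρ)).aestronglyMeasurable
  have hb₁ : ∀ ρ, 0 ≤ ρ → ∀ s, ‖I₁ ρ s‖ ≤ Real.pi * solvProfile s * B := by
    intro ρ hρ s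
    rw [hI₁, norm_mul, Real.norm_eq_abs, abs_of_nonneg (diskKernel_nonneg _ _)]
    exact mul_le_mul (diskKernel_le hρ s) (abs_horoAvg_le hB _ _) (norm_nonneg _)
      (mul_nonneg Real.pi_pos.le (solvProfile_nonneg _))
  have hb₂ : ∀ ρ s, ‖I₂ ρ s‖ ≤ Real.pi * solvProfile s * B := by
    intro ρ s
    rw [hI₂, norm_mul, norm_mul, Real.norm_eq_abs, Real.norm_eq_abs, abs_of_pos Real.pi_pos,
      abs_of_nonneg (solvProfile_nonneg _), ← mul_assoc]
    exact mul_le_mul_of_nonneg_left (hfbB _)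
      (mul_nonneg Real.pi_pos.le (solvProfile_nonneg _))
  have hlim : Tendsto (fun ρ => ∫ s, (I₁ ρ s - I₂ ρ s)) atTop (𝓝 (∫ _ : ℝ, (0 : ℝ))) := by
    refine tendsto_integral_filter_of_dominated_convergence
      (fun s => Real.pi * solvProfile s * B + Real.pi * solvProfile s * B)
      (.of_forall fun ρ => (hm₁ ρ).sub (hm₂ ρ)) ?_ (hdom.add hdom) (.of_forall fun s => ?_)
    · filter_upwards [eventually_ge_atTop 0] with ρ hρ
      exact .of_forall fun s => (norm_sub_le _ _).trans (add_le_add (hb₁ ρ hρ s) (hb₂ ρ s))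
    · rcases le_or_gt s 0 with hs | hs
      · refine tendsto_const_nhds.congr' ?_
        filter_upwards [eventually_ge_atTop 0] with ρ hρ
        have h1 := hb₁ ρ hρ s
        have h2 := hb₂ ρ s
        rw [solvProfile_of_nonpos hs, mul_zero, zero_mul] at h1 h2
        rw [norm_le_zero_iff.1 h1, norm_le_zero_iff.1 h2, sub_zero]
      -- For fixed `s > 0` the slices become long. Uniformity of equidistribution in the base point
      -- is essential here, since the latter moves with `ρ`.
      · have h1 : Tendsto (fun ρ => horoAvg f (rmul (z ρ) (geo (s - ρ)))
            (Real.exp (-(s - ρ)) * sliceRadius ρ (s - ρ)) -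
            fb (baseProj Γ (z ρ) + ((s - ρ : ℝ) : ℝ ⧸ heightGroup Γ))) atTop (𝓝 0) := by
          rw [Metric.tendsto_nhds]
          intro ε hε
          obtain ⟨L₀, -, H⟩ := hfb (ε / 2) (half_pos hε)
          filter_upwards [(tendsto_sliceLength hs).eventually_ge_atTop L₀] with ρ hρ
          have := H _ hρ (rmul (z ρ) (geo (s - ρ)))
          rw [baseProj_rmul] at this
          rw [dist_zero_right]
          exact this.trans_lt (half_lt_self hε)
        have h2 := (tendsto_diskKernel s).sub (tendsto_const_nhds (x := Real.pi * solvProfile s))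
        rw [sub_self] at h2
        have h3 := (tendsto_diskKernel s).mul h1
        rw [mul_zero] at h3
        have h4 : Tendsto (fun ρ => (diskKernel ρ s - Real.pi * solvProfile s) *
            fb (baseProj Γ (z ρ) + ((s - ρ : ℝ) : ℝ ⧸ heightGroup Γ))) atTop (𝓝 0) :=
          h2.zero_mul_isBoundedUnder_le (isBoundedUnder_of ⟨B, fun ρ => hfbB _⟩)
        have h5 := h3.add h4
        rw [add_zero] at h5
        refine h5.congr fun ρ => ?_
        simp only [hI₁, hI₂]
        ring
  rw [integral_zero] at hlim
  refine hlim.congr' ?_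
  filter_upwards [eventually_ge_atTop 0] with ρ hρ
  have e : ∫ s, I₁ ρ s = Real.exp (-ρ) *
      ∫ w in Metric.ball UpperHalfPlane.I ρ, f (leafMap Γ (z ρ) w) := by
    rw [integral_ball f (z ρ) hρ, ← integral_sub_right_eq_self (fun t => 2 * Real.exp (-t) *
      sliceRadius ρ t * horoAvg f (rmul (z ρ) (geo t)) (Real.exp (-t) * sliceRadius ρ t)) ρ,
      ← integral_const_mul]
    refine integral_congr_ae (.of_forall fun s => ?_)
    simp only [hI₁]
    rw [← exp_neg_mul_slice]
    ring
  rw [integral_sub (hdom.mono' (hm₁ ρ) (.of_forall (hb₁ ρ hρ)))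
    (hdom.mono' (hm₂ ρ) (.of_forall (hb₂ ρ))), e, hI₂, integral_const_mul]

theorem integral_diskMeasure {f : SolvQuotient Γ → ℝ} (hf : Continuous f) (ρ : ℝ)
    (z : SolvQuotient Γ) : ∫ y, f y ∂(diskMeasure Γ ρ z) =
      (volume (Metric.ball UpperHalfPlane.I ρ)).toReal⁻¹ *
        ∫ w in Metric.ball UpperHalfPlane.I ρ, f (leafMap Γ z w) := by
  rw [diskMeasure, integral_map (continuous_leafMap Γ z).measurable.aemeasurable
    hf.aestronglyMeasurable, ProbabilityTheory.cond, integral_smul_measure, ENNReal.toReal_inv,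
    smul_eq_mul]

/-- The case `f = 1` of the asymptotics, combined with `∫ solvProfile = 1`. -/
theorem tendsto_volume_ball [CompactSpace (SolvQuotient Γ)] [Nonempty (SolvQuotient Γ)] :
    Tendsto (fun ρ => Real.exp (-ρ) * (volume (Metric.ball UpperHalfPlane.I ρ)).toReal) atTop
      (𝓝 Real.pi) := by
  have h := IsFiberMean.tendsto_integral_ball (f := (1 : C(SolvQuotient Γ, ℝ)))
    (isFiberMean_one (Γ := Γ)) (fun _ => Classical.arbitrary _)
  simp only [ContinuousMap.one_apply, mul_one, integral_solvProfile, setIntegral_const,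
    smul_eq_mul] at h
  have h2 := h.add_const Real.pi
  simp only [sub_add_cancel, zero_add] at h2
  exact h2

/-- The asymptotics of the means over large disks. -/
theorem IsFiberMean.tendsto_integral_diskMeasure [CompactSpace (SolvQuotient Γ)]
    {f : C(SolvQuotient Γ, ℝ)} {fb : C(ℝ ⧸ heightGroup Γ, ℝ)} (hfb : IsFiberMean f fb)
    (z : ℝ → SolvQuotient Γ) :
    Tendsto (fun ρ => ∫ y, f y ∂(diskMeasure Γ ρ (z ρ)) -
      ∫ s, solvProfile s * fb (baseProj Γ (z ρ) + ((s - ρ : ℝ) : ℝ ⧸ heightGroup Γ)))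
      atTop (𝓝 0) := by
  have : Nonempty (SolvQuotient Γ) := ⟨z 0⟩
  obtain ⟨B, hB⟩ := exists_bound f.continuous
  have hfbB := hfb.abs_le hB
  set J : ℝ → ℝ := fun ρ =>
    ∫ s, solvProfile s * fb (baseProj Γ (z ρ) + ((s - ρ : ℝ) : ℝ ⧸ heightGroup Γ)) with hJ
  have hJB : ∀ ρ, ‖J ρ‖ ≤ ∫ s, solvProfile s * B := by
    intro ρ
    refine norm_integral_le_of_norm_le (f := fun s => solvProfile s *
      fb (baseProj Γ (z ρ) + ((s - ρ : ℝ) : ℝ ⧸ heightGroup Γ)))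
      (integrable_solvProfile.mul_const _) (.of_forall fun s => ?_)
    rw [norm_mul, Real.norm_eq_abs, abs_of_nonneg (solvProfile_nonneg _)]
    exact mul_le_mul_of_nonneg_left (hfbB _) (solvProfile_nonneg _)
  set V : ℝ → ℝ := fun ρ => Real.exp (-ρ) * (volume (Metric.ball UpperHalfPlane.I ρ)).toReal with hV
  have hVlim : Tendsto V atTop (𝓝 Real.pi) := tendsto_volume_ball (Γ := Γ)
  have hVinv := hVlim.inv₀ Real.pi_ne_zero
  have h1 := (hfb.tendsto_integral_ball z).mul hVinv
  have h2 : Tendsto (fun ρ => (Real.pi * (V ρ)⁻¹ - 1) * J ρ) atTop (𝓝 0) := by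
    refine Tendsto.zero_mul_isBoundedUnder_le ?_ (isBoundedUnder_of ⟨_, hJB⟩)
    have := (hVinv.const_mul Real.pi).sub_const 1
    rwa [mul_inv_cancel₀ Real.pi_ne_zero, sub_self] at this
  have h3 := h1.add h2
  rw [zero_mul, add_zero] at h3
  refine h3.congr fun ρ => ?_
  rw [integral_diskMeasure f.continuous]
  change (_ - Real.pi * J ρ) * (V ρ)⁻¹ + _ = _ - J ρ
  simp only [hV, mul_inv]
  have := Real.exp_ne_zero (-ρ)
  field_simp
  ring

end SolvQuotient

/-! ### Smoothing by kernels and annihilation by harmonic measures -/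

/-- A symmetric second difference quotient tends to the second derivative. -/
theorem tendsto_second_difference_of_hasDerivAt {φ φ' φ'' : ℝ → ℝ}
    (h1 : ∀ᶠ r in 𝓝 0, HasDerivAt φ (φ' r) r) (h2 : ∀ᶠ r in 𝓝 0, HasDerivAt φ' (φ'' r) r)
    (hc : ContinuousAt φ'' 0) :
    Tendsto (fun s : ℝ => (φ s + φ (-s) - 2 * φ 0) / s ^ 2) (𝓝[>] 0) (𝓝 (φ'' 0)) := by
  rw [Metric.tendsto_nhds]
  intro ε hε
  obtain ⟨δ, hδ, h⟩ := Metric.eventually_nhds_iff.1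
    ((h1.and h2).and (Metric.tendsto_nhds.1 hc ε hε))
  filter_upwards [self_mem_nhdsWithin, nhdsWithin_le_nhds (Metric.ball_mem_nhds (0 : ℝ) hδ)]
    with s hs hsδ
  have hs0 : (0 : ℝ) < s := hs
  have hsδ' : s < δ := by simpa [abs_of_pos hs0] using hsδ
  have hmem : ∀ r, |r| ≤ s → dist r 0 < δ := fun r hr => by simpa using hr.trans_lt hsδ'
  obtain ⟨r, hr, e⟩ := exists_second_difference hs0 (fun r hr => (h (hmem r hr)).1.1)
    (fun r hr => (h (hmem r hr)).1.2)
  rw [e, mul_div_cancel_left₀ _ (by positivity)]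
  exact (h (hmem r hr)).2

namespace SolvQuotient

open Solv

variable {Γ : Subgroup Solv} {τ a b : ℝ}

/-- The kernel `(v, h) ↦ φ (v⁻¹ h)` in coordinates. -/
noncomputable def kernel (φ : ℝ × ℝ × ℝ → ℝ) (v h : ℝ × ℝ × ℝ) : ℝ :=
  φ (Real.exp (-v.2.2) * (h.1 - v.1), Real.exp v.2.2 * (h.2.1 - v.2.1), h.2.2 - v.2.2)

theorem kernel_eq (φ : ℝ × ℝ × ℝ → ℝ) (g h : Solv) :
    kernel φ (g.x, g.q, g.t) (h.x, h.q, h.t) =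
      φ ((g⁻¹ * h).x, (g⁻¹ * h).q, (g⁻¹ * h).t) := by
  rw [kernel]
  congr 1
  refine Prod.ext ?_ (Prod.ext ?_ ?_)
  · simp; ring
  · simp; ring
  · simp; ring

/-- The convolution of a function on `M` with a kernel on the right. -/
noncomputable def smear (F : C(SolvQuotient Γ, ℝ)) (φ : ℝ × ℝ × ℝ → ℝ) (z : SolvQuotient Γ) : ℝ :=
  ∫ h : Solv, F (rmul z h) * φ (h.x, h.q, h.t)

/-- Left invariance of the volume moves the translation from `F` to the kernel, so that derivatives
fall on `φ` although `F` is only continuous. -/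
theorem smear_rmul (F : C(SolvQuotient Γ, ℝ)) (φ : ℝ × ℝ × ℝ → ℝ) (z : SolvQuotient Γ)
    (g : Solv) :
    smear F φ (rmul z g) = ∫ h : Solv, F (rmul z h) * kernel φ (g.x, g.q, g.t) (h.x, h.q, h.t) := by
  rw [smear, ← integral_mul_left_eq_self _ g⁻¹]
  refine integral_congr_ae (.of_forall fun h => ?_)
  simp only [rmul_rmul, mul_inv_cancel_left, kernel_eq]

theorem kernel_support {φ : ℝ × ℝ × ℝ → ℝ} {K : Set Solv} {g h : Solv} (hg : g ∈ K)
    (hgh : kernel φ (g.x, g.q, g.t) (h.x, h.q, h.t) ≠ 0) :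
    h ∈ (fun p : Solv × Solv => p.1 * p.2) '' (K ×ˢ (show Set Solv from tsupport φ)) := by
  rw [kernel_eq] at hgh
  exact ⟨(g, g⁻¹ * h), ⟨hg, subset_tsupport φ hgh⟩, mul_inv_cancel_left g h⟩

theorem isCompact_kernel_support {φ : ℝ × ℝ × ℝ → ℝ} (hφ : HasCompactSupport φ) {K : Set Solv}
    (hK : IsCompact K) : IsCompact
      ((fun p : Solv × Solv => p.1 * p.2) '' (K ×ˢ (show Set Solv from tsupport φ))) :=
  (hK.prod (show IsCompact (X := Solv) (tsupport φ) from hφ)).image continuous_mul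

theorem contDiff_kernel {φ : ℝ × ℝ × ℝ → ℝ} (hφ : ContDiff ℝ 2 φ) :
    ContDiff ℝ 2 fun p : (ℝ × ℝ × ℝ) × (ℝ × ℝ × ℝ) => kernel φ p.1 p.2 := by
  refine hφ.comp (ContDiff.prodMk ?_ (ContDiff.prodMk ?_ ?_)) <;> fun_prop

theorem isC2_smear (F : C(SolvQuotient Γ, ℝ)) {φ : ℝ × ℝ × ℝ → ℝ} (hφ : ContDiff ℝ 2 φ)
    (hφc : HasCompactSupport φ) : IsC2 Γ (smear F φ) := by
  rw [IsC2, contDiff_iff_contDiffAt]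
  intro v
  -- The integral is written as a convolution with parameter `v`, evaluated at `0`; this accounts
  -- for the reflected argument `-k`.
  have e : ∀ v : ℝ × ℝ × ℝ, smear F φ (proj Γ (Solv.mk v.1 v.2.1 v.2.2)) =
      convolution (fun h : ℝ × ℝ × ℝ => F (proj Γ (Solv.mk h.1 h.2.1 h.2.2)))
        (fun k => kernel φ v (-k)) (ContinuousLinearMap.mul ℝ ℝ) volume 0 := by
    intro v
    have h1 : proj Γ (Solv.mk v.1 v.2.1 v.2.2) = rmul (proj Γ 1) (Solv.mk v.1 v.2.1 v.2.2) := by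
      rw [rmul_proj, one_mul]
    rw [h1, smear_rmul, convolution_def]
    simp only [rmul_proj, one_mul, zero_sub, neg_neg, ContinuousLinearMap.mul_apply']
    rfl
  have hc : Continuous fun h : ℝ × ℝ × ℝ => F (proj Γ (Solv.mk h.1 h.2.1 h.2.2)) :=
    F.continuous.comp ((continuous_proj Γ).comp
      (continuous_mk continuous_fst (by fun_prop) (by fun_prop)))
  have hcb : IsCompact (X := ℝ × ℝ × ℝ) (Metric.closedBall v 1) := isCompact_closedBall v 1
  have hK := isCompact_kernel_support (K := (Metric.closedBall v 1 : Set (ℝ × ℝ × ℝ))) hφc hcb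
  have hK' : IsCompact (X := ℝ × ℝ × ℝ) _ := hK
  have h2 := contDiffOn_convolution_right_with_param_comp (n := 2) (μ := volume)
    (ContinuousLinearMap.mul ℝ ℝ) (s := Metric.ball v 1) (v := fun _ : ℝ × ℝ × ℝ => (0 : ℝ × ℝ × ℝ))
    contDiffOn_const (f := fun h : ℝ × ℝ × ℝ => F (proj Γ (Solv.mk h.1 h.2.1 h.2.2)))
    (g := fun v k => kernel φ v (-k)) Metric.isOpen_ball hK'.neg (by
      intro p x hp hx
      by_contra hne
      refine hx ?_
      exact kernel_support (K := (Metric.closedBall v 1 : Set (ℝ × ℝ × ℝ))) (g := p) (h := -x)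
        (Metric.ball_subset_closedBall (α := ℝ × ℝ × ℝ) hp) hne) hc.locallyIntegrable
    ((contDiff_kernel hφ).comp (contDiff_fst.prodMk contDiff_snd.neg)).contDiffOn
  refine (h2.contDiffAt (Metric.ball_mem_nhds v one_pos)).congr_of_eventuallyEq ?_
  exact .of_forall e

/-- The kernel along the leaf through the base point, as a function on the upper half-plane. -/
noncomputable def kernelChart (φ : ℝ × ℝ × ℝ → ℝ) (p : (ℝ × ℝ × ℝ) × ℂ) : ℝ :=
  kernel φ (p.2.re, 0, Real.log p.2.im) p.1

theorem contDiffOn_kernelChart {φ : ℝ × ℝ × ℝ → ℝ} (hφ : ContDiff ℝ 2 φ) :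
    ContDiffOn ℝ 2 (kernelChart φ) {p | 0 < p.2.im} := by
  have hre : ContDiff ℝ 2 Complex.re := Complex.reCLM.contDiff
  have him : ContDiff ℝ 2 Complex.im := Complex.imCLM.contDiff
  have hlog : ContDiffOn ℝ 2 (fun p : (ℝ × ℝ × ℝ) × ℂ => Real.log p.2.im) {p | 0 < p.2.im} :=
    (him.comp contDiff_snd).contDiffOn.log fun p hp => (show 0 < p.2.im from hp).ne'
  exact (contDiff_kernel hφ).comp_contDiffOn
    (((hre.comp contDiff_snd).contDiffOn.prodMk (contDiffOn_const.prodMk hlog)).prodMk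
      contDiff_fst.contDiffOn)

theorem fivePoint_kernelChart (φ : ℝ × ℝ × ℝ → ℝ) (h : ℝ × ℝ × ℝ) (s : ℝ) :
    fivePoint (fun w => kernelChart φ (h, w)) Complex.I s =
      (kernel φ (s, 0, 0) h + kernel φ (-s, 0, 0) h + kernel φ (0, 0, Real.log (1 + s)) h +
        kernel φ (0, 0, Real.log (1 - s)) h - 4 * kernel φ (0, 0, 0) h) / s ^ 2 := by
  rw [fivePoint]
  simp [kernelChart]

theorem continuous_kernel {φ : ℝ × ℝ × ℝ → ℝ} (hφ : ContDiff ℝ 2 φ) (v : ℝ × ℝ × ℝ) :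
    Continuous fun h : Solv => kernel φ v (h.x, h.q, h.t) :=
  (contDiff_kernel hφ).continuous.comp (f := fun h : Solv => (v, (h.x, h.q, h.t)))
    (continuous_const.prodMk (continuous_x.prodMk (continuous_q.prodMk continuous_t)))

theorem continuous_rmul_right (z : SolvQuotient Γ) : Continuous fun h : Solv => rmul z h :=
  continuous_const.rmul continuous_id

theorem leafFivePoint_smear (F : C(SolvQuotient Γ, ℝ)) {φ : ℝ × ℝ × ℝ → ℝ}
    (hφ : ContDiff ℝ 2 φ) (hφc : HasCompactSupport φ) (z : SolvQuotient Γ) (s : ℝ) :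
    leafFivePoint (smear F φ) z s = ∫ h : Solv, F (rmul z h) *
      fivePoint (fun w => kernelChart φ ((h.x, h.q, h.t), w)) Complex.I s := by
  have hi : ∀ g : Solv, Integrable fun h : Solv =>
      F (rmul z h) * kernel φ (g.x, g.q, g.t) (h.x, h.q, h.t) := by
    intro g
    refine Continuous.integrable_of_hasCompactSupport
      ((F.continuous.comp (continuous_rmul_right z)).mul (continuous_kernel hφ _)) ?_
    refine HasCompactSupport.intro (isCompact_kernel_support hφc (isCompact_singleton (x := g))) ?_
    intro h hh
    by_contra hne
    exact hh (kernel_support rfl (right_ne_zero_of_mul hne))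
  have h0 : smear F φ z = ∫ h : Solv, F (rmul z h) * kernel φ (0, 0, 0) (h.x, h.q, h.t) := by
    conv_lhs => rw [← rmul_one z]
    exact smear_rmul F φ z 1
  have i1 := hi (horo s)
  have i2 := hi (horo (-s))
  have i3 := hi (geo (Real.log (1 + s)))
  have i4 := hi (geo (Real.log (1 - s)))
  have i5 := hi 1
  simp only [fivePoint_kernelChart, leafFivePoint, h0, smear_rmul]
  simp only [horo, geo, x_mk, q_mk, t_mk, x_one, q_one, t_one] at i1 i2 i3 i4 i5 ⊢
  have e : ∀ h : Solv, F (rmul z h) * ((kernel φ (s, 0, 0) (h.x, h.q, h.t) +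
      kernel φ (-s, 0, 0) (h.x, h.q, h.t) + kernel φ (0, 0, Real.log (1 + s)) (h.x, h.q, h.t) +
      kernel φ (0, 0, Real.log (1 - s)) (h.x, h.q, h.t) -
      4 * kernel φ (0, 0, 0) (h.x, h.q, h.t)) / s ^ 2) =
      (F (rmul z h) * kernel φ (s, 0, 0) (h.x, h.q, h.t) +
      F (rmul z h) * kernel φ (-s, 0, 0) (h.x, h.q, h.t) +
      F (rmul z h) * kernel φ (0, 0, Real.log (1 + s)) (h.x, h.q, h.t) +
      F (rmul z h) * kernel φ (0, 0, Real.log (1 - s)) (h.x, h.q, h.t) -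
      4 * (F (rmul z h) * kernel φ (0, 0, 0) (h.x, h.q, h.t))) / s ^ 2 := fun h => by ring
  simp only [e]
  rw [integral_div, integral_sub (by exact ((i1.add i2).add i3).add i4) (i5.const_mul 4),
    integral_add (by exact (i1.add i2).add i3) i4, integral_add (by exact i1.add i2) i3,
    integral_add i1 i2, integral_const_mul]

/-- Harmonic measures annihilate the convolutions with Laplacians of kernels. -/
theorem IsHarmonic.integral_smear_eq_zero (h : IsLatticeData Γ τ a b)
    {ν : Measure (SolvQuotient Γ)} [IsFiniteMeasure ν] (hν : IsHarmonic Γ ν)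
    (F : C(SolvQuotient Γ, ℝ)) {φ : ℝ × ℝ × ℝ → ℝ} (hφ : ContDiff ℝ 2 φ)
    (hφc : HasCompactSupport φ) {q : ℝ × ℝ × ℝ → ℝ}
    (hq : ∀ h, Tendsto (fivePoint (fun w => kernelChart φ (h, w)) Complex.I) (𝓝[>] 0) (𝓝 (q h))) :
    ∫ z, smear F q z ∂ν = 0 := by
  have := h.compactSpace
  have hC2 := isC2_smear F hφ hφc
  rw [← hν _ hC2]
  refine integral_congr_ae (.of_forall fun z => ?_)
  -- Both sides are limits of the same quotients: those of `smear F φ` are integrals of the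
  -- quotients of the kernel, which converge to `q`.
  refine tendsto_nhds_unique ?_ (hC2.tendsto_leafFivePoint z)
  obtain ⟨B, hB⟩ := exists_bound F.continuous
  have hB0 : 0 ≤ B := (abs_nonneg _).trans (hB z)
  -- `K₀` contains the five points of the difference quotient for all `s ≤ 1 / 2`, so outside `K`
  -- every quotient vanishes: one compact support serves for all `s`.
  set K₀ : Set Solv := (fun p : ℝ × ℝ => mk p.1 0 p.2) ''
    (Set.Icc (-1) 1 ×ˢ Set.Icc (Real.log (1 / 2)) (Real.log 2)) with hK₀
  have hK₀c : IsCompact K₀ := (isCompact_Icc.prod isCompact_Icc).image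
    (continuous_mk continuous_fst continuous_const continuous_snd)
  have hl1 : Real.log (1 / 2) ≤ 0 := Real.log_nonpos (by norm_num) (by norm_num)
  have hl2 : 0 ≤ Real.log 2 := Real.log_nonneg (by norm_num)
  set K := (fun p : Solv × Solv => p.1 * p.2) '' (K₀ ×ˢ (show Set Solv from tsupport φ))
  have hK : IsCompact K := isCompact_kernel_support hφc hK₀c
  obtain ⟨B', hB'⟩ := exists_bound_fivePoint isOpen_im_pos (contDiffOn_kernelChart hφ)
    (show IsCompact (X := ℝ × ℝ × ℝ) K from hK) (w := Complex.I) (δ := 1 / 2) (by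
      rintro ⟨p, w⟩ ⟨-, hw⟩
      have h1 : |(w - Complex.I).im| ≤ 1 / 2 :=
        (Complex.abs_im_le_norm _).trans (by simpa [dist_eq_norm] using hw)
      simp only [Complex.sub_im, Complex.I_im] at h1
      show 0 < w.im
      linarith [(abs_le.1 h1).1])
  have hzero : ∀ h : Solv, h ∉ K → ∀ s, 0 < s → s ≤ 1 / 2 →
      fivePoint (fun w => kernelChart φ ((h.x, h.q, h.t), w)) Complex.I s = 0 := by
    intro h hh s hs hs'
    have key : ∀ g ∈ K₀, kernel φ (g.x, g.q, g.t) (h.x, h.q, h.t) = 0 := by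
      intro g hg
      by_contra hne
      exact hh (kernel_support hg hne)
    have k : ∀ x t, x ∈ Set.Icc (-1 : ℝ) 1 → t ∈ Set.Icc (Real.log (1 / 2)) (Real.log 2) →
        kernel φ (x, 0, t) (h.x, h.q, h.t) = 0 := fun x t hx ht =>
      key (mk x 0 t) ⟨(x, t), ⟨hx, ht⟩, rfl⟩
    rw [fivePoint_kernelChart, k s 0 ⟨by linarith, by linarith⟩ ⟨hl1, hl2⟩,
      k (-s) 0 ⟨by linarith, by linarith⟩ ⟨hl1, hl2⟩, k 0 0 ⟨by norm_num, by norm_num⟩ ⟨hl1, hl2⟩,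
      k 0 (Real.log (1 + s)) ⟨by norm_num, by norm_num⟩
        ⟨Real.log_le_log (by norm_num) (by linarith), Real.log_le_log (by linarith) (by linarith)⟩,
      k 0 (Real.log (1 - s)) ⟨by norm_num, by norm_num⟩
        ⟨Real.log_le_log (by norm_num) (by linarith), Real.log_le_log (by linarith) (by linarith)⟩]
    simp
  rw [funext (leafFivePoint_smear F hφ hφc z)]
  refine tendsto_integral_filter_of_dominated_convergence (K.indicator fun _ => B * B') ?_ ?_ ?_
    (.of_forall fun h => (hq _).const_mul _)
  · refine .of_forall fun s => Continuous.aestronglyMeasurable ?_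
    refine (F.continuous.comp (continuous_rmul_right z)).mul ?_
    simp only [fivePoint_kernelChart]
    have := continuous_kernel hφ
    exact (((((this _).add (this _)).add (this _)).add (this _)).sub
      (continuous_const.mul (this _))).div_const _
  · filter_upwards [self_mem_nhdsWithin, nhdsWithin_le_nhds (Iic_mem_nhds
      (show (0 : ℝ) < 1 / 2 by norm_num))] with s hs hs'
    refine .of_forall fun h => ?_
    by_cases hh : h ∈ K
    · rw [Set.indicator_of_mem hh, norm_mul]
      exact mul_le_mul (hB _) (hB' _ hh s hs hs') (norm_nonneg _) hB0
    · rw [Set.indicator_of_notMem hh, hzero h hh s hs hs', mul_zero, norm_zero]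
  · rw [integrable_indicator_iff hK.measurableSet]
    exact integrableOn_const hK.measure_lt_top.ne

end SolvQuotient

/-! ### The radial Poisson equation and radial kernels -/

theorem contDiff_two_of_hasDerivAt {f f' f'' : ℝ → ℝ} (h1 : ∀ c, HasDerivAt f (f' c) c)
    (h2 : ∀ c, HasDerivAt f' (f'' c) c) (hc : Continuous f'') : ContDiff ℝ 2 f := by
  have e1 : deriv f = f' := funext fun c => (h1 c).deriv
  have e2 : deriv f' = f'' := funext fun c => (h2 c).deriv
  have k1 : ContDiff ℝ 1 f' :=
    contDiff_one_iff_deriv.2 ⟨fun c => (h2 c).differentiableAt, e2 ▸ hc⟩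
  rw [show (2 : WithTop ℕ∞) = 1 + 1 by norm_num, contDiff_succ_iff_deriv]
  exact ⟨fun c => (h1 c).differentiableAt, by simp, e1 ▸ k1⟩

/-- Solution of the radial Poisson equation on the hyperbolic plane, as a function of the hyperbolic
cosine of the distance. -/
theorem exists_radial_poisson {k : ℝ → ℝ} (hk : Continuous k) {c₀ C : ℝ} (hc₀ : 1 < c₀)
    (hlow : ∀ c ≤ c₀, k c = 0) (hhigh : ∀ c ≥ C, k c = 0) (hint : ∫ c in c₀..C, k c = 0) :
    ∃ ψ ψ' ψ'' : ℝ → ℝ, (∀ c, HasDerivAt ψ (ψ' c) c) ∧ (∀ c, HasDerivAt ψ' (ψ'' c) c) ∧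
      Continuous ψ'' ∧ (∀ c ≥ C, ψ c = 0) ∧
      ∀ c, 1 ≤ c → (c ^ 2 - 1) * ψ'' c + 2 * c * ψ' c = k c := by
  -- In the variable `c = cosh r` the radial Laplacian is `((c ^ 2 - 1) * ψ')'`, hence `ψ' = g / (c
  -- ^ 2 - 1)`. The primitive `g` vanishes up to `c₀ > 1`, which removes the singularity at `c = 1`,
  -- and beyond `C`, because `k` has mean zero.
  set g : ℝ → ℝ := fun c => ∫ u in c₀..c, k u with hg
  have hgd : ∀ c, HasDerivAt g (k c) c := fun c =>
    intervalIntegral.integral_hasDerivAt_right (hk.intervalIntegrable _ _)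
      hk.stronglyMeasurable.stronglyMeasurableAtFilter hk.continuousAt
  have hgc : Continuous g := continuous_iff_continuousAt.2 fun c => (hgd c).continuousAt
  have hglow : ∀ c ≤ c₀, g c = 0 := by
    intro c hc
    refine intervalIntegral.integral_zero_ae (.of_forall fun u hu => ?_)
    rw [Set.uIoc_of_ge hc] at hu
    exact hlow u hu.2
  have hghigh : ∀ c ≥ C, g c = 0 := by
    intro c hc
    change ∫ u in c₀..c, k u = 0
    rw [← intervalIntegral.integral_add_adjacent_intervals (hk.intervalIntegrable c₀ C)
      (hk.intervalIntegrable C c), hint, zero_add]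
    refine intervalIntegral.integral_zero_ae (.of_forall fun u hu => ?_)
    rw [Set.uIoc_of_le hc] at hu
    exact hhigh u hu.1.le
  set θ : ℝ → ℝ := fun c => g c / (c ^ 2 - 1) with hθ
  set θ' : ℝ → ℝ := fun c => (k c * (c ^ 2 - 1) - g c * (2 * c)) / (c ^ 2 - 1) ^ 2 with hθ'
  have hlowθ : ∀ c ≤ c₀, θ c = 0 := fun c hc => by simp only [hθ, hglow c hc, zero_div]
  have hlowθ' : ∀ c ≤ c₀, θ' c = 0 := fun c hc => by
    simp only [hθ', hglow c hc, hlow c hc, zero_mul, sub_zero, zero_div]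
  have hne : ∀ c : ℝ, 1 < c → c ^ 2 - 1 ≠ 0 := fun c hc => by nlinarith
  have hd : ∀ c, HasDerivAt θ (θ' c) c := by
    intro c
    rcases lt_or_ge c c₀ with hc | hc
    · rw [hlowθ' c hc.le]
      refine (hasDerivAt_const c (0 : ℝ)).congr_of_eventuallyEq ?_
      filter_upwards [Iic_mem_nhds hc] with u hu using hlowθ u hu
    · have := (hgd c).div (((hasDerivAt_pow 2 c).sub_const 1)) (hne c (hc₀.trans_le hc))
      exact this.congr_deriv (by simp [hθ'])
  have hθ'c : Continuous θ' := by
    refine continuous_iff_continuousAt.2 fun c => ?_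
    rcases lt_or_ge c c₀ with hc | hc
    · refine (continuousAt_const (y := (0 : ℝ))).congr ?_
      filter_upwards [Iic_mem_nhds hc] with u hu using (hlowθ' u hu).symm
    · refine ContinuousAt.div (by fun_prop) (by fun_prop) (pow_ne_zero 2 (hne c (hc₀.trans_le hc)))
  have hθc : Continuous θ := continuous_iff_continuousAt.2 fun c => (hd c).continuousAt
  refine ⟨fun c => ∫ u in C..c, θ u, θ, θ', fun c =>
    intervalIntegral.integral_hasDerivAt_right (hθc.intervalIntegrable _ _)
      hθc.stronglyMeasurable.stronglyMeasurableAtFilter hθc.continuousAt, hd, hθ'c, ?_, ?_⟩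
  · intro c hc
    refine intervalIntegral.integral_zero_ae (.of_forall fun u hu => ?_)
    rw [Set.uIoc_of_le hc] at hu
    simp only [hθ, hghigh u hu.1.le, zero_div]
  · intro c hc
    rcases le_or_gt c c₀ with h | h
    · rw [hlowθ c h, hlowθ' c h, hlow c h]; ring
    · have := hne c (hc₀.trans h)
      simp only [hθ, hθ']
      field_simp
      ring

theorem UpperHalfPlane.contDiff_coshDist :
    ContDiff ℝ 2 fun p : ℝ × ℝ × ℝ => coshDist p.1 p.2.2 := by
  unfold coshDist
  refine ContDiff.div (by fun_prop) (by fun_prop) fun p => by positivity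

theorem UpperHalfPlane.one_le_coshDist (x t : ℝ) : 1 ≤ coshDist x t := by
  rw [← cosh_dist_horocyclic (x, t)]; exact Real.one_le_cosh _

namespace SolvQuotient

open Solv

variable {Γ : Subgroup Solv} {τ a b : ℝ}

/-- A kernel that is radial in the leaf direction. -/
noncomputable def radialKernel (ψ χ : ℝ → ℝ) (p : ℝ × ℝ × ℝ) : ℝ :=
  ψ (coshDist p.1 p.2.2) * χ (Real.exp p.2.2 * p.2.1)

theorem contDiff_radialKernel {ψ χ : ℝ → ℝ} (hψ : ContDiff ℝ 2 ψ) (hχ : ContDiff ℝ 2 χ) :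
    ContDiff ℝ 2 (radialKernel ψ χ) :=
  (hψ.comp contDiff_coshDist).mul (hχ.comp (by fun_prop))

theorem hasCompactSupport_radialKernel {ψ χ : ℝ → ℝ} {C r : ℝ} (hψ : ∀ c ≥ C, ψ c = 0)
    (hχ : ∀ y, r < |y| → χ y = 0) : HasCompactSupport (radialKernel ψ χ) := by
  refine HasCompactSupport.intro (K := Set.Icc (-(2 * C)) (2 * C) ×ˢ
    Set.Icc (-(2 * C * r)) (2 * C * r) ×ˢ Set.Icc (-(2 * C)) (2 * C))
    (isCompact_Icc.prod (isCompact_Icc.prod isCompact_Icc)) ?_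
  rintro ⟨x, q, t⟩ hp
  by_contra hne
  refine hp ?_
  have h1 : coshDist x t < C := by
    by_contra h
    exact hne (by rw [radialKernel, hψ _ (not_lt.1 h), zero_mul])
  have h2 : |Real.exp t * q| ≤ r := by
    by_contra h
    exact hne (by rw [radialKernel, hχ _ (not_le.1 h), mul_zero])
  rw [coshDist, div_lt_iff₀ (by positivity)] at h1
  have he := Real.exp_pos t
  have hee : Real.exp t * Real.exp (-t) = 1 := by rw [← Real.exp_add]; simp
  have he' := Real.exp_pos (-t)
  have hC : 0 < C := by
    by_contra h
    nlinarith [sq_nonneg x, sq_nonneg (Real.exp t), not_lt.1 h]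
  have a1 : Real.exp t < 2 * C := by nlinarith [sq_nonneg x]
  have a2 : Real.exp (-t) < 2 * C := by nlinarith [sq_nonneg x, sq_nonneg (Real.exp t)]
  have a3 : x ^ 2 ≤ (2 * C) ^ 2 := by nlinarith [sq_nonneg (Real.exp t)]
  have a4 := Real.add_one_le_exp t
  have a5 := Real.add_one_le_exp (-t)
  rw [abs_mul, abs_of_pos he] at h2
  have hr : 0 ≤ r := (by positivity : 0 ≤ Real.exp t * |q|).trans h2
  have a6 : |q| ≤ 2 * C * r := by
    have : |q| = Real.exp (-t) * (Real.exp t * |q|) := by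
      rw [← mul_assoc, mul_comm (Real.exp (-t)), hee, one_mul]
    rw [this]
    exact mul_le_mul a2.le h2 (by positivity) (by positivity)
  exact ⟨abs_le.1 (abs_le_of_sq_le_sq a3 (by positivity)), abs_le.1 a6, by linarith, by linarith⟩

/-- The quantity `exp t * q` is unchanged by left translation by elements of `{q = 0}`, so only the
radial factor is differentiated. With `c = coshDist x t`, the formula follows from `α' ^ 2 + β' ^ 2
= c ^ 2 - 1` and `α'' + β'' = 2 * c` at `0`. -/
theorem tendsto_fivePoint_radialKernel {ψ ψ' ψ'' χ : ℝ → ℝ} (h1 : ∀ c, HasDerivAt ψ (ψ' c) c)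
    (h2 : ∀ c, HasDerivAt ψ' (ψ'' c) c) (hc : Continuous ψ'') (h : ℝ × ℝ × ℝ) :
    Tendsto (fivePoint (fun w => kernelChart (radialKernel ψ χ) (h, w)) Complex.I) (𝓝[>] 0)
      (𝓝 (radialKernel (fun c => (c ^ 2 - 1) * ψ'' c + 2 * c * ψ' c) χ h)) := by
  obtain ⟨x, q, t⟩ := h
  set E := Real.exp t with hE
  have hE0 : 0 < E := Real.exp_pos t
  set P := (x ^ 2 + E ^ 2) / E with hP
  -- `α s` and `β s` are the hyperbolic cosines of the distances from `x + i * exp t` to `i + s` and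
  -- to `(1 + s) i`.
  set α : ℝ → ℝ := fun s => ((x - s) ^ 2 + E ^ 2 + 1) / (2 * E) with hα
  set β : ℝ → ℝ := fun s => (P / (1 + s) + (1 + s) / E) / 2 with hβ
  have dα : ∀ s, HasDerivAt α ((s - x) / E) s := by
    intro s
    have := ((((hasDerivAt_id s).const_sub x).pow 2).add_const (E ^ 2)).add_const 1
    exact (this.div_const (2 * E)).congr_deriv (by simp; field_simp; ring)
  have dα' : ∀ s, HasDerivAt (fun s => (s - x) / E) (1 / E) s := fun s =>
    ((hasDerivAt_id s).sub_const x).div_const E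
  have hpos : ∀ᶠ s : ℝ in 𝓝 0, 0 < 1 + s := by
    filter_upwards [Ioi_mem_nhds (show (-1 : ℝ) < 0 by norm_num)] with s hs
    have : -1 < s := hs
    linarith
  have d1 : ∀ s, HasDerivAt (fun s : ℝ => 1 + s) 1 s := fun s => (hasDerivAt_id s).const_add 1
  have dβ : ∀ s, 0 < 1 + s → HasDerivAt β ((1 / E - P / (1 + s) ^ 2) / 2) s := by
    intro s hs
    have := ((hasDerivAt_const s P).div (d1 s) hs.ne').add ((d1 s).div_const E)
    exact (this.div_const 2).congr_deriv (by field_simp; ring)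
  have dβ' : ∀ s, 0 < 1 + s →
      HasDerivAt (fun s => (1 / E - P / (1 + s) ^ 2) / 2) (P / (1 + s) ^ 3) s := by
    intro s hs
    have := ((hasDerivAt_const s P).div ((d1 s).pow 2) (pow_ne_zero 2 hs.ne')).const_sub (1 / E)
    exact (this.div_const 2).congr_deriv (by simp; field_simp)
  have hψ'c : Continuous ψ' := continuous_iff_continuousAt.2 fun c => (h2 c).continuousAt
  have tα := tendsto_second_difference_of_hasDerivAt (φ := fun s => ψ (α s))
    (φ' := fun s => ψ' (α s) * ((s - x) / E))
    (φ'' := fun s => ψ'' (α s) * ((s - x) / E) * ((s - x) / E) + ψ' (α s) * (1 / E))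
    (.of_forall fun s => (h1 _).comp s (dα s))
    (.of_forall fun s => ((h2 _).comp s (dα s)).mul (dα' s)) (by
      refine Continuous.continuousAt ?_
      have : Continuous α := by fun_prop
      fun_prop)
  have tβ := tendsto_second_difference_of_hasDerivAt (φ := fun s => ψ (β s))
    (φ' := fun s => ψ' (β s) * ((1 / E - P / (1 + s) ^ 2) / 2))
    (φ'' := fun s => ψ'' (β s) * ((1 / E - P / (1 + s) ^ 2) / 2) *
      ((1 / E - P / (1 + s) ^ 2) / 2) + ψ' (β s) * (P / (1 + s) ^ 3))
    (hpos.mono fun s hs => (h1 _).comp s (dβ s hs))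
    (hpos.mono fun s hs => ((h2 _).comp s (dβ s hs)).mul (dβ' s hs)) (by
      have k1 : ContinuousAt β 0 := (dβ 0 (by norm_num)).continuousAt
      have k2 : ContinuousAt (fun s => (1 / E - P / (1 + s) ^ 2) / 2) 0 :=
        (dβ' 0 (by norm_num)).continuousAt
      have k3 : ContinuousAt (fun s : ℝ => P / (1 + s) ^ 3) 0 :=
        ContinuousAt.div (by fun_prop) (by fun_prop) (by norm_num)
      exact (((hc.continuousAt.comp k1).mul k2).mul k2).add ((hψ'c.continuousAt.comp k1).mul k3))
  have key := (tα.add tβ).mul_const (χ (E * q))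
  have e0 : α 0 = coshDist x t := by simp [hα, coshDist, hE]
  have e0' : β 0 = coshDist x t := by
    simp only [hβ, hP, coshDist, ← hE]; field_simp; ring
  have ec : coshDist x t = (x ^ 2 + E ^ 2 + 1) / (2 * E) := rfl
  refine (key.congr' ?_).trans (le_of_eq ?_)
  · filter_upwards [self_mem_nhdsWithin, nhdsWithin_le_nhds (Iio_mem_nhds one_pos)] with s hs hs'
    have hs0 : (0 : ℝ) < s := hs
    have hs1 : s < 1 := hs'
    have p1 : 0 < 1 + s := by linarith
    have p2 : 0 < 1 - s := by linarith
    have K1 : ∀ s, kernel (radialKernel ψ χ) (s, 0, 0) (x, q, t) = ψ (α s) * χ (E * q) := by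
      intro s
      simp [kernel, radialKernel, coshDist, hα, hE]
    have K2 : ∀ s, 0 < 1 + s → kernel (radialKernel ψ χ) (0, 0, Real.log (1 + s)) (x, q, t) =
        ψ (β s) * χ (E * q) := by
      intro s hs
      simp only [kernel, radialKernel, coshDist, Real.exp_neg, Real.exp_sub, Real.exp_log hs,
        sub_zero, ← hE]
      congr 2
      · simp only [hβ, hP]; field_simp
      · field_simp
    have K3 := K2 (-s) (by linarith)
    rw [← sub_eq_add_neg] at K3
    rw [fivePoint_kernelChart, K1, K1, K1, K2 s p1, K3, e0, e0']
    ring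
  · congr 1
    simp only [radialKernel, ← hE, e0, e0', ec, hP]
    field_simp
    ring

end SolvQuotient

/-! ### From radial orthogonality to the mean value property -/

/-- A trapezoidal approximation of the indicator function of `(1, C)`. -/
noncomputable def trapezoid (C : ℝ) (n : ℕ) (c : ℝ) : ℝ :=
  max 0 (min 1 (min ((n + 1) * (c - 1) - 1) ((n + 1) * (C - c))))

theorem continuous_trapezoid (C : ℝ) (n : ℕ) : Continuous (trapezoid C n) := by
  unfold trapezoid; fun_prop

theorem trapezoid_nonneg (C : ℝ) (n : ℕ) (c : ℝ) : 0 ≤ trapezoid C n c := le_max_left _ _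

theorem trapezoid_le_one (C : ℝ) (n : ℕ) (c : ℝ) : trapezoid C n c ≤ 1 :=
  max_le zero_le_one (min_le_left _ _)

/-- Vanishing on a neighbourhood of `c = 1` provides the `c₀ > 1` required in
`IsRadiallyOrthogonal`. -/
theorem trapezoid_of_le {C : ℝ} {n : ℕ} {c : ℝ} (hc : c ≤ 1 + 1 / (n + 1)) :
    trapezoid C n c = 0 := by
  have hn : (0 : ℝ) < n + 1 := by positivity
  refine max_eq_left ((min_le_right _ _).trans ((min_le_left _ _).trans ?_))
  have : (n + 1) * (c - 1) ≤ (n + 1) * (1 / (n + 1)) := by gcongr; linarith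
  rw [mul_one_div_cancel hn.ne'] at this
  linarith

theorem trapezoid_of_ge {C : ℝ} {n : ℕ} {c : ℝ} (hc : C ≤ c) : trapezoid C n c = 0 := by
  have hn : (0 : ℝ) < n + 1 := by positivity
  refine max_eq_left ((min_le_right _ _).trans ((min_le_right _ _).trans ?_))
  exact mul_nonpos_of_nonneg_of_nonpos hn.le (by linarith)

theorem tendsto_trapezoid (C c : ℝ) : Tendsto (fun n => trapezoid C n c) atTop
    (𝓝 ((Set.Ioo 1 C).indicator 1 c)) := by
  by_cases hc : c ∈ Set.Ioo 1 C
  · rw [Set.indicator_of_mem hc, Pi.one_apply]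
    have hn : Tendsto (fun n : ℕ => (n : ℝ) + 1) atTop atTop :=
      tendsto_atTop_add_const_right _ _ tendsto_natCast_atTop_atTop
    refine tendsto_const_nhds.congr' ?_
    filter_upwards [(hn.atTop_mul_const (sub_pos.2 hc.1)).eventually_ge_atTop 2,
      (hn.atTop_mul_const (sub_pos.2 hc.2)).eventually_ge_atTop 1] with n h1 h2
    rw [trapezoid, min_eq_left (le_min (by linarith) h2), max_eq_right zero_le_one]
  · rw [Set.indicator_of_notMem hc]
    refine tendsto_const_nhds.congr fun n => ?_
    rcases le_or_gt c 1 with h | h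
    · exact (trapezoid_of_le (h.trans (by rw [le_add_iff_nonneg_right]; positivity))).symm
    · exact (trapezoid_of_ge (not_lt.1 fun h' => hc ⟨h, h'⟩)).symm

theorem abs_trapezoid_le (C : ℝ) (n : ℕ) (c : ℝ) :
    |trapezoid C n c| ≤ (Set.Icc 1 C).indicator 1 c := by
  rw [abs_of_nonneg (trapezoid_nonneg _ _ _)]
  by_cases hc : c ∈ Set.Icc 1 C
  · rw [Set.indicator_of_mem hc]; exact trapezoid_le_one _ _ _
  · rw [Set.indicator_of_notMem hc]
    rcases lt_or_ge c 1 with h | h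
    · exact (trapezoid_of_le (h.le.trans (by rw [le_add_iff_nonneg_right]; positivity))).le
    · exact (trapezoid_of_ge (not_le.1 fun h' => hc ⟨h, h'⟩).le).le

theorem tendsto_integral_trapezoid {C : ℝ} (hC : 1 ≤ C) :
    Tendsto (fun n => ∫ c, trapezoid C n c) atTop (𝓝 (C - 1)) := by
  have h : ∫ c, (Set.Ioo 1 C).indicator (1 : ℝ → ℝ) c = C - 1 := by
    rw [integral_indicator_one measurableSet_Ioo, Real.volume_real_Ioo_of_le hC]
  rw [← h]
  refine tendsto_integral_of_dominated_convergence ((Set.Icc 1 C).indicator 1)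
    (fun n => (continuous_trapezoid C n).aestronglyMeasurable) ?_
    (fun n => .of_forall (abs_trapezoid_le C n)) (.of_forall (tendsto_trapezoid C))
  exact (integrable_indicator_iff measurableSet_Icc).2 (integrableOn_const (by simp) (by simp))

namespace UpperHalfPlane

theorem mem_ball_I_iff {ρ : ℝ} (hρ : 0 ≤ ρ) (w : ℍ) :
    w ∈ Metric.ball UpperHalfPlane.I ρ ↔ Real.cosh (dist w UpperHalfPlane.I) < Real.cosh ρ := by
  rw [Metric.mem_ball, Real.cosh_lt_cosh, abs_of_nonneg dist_nonneg, abs_of_nonneg hρ]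

theorem volume_singleton (w : ℍ) : (volume : Measure ℍ) {w} = 0 := by
  rw [volume_eq_lintegral, Set.image_singleton]
  simp

/-- For the trivial group, a null disk would push forward to the zero measure, but disk measures are
probability measures. -/
theorem volume_ball_pos {ρ : ℝ} (hρ : 0 < ρ) :
    0 < (volume (Metric.ball UpperHalfPlane.I ρ)).toReal := by
  have h2 : (volume : Measure ℍ) (Metric.ball UpperHalfPlane.I ρ) ≠ ⊤ :=
    ((measure_mono Metric.ball_subset_closedBall).trans_lt
      (isCompact_closedBall _ _).measure_lt_top).ne
  refine ENNReal.toReal_pos (fun h0 => ?_) h2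
  have := SolvQuotient.isProbabilityMeasure_diskMeasure ⊥ hρ (SolvQuotient.proj ⊥ 1)
  refine IsProbabilityMeasure.ne_zero (SolvQuotient.diskMeasure ⊥ ρ (SolvQuotient.proj ⊥ 1)) ?_
  rw [SolvQuotient.diskMeasure, ProbabilityTheory.cond, Measure.restrict_eq_zero.2 h0, smul_zero,
    Measure.map_zero]

/-- The pointwise limit is the indicator of the disk without its centre, where `cosh (dist w I) =
1`; a point is null. -/
theorem tendsto_integral_trapezoid_mul {u : ℍ → ℝ} (hu : Continuous u) {ρ : ℝ} (hρ : 0 < ρ) :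
    Tendsto (fun n => ∫ w, trapezoid (Real.cosh ρ) n (Real.cosh (dist w UpperHalfPlane.I)) * u w)
      atTop (𝓝 (∫ w in Metric.ball UpperHalfPlane.I ρ, u w)) := by
  rw [← integral_indicator Metric.isOpen_ball.measurableSet]
  have hd : Continuous fun w : ℍ => Real.cosh (dist w UpperHalfPlane.I) := by fun_prop
  refine tendsto_integral_of_dominated_convergence
    ((Metric.closedBall UpperHalfPlane.I ρ).indicator fun w => |u w|)
    (fun n => (((continuous_trapezoid _ n).comp hd).mul hu).aestronglyMeasurable) ?_ ?_ ?_
  · rw [integrable_indicator_iff Metric.isClosed_closedBall.measurableSet]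
    exact hu.abs.continuousOn.integrableOn_compact (isCompact_closedBall _ _)
  · refine fun n => .of_forall fun w => ?_
    rw [norm_mul, Real.norm_eq_abs, Real.norm_eq_abs]
    have h := abs_trapezoid_le (Real.cosh ρ) n (Real.cosh (dist w UpperHalfPlane.I))
    by_cases hw : w ∈ Metric.closedBall UpperHalfPlane.I ρ
    · rw [Set.indicator_of_mem hw]
      refine mul_le_of_le_one_left (abs_nonneg _) ?_
      rw [abs_of_nonneg (trapezoid_nonneg _ _ _)]
      exact trapezoid_le_one _ _ _
    · rw [Set.indicator_of_notMem hw, trapezoid_of_ge, abs_zero, zero_mul]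
      rw [Real.cosh_le_cosh, abs_of_pos hρ, abs_of_nonneg dist_nonneg]
      exact (not_le.1 hw).le
  · have hne : ∀ᵐ w : ℍ, w ≠ UpperHalfPlane.I := by
      rw [ae_iff]
      simpa using volume_singleton UpperHalfPlane.I
    filter_upwards [hne] with w hw
    have h1 : 1 < Real.cosh (dist w UpperHalfPlane.I) :=
      Real.one_lt_cosh.2 (dist_pos.2 hw).ne'
    have h2 := (tendsto_trapezoid (Real.cosh ρ) (Real.cosh (dist w UpperHalfPlane.I))).mul_const (u w)
    convert h2 using 2
    by_cases hb : w ∈ Metric.ball UpperHalfPlane.I ρ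
    · rw [Set.indicator_of_mem hb, Set.indicator_of_mem
        (show _ ∈ Set.Ioo _ _ from ⟨h1, (mem_ball_I_iff hρ.le w).1 hb⟩)]
      simp
    · rw [Set.indicator_of_notMem hb, Set.indicator_of_notMem
        (fun h => hb ((mem_ball_I_iff hρ.le w).2 h.2)), zero_mul]

/-- The functions on `ℍ` that are orthogonal to the radial functions of mean zero. -/
def IsRadiallyOrthogonal (u : ℍ → ℝ) : Prop :=
  ∀ (k : ℝ → ℝ) (c₀ C : ℝ), Continuous k → 1 < c₀ → (∀ c ≤ c₀, k c = 0) → (∀ c ≥ C, k c = 0) →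
    ∫ c in c₀..C, k c = 0 → ∫ w, k (Real.cosh (dist w UpperHalfPlane.I)) * u w = 0

/-- The disk of radius `ρ` is the interval of length `cosh ρ - 1` in the variable `cosh (dist w I)`,
so the cross-weighted difference of two disks has mean zero. Continuous approximations make it
admissible. -/
theorem IsRadiallyOrthogonal.integral_ball {u : ℍ → ℝ} (H : IsRadiallyOrthogonal u)
    (hu : Continuous u) {ρ₁ ρ₂ : ℝ} (h₁ : 0 < ρ₁) (h₂ : 0 < ρ₂) :
    (Real.cosh ρ₂ - 1) * ∫ w in Metric.ball UpperHalfPlane.I ρ₁, u w =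
      (Real.cosh ρ₁ - 1) * ∫ w in Metric.ball UpperHalfPlane.I ρ₂, u w := by
  have hd : Continuous fun w : ℍ => Real.cosh (dist w UpperHalfPlane.I) := by fun_prop
  have hint : ∀ ρ, 0 < ρ → ∀ n : ℕ, Integrable fun w =>
      trapezoid (Real.cosh ρ) n (Real.cosh (dist w UpperHalfPlane.I)) * u w := by
    intro ρ hρ n
    refine (((continuous_trapezoid _ n).comp hd).mul hu).integrable_of_hasCompactSupport ?_
    refine HasCompactSupport.intro (isCompact_closedBall UpperHalfPlane.I ρ) fun w hw => ?_
    refine mul_eq_zero_of_left (trapezoid_of_ge ?_) _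
    rw [Real.cosh_le_cosh, abs_of_pos hρ, abs_of_nonneg dist_nonneg]
    exact (not_le.1 hw).le
  have hint' : ∀ ρ, 0 < ρ → ∀ n : ℕ, Integrable (trapezoid (Real.cosh ρ) n) := by
    intro ρ hρ n
    refine (continuous_trapezoid _ n).integrable_of_hasCompactSupport
      (HasCompactSupport.intro (isCompact_Icc (a := 1) (b := Real.cosh ρ)) fun c hc => ?_)
    have := abs_trapezoid_le (Real.cosh ρ) n c
    rw [Set.indicator_of_notMem hc] at this
    exact abs_nonpos_iff.1 this
  have key : ∀ n : ℕ, (∫ c, trapezoid (Real.cosh ρ₂) n c) *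
      (∫ w, trapezoid (Real.cosh ρ₁) n (Real.cosh (dist w UpperHalfPlane.I)) * u w) =
      (∫ c, trapezoid (Real.cosh ρ₁) n c) *
      (∫ w, trapezoid (Real.cosh ρ₂) n (Real.cosh (dist w UpperHalfPlane.I)) * u w) := by
    intro n
    -- Weights equal to the exact trapezoid integrals give mean zero for every `n`, not only in the
    -- limit.
    set l₁ := ∫ c, trapezoid (Real.cosh ρ₁) n c with hl₁
    set l₂ := ∫ c, trapezoid (Real.cosh ρ₂) n c with hl₂
    set k : ℝ → ℝ := fun c => l₂ * trapezoid (Real.cosh ρ₁) n c -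
      l₁ * trapezoid (Real.cosh ρ₂) n c with hk
    have hlow : ∀ c ≤ 1 + 1 / ((n : ℝ) + 1), k c = 0 := fun c hc => by
      simp only [hk, trapezoid_of_le hc, mul_zero, sub_zero]
    have hhigh : ∀ c ≥ max (Real.cosh ρ₁) (Real.cosh ρ₂), k c = 0 := fun c hc => by
      simp only [hk, trapezoid_of_ge ((le_max_left _ _).trans hc),
        trapezoid_of_ge ((le_max_right _ _).trans hc), mul_zero, sub_zero]
    have hk0 : ∫ c, k c = 0 := by
      rw [hk, integral_sub ((hint' ρ₁ h₁ n).const_mul _) ((hint' ρ₂ h₂ n).const_mul _),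
        integral_const_mul, integral_const_mul, ← hl₁, ← hl₂]
      ring
    have h0 := H k (1 + 1 / ((n : ℝ) + 1)) (max (Real.cosh ρ₁) (Real.cosh ρ₂))
      (((continuous_trapezoid _ n).const_mul _).sub ((continuous_trapezoid _ n).const_mul _))
      (by rw [lt_add_iff_pos_right]; positivity) hlow hhigh (by
        rw [intervalIntegral.integral_eq_integral_of_support_subset, hk0]
        intro c hc
        refine ⟨not_le.1 fun h => hc (hlow c h), not_lt.1 fun h => hc (hhigh c h.le)⟩)
    have e : ∀ w : ℍ, k (Real.cosh (dist w UpperHalfPlane.I)) * u w =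
        l₂ * (trapezoid (Real.cosh ρ₁) n (Real.cosh (dist w UpperHalfPlane.I)) * u w) -
        l₁ * (trapezoid (Real.cosh ρ₂) n (Real.cosh (dist w UpperHalfPlane.I)) * u w) :=
      fun w => by simp only [hk]; ring
    simp only [e] at h0
    rw [integral_sub ((hint ρ₁ h₁ n).const_mul _) ((hint ρ₂ h₂ n).const_mul _),
      integral_const_mul, integral_const_mul] at h0
    linarith
  have t := fun ρ (hρ : 0 < ρ) => tendsto_integral_trapezoid (Real.one_le_cosh ρ)
  refine tendsto_nhds_unique ((t ρ₂ h₂).mul (tendsto_integral_trapezoid_mul hu h₁)) ?_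
  simp only [key]
  exact (t ρ₁ h₁).mul (tendsto_integral_trapezoid_mul hu h₂)

/-- Mean value property. -/
theorem IsRadiallyOrthogonal.mean_value {u : ℍ → ℝ} (H : IsRadiallyOrthogonal u)
    (H1 : IsRadiallyOrthogonal fun _ => 1) (hu : Continuous u) {ρ : ℝ} (hρ : 0 < ρ) :
    (volume (Metric.ball UpperHalfPlane.I ρ)).toReal⁻¹ *
      ∫ w in Metric.ball UpperHalfPlane.I ρ, u w = u UpperHalfPlane.I := by
  set V : ℝ → ℝ := fun ρ => (volume (Metric.ball UpperHalfPlane.I ρ)).toReal with hV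
  have hVpos : ∀ ρ, 0 < ρ → 0 < V ρ := fun ρ hρ => volume_ball_pos hρ
  have hfin : ∀ ρ, (volume : Measure ℍ) (Metric.ball UpperHalfPlane.I ρ) < ⊤ := fun ρ =>
    (measure_mono Metric.ball_subset_closedBall).trans_lt (isCompact_closedBall _ _).measure_lt_top
  have hI : ∀ ρ, IntegrableOn u (Metric.ball UpperHalfPlane.I ρ) := fun ρ =>
    (hu.continuousOn.integrableOn_compact (isCompact_closedBall UpperHalfPlane.I ρ)).mono_set
      Metric.ball_subset_closedBall
  change (V ρ)⁻¹ * _ = _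
  have hindep : ∀ r, 0 < r → (V ρ)⁻¹ * ∫ w in Metric.ball UpperHalfPlane.I ρ, u w =
      (V r)⁻¹ * ∫ w in Metric.ball UpperHalfPlane.I r, u w := by
    intro r hr
    -- The same proportionality for the constant `1` compares the areas, so the means over disks do
    -- not depend on the radius; letting it tend to `0` gives the value at the centre.
    have e1 := H.integral_ball hu hρ hr
    have e2 := H1.integral_ball continuous_const hρ hr
    simp only [setIntegral_const, smul_eq_mul, mul_one] at e2
    change (Real.cosh r - 1) * V ρ = (Real.cosh ρ - 1) * V r at e2
    have p1 := hVpos ρ hρ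
    have p2 := hVpos r hr
    have p3 : 0 < Real.cosh r - 1 := sub_pos.2 (Real.one_lt_cosh.2 hr.ne')
    have p4 : 0 < Real.cosh ρ - 1 := sub_pos.2 (Real.one_lt_cosh.2 hρ.ne')
    set A := ∫ w in Metric.ball UpperHalfPlane.I ρ, u w
    set A' := ∫ w in Metric.ball UpperHalfPlane.I r, u w
    have e3 : (Real.cosh r - 1) * (V r * A - V ρ * A') = 0 := by
      linear_combination V r * e1 - A' * e2
    have e4 : V r * A = V ρ * A' := by
      rcases mul_eq_zero.1 e3 with h | h
      · exact absurd h p3.ne'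
      · linarith
    field_simp
    linarith
  refine eq_of_abs_sub_le_all fun ε hε => ?_
  obtain ⟨δ, hδ, h⟩ := Metric.continuousAt_iff.1 (hu.continuousAt (x := UpperHalfPlane.I)) ε hε
  rw [hindep δ hδ]
  have p := hVpos δ hδ
  have e : (V δ)⁻¹ * (∫ w in Metric.ball UpperHalfPlane.I δ, u w) - u UpperHalfPlane.I =
      (V δ)⁻¹ * ∫ w in Metric.ball UpperHalfPlane.I δ, (u w - u UpperHalfPlane.I) := by
    rw [integral_sub (hI δ) (integrableOn_const (hfin δ).ne), setIntegral_const, smul_eq_mul]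
    change _ = (V δ)⁻¹ * (_ - V δ * _)
    field_simp
  rw [e, abs_mul, abs_of_pos (inv_pos.2 p), inv_mul_le_iff₀ p, mul_comm (V δ)]
  have hb : ∀ w ∈ Metric.ball UpperHalfPlane.I δ, ‖u w - u UpperHalfPlane.I‖ ≤ ε :=
    fun w hw => (h hw).le
  exact norm_setIntegral_le_of_norm_le_const (hfin δ) hb

end UpperHalfPlane

/-! ### Transverse averages and leafwise means of harmonic measures -/

namespace SolvQuotient

open Solv

variable {Γ : Subgroup Solv} {τ a b : ℝ}

theorem measurePreserving_reorder : MeasurePreserving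
    (fun p : (ℝ × ℝ) × ℝ => (p.1.1, p.2, p.1.2)) volume volume := by
  have h1 : MeasurePreserving (MeasurableEquiv.prodAssoc : (ℝ × ℝ) × ℝ ≃ᵐ ℝ × ℝ × ℝ)
    volume volume := measurePreserving_prodAssoc volume volume volume
  have h2 : MeasurePreserving (Prod.map id Prod.swap : ℝ × ℝ × ℝ → ℝ × ℝ × ℝ) volume volume :=
    (MeasurePreserving.id volume).prod Measure.measurePreserving_swap
  exact h2.comp h1

/-- The average of a function on `M` in the direction transverse to the foliation. -/
noncomputable def transAvg (F : C(SolvQuotient Γ, ℝ)) (χ : ℝ → ℝ) (z : SolvQuotient Γ) : ℝ :=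
  ∫ y, χ y * F (rmul z (trans y))

theorem continuous_transAvg [CompactSpace (SolvQuotient Γ)] (F : C(SolvQuotient Γ, ℝ)) {χ : ℝ → ℝ}
    (hχ : Integrable χ) (hχc : Continuous χ) : Continuous (transAvg F χ) := by
  obtain ⟨B, hB⟩ := exists_bound F.continuous
  have ht := continuous_trans
  refine continuous_of_dominated (bound := fun y => ‖χ y‖ * B) (fun z => ?_)
    (fun z => .of_forall fun y => ?_) (hχ.norm.mul_const B) (.of_forall fun y => ?_)
  · exact (by fun_prop : Continuous _).aestronglyMeasurable
  · rw [norm_mul]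
    exact mul_le_mul_of_nonneg_left (hB _) (norm_nonneg _)
  · fun_prop

/-- Since `(x, q, t) = (x, 0, t) * trans (exp t * q)`, the substitution `y = exp t * q` splits the
integral into a transverse and a leafwise one; its Jacobian `exp (-t)` is exactly the density of
hyperbolic area. -/
theorem smear_radialKernel (F : C(SolvQuotient Γ, ℝ)) {k χ : ℝ → ℝ} (hk : Continuous k)
    (hχ : Continuous χ) {C r : ℝ} (hkC : ∀ c ≥ C, k c = 0) (hχr : ∀ y, r < |y| → χ y = 0)
    (z : SolvQuotient Γ) : smear F (radialKernel k χ) z =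
      ∫ w : ℍ, k (Real.cosh (dist w UpperHalfPlane.I)) * transAvg F χ (leafMap Γ z w) := by
  set G : ℝ × ℝ × ℝ → ℝ := fun p => F (rmul z (mk p.1 p.2.1 p.2.2)) * radialKernel k χ p with hG
  have hcosh : Continuous fun p : ℝ × ℝ × ℝ => coshDist p.1 p.2.2 := contDiff_coshDist.continuous
  have hGc : Continuous G := by
    have hm : Continuous fun p : ℝ × ℝ × ℝ => mk p.1 p.2.1 p.2.2 :=
      continuous_mk continuous_fst (by fun_prop) (by fun_prop)
    unfold G radialKernel
    fun_prop
  have hGs : HasCompactSupport G := (hasCompactSupport_radialKernel hkC hχr).mul_left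
  have hGi := hGc.integrable_of_hasCompactSupport hGs (μ := volume)
  have e1 : smear F (radialKernel k χ) z = ∫ p, G p := rfl
  have hr := measurePreserving_reorder
  have hGi' : Integrable fun p : (ℝ × ℝ) × ℝ => G (p.1.1, p.2, p.1.2) :=
    hr.integrable_comp_of_integrable hGi
  rw [e1, integral_horocyclic, ← hr.map_eq,
    integral_map hr.measurable.aemeasurable hGc.aestronglyMeasurable, Measure.volume_eq_prod,
    integral_prod _ hGi']
  refine integral_congr_ae (.of_forall fun p => ?_)
  obtain ⟨x, t⟩ := p
  simp only [cosh_dist_horocyclic, transAvg, leafMap_eq, ofUpperHalfPlane_horocyclic, rmul_rmul]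
  have e2 := Measure.integral_comp_mul_left
    (fun y => χ y * F (rmul z (mk x 0 t * trans y))) (Real.exp t)
  rw [abs_of_pos (inv_pos.2 (Real.exp_pos t)), ← Real.exp_neg, smul_eq_mul] at e2
  rw [mul_left_comm, ← e2, ← integral_const_mul]
  refine integral_congr_ae (.of_forall fun q => ?_)
  have e3 : mk x 0 t * trans (Real.exp t * q) = mk x q t := by
    have : Real.exp (-t) * Real.exp t = 1 := by rw [← Real.exp_add]; simp
    ext
    · simp [Solv.trans]
    · simp [Solv.trans, ← mul_assoc, this]
    · simp [Solv.trans]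
  simp only [e3, hG, radialKernel]
  ring

/-- The function on the hyperbolic plane obtained by averaging over the leaves. -/
noncomputable def leafMean (ν : Measure (SolvQuotient Γ)) (f : SolvQuotient Γ → ℝ) (w : ℍ) : ℝ :=
  ∫ z, f (leafMap Γ z w) ∂ν

theorem continuous_leafMap_uncurry :
    Continuous fun p : SolvQuotient Γ × ℍ => leafMap Γ p.1 p.2 := by
  simp only [leafMap_eq]
  exact continuous_fst.rmul (continuous_ofUpperHalfPlane.comp continuous_snd)

theorem integrable_radial {k : ℝ → ℝ} (hk : Continuous k) {C : ℝ} (hkC : ∀ c ≥ C, k c = 0) :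
    Integrable fun w : ℍ => k (Real.cosh (dist w UpperHalfPlane.I)) := by
  refine Continuous.integrable_of_hasCompactSupport (by fun_prop) (HasCompactSupport.intro
    (isCompact_closedBall UpperHalfPlane.I |C|) fun w hw => hkC _ ?_)
  have h1 : |C| < dist w UpperHalfPlane.I := not_le.1 hw
  have h2 := Real.add_one_le_exp (dist w UpperHalfPlane.I)
  have h3 := Real.cosh_sq (dist w UpperHalfPlane.I)
  have h4 : dist w UpperHalfPlane.I ≤ Real.sinh (dist w UpperHalfPlane.I) :=
    Real.self_le_sinh_iff.2 dist_nonneg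
  have h5 : Real.sinh (dist w UpperHalfPlane.I) < Real.cosh (dist w UpperHalfPlane.I) :=
    Real.sinh_lt_cosh _
  linarith [le_abs_self C]

section

variable {ν : Measure (SolvQuotient Γ)} {f : SolvQuotient Γ → ℝ}

theorem leafMean_I : leafMean ν f UpperHalfPlane.I = ∫ z, f z ∂ν := by
  simp only [leafMean, leafMap_I]

variable [CompactSpace (SolvQuotient Γ)] [IsFiniteMeasure ν]

theorem continuous_leafMean (hf : Continuous f) : Continuous (leafMean ν f) := by
  obtain ⟨B, hB⟩ := exists_bound hf
  refine continuous_of_dominated (bound := fun _ => B) (fun w => ?_)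
    (fun w => .of_forall fun z => hB _) (integrable_const B) (.of_forall fun z => ?_)
  · exact (hf.comp (continuous_leafMap_uncurry.comp
      (continuous_id.prodMk continuous_const))).aestronglyMeasurable
  · exact hf.comp (continuous_leafMap Γ z)

theorem integral_integral_leafMap (hf : Continuous f) {u : ℍ → ℝ} (hu : Integrable u) :
    ∫ z, (∫ w, u w * f (leafMap Γ z w)) ∂ν = ∫ w, u w * leafMean ν f w := by
  obtain ⟨B, hB⟩ := exists_bound hf
  rw [integral_integral_swap]
  · simp only [integral_const_mul, leafMean]
  · exact (hu.comp_snd ν).mul_bdd (c := B)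
      (hf.comp continuous_leafMap_uncurry).aestronglyMeasurable (.of_forall fun p => hB _)

/-- The leafwise mean of a harmonic measure is orthogonal to the radial functions of mean zero. -/
theorem IsHarmonic.isRadiallyOrthogonal (h : IsLatticeData Γ τ a b) (hν : IsHarmonic Γ ν)
    (F : C(SolvQuotient Γ, ℝ)) {χ : ℝ → ℝ} (hχ : ContDiff ℝ 2 χ) {r : ℝ}
    (hχr : ∀ y, r < |y| → χ y = 0) : IsRadiallyOrthogonal (leafMean ν (transAvg F χ)) := by
  intro k c₀ C hk hc₀ hlow hhigh hint
  have hχi : Integrable χ := hχ.continuous.integrable_of_hasCompactSupport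
    (HasCompactSupport.intro (isCompact_Icc (a := -r) (b := r)) fun y hy => hχr y
      (not_le.1 fun hle => hy (abs_le.1 hle)))
  -- Solving the Poisson equation exhibits `radialKernel k χ` as the leafwise Laplacian of a
  -- compactly supported kernel, so `ν` annihilates its smear.
  obtain ⟨ψ, ψ', ψ'', h1, h2, h3, h4, h5⟩ := exists_radial_poisson hk hc₀ hlow hhigh hint
  have h6 := hν.integral_smear_eq_zero h F
    (contDiff_radialKernel (contDiff_two_of_hasDerivAt h1 h2 h3) hχ)
    (hasCompactSupport_radialKernel h4 hχr) (tendsto_fivePoint_radialKernel h1 h2 h3)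
  have e : radialKernel (fun c => (c ^ 2 - 1) * ψ'' c + 2 * c * ψ' c) χ = radialKernel k χ := by
    funext p
    simp only [radialKernel, h5 _ (one_le_coshDist _ _)]
  rw [e] at h6
  simp only [smear_radialKernel F hk hχ.continuous hhigh hχr] at h6
  rw [← h6, integral_integral_leafMap (continuous_transAvg F hχi hχ.continuous)
    (integrable_radial hk hhigh)]

end

end SolvQuotient

/-! ### Uniqueness of the harmonic probability measure -/

namespace SolvQuotient

open Solv

variable {Γ : Subgroup Solv} {τ a b : ℝ}

/-- The translates of the profile on the circle, integrated against a function. -/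
noncomputable def profileMean (φ : C(ℝ ⧸ heightGroup Γ, ℝ)) (y : ℝ ⧸ heightGroup Γ) (ρ : ℝ) : ℝ :=
  ∫ s, solvProfile s * φ (y + ((s - ρ : ℝ) : ℝ ⧸ heightGroup Γ))

theorem continuous_profileMean {φ : C(ℝ ⧸ heightGroup Γ, ℝ)} {B : ℝ} (hB : ∀ y, |φ y| ≤ B) :
    Continuous fun p : (ℝ ⧸ heightGroup Γ) × ℝ => profileMean φ p.1 p.2 := by
  have hc : Continuous fun s : ℝ => (s : ℝ ⧸ heightGroup Γ) := continuous_coe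
  have hs := continuous_solvProfile
  refine continuous_of_dominated (bound := fun s => solvProfile s * B) (fun p => ?_)
    (fun p => .of_forall fun s => ?_) (integrable_solvProfile.mul_const B) (.of_forall fun s => ?_)
  · exact (by fun_prop : Continuous _).aestronglyMeasurable
  · rw [norm_mul, Real.norm_eq_abs, abs_of_nonneg (solvProfile_nonneg _)]
    exact mul_le_mul_of_nonneg_left (hB _) (solvProfile_nonneg _)
  · fun_prop

theorem abs_profileMean_le {φ : C(ℝ ⧸ heightGroup Γ, ℝ)} {B : ℝ} (hB : ∀ y, |φ y| ≤ B)
    (y : ℝ ⧸ heightGroup Γ) (ρ : ℝ) : |profileMean φ y ρ| ≤ B := by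
  have h : ‖profileMean φ y ρ‖ ≤ ∫ s, solvProfile s * B := by
    refine norm_integral_le_of_norm_le (integrable_solvProfile.mul_const B)
      (.of_forall fun s => ?_)
    rw [norm_mul, Real.norm_eq_abs, abs_of_nonneg (solvProfile_nonneg _)]
    exact mul_le_mul_of_nonneg_left (hB _) (solvProfile_nonneg _)
  rwa [integral_mul_const, integral_solvProfile, one_mul] at h

theorem IsLatticeData.profileMean_add_period (h : IsLatticeData Γ τ a b)
    (φ : C(ℝ ⧸ heightGroup Γ, ℝ)) (y : ℝ ⧸ heightGroup Γ) (ρ : ℝ) :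
    profileMean φ y (ρ + τ) = profileMean φ y ρ := by
  have e : ∀ s : ℝ, ((s - (ρ + τ) : ℝ) : ℝ ⧸ heightGroup Γ) = ((s - ρ : ℝ) : ℝ ⧸ heightGroup Γ) := by
    intro s
    rw [← h.coe_add_period (s - (ρ + τ))]
    congr 1
    ring
  simp only [profileMean, e]

theorem IsLatticeData.integral_translate (h : IsLatticeData Γ τ a b)
    (φ : C(ℝ ⧸ heightGroup Γ, ℝ)) (y : ℝ ⧸ heightGroup Γ) (s : ℝ) :
    ∫ ρ in (0 : ℝ)..τ, φ (y + ((s - ρ : ℝ) : ℝ ⧸ heightGroup Γ)) =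
      ∫ r in (0 : ℝ)..τ, φ (r : ℝ ⧸ heightGroup Γ) := by
  obtain ⟨t, rfl⟩ := QuotientAddGroup.mk_surjective y
  have hper : Function.Periodic (fun s : ℝ => φ (s : ℝ ⧸ heightGroup Γ)) τ := fun s => by
    simp only [h.coe_add_period]
  have e1 := hper.intervalIntegral_add_eq (t + s - τ) 0
  rw [zero_add, sub_add_cancel] at e1
  have e2 := intervalIntegral.integral_comp_sub_left (a := 0) (b := τ)
    (fun r : ℝ => φ (r : ℝ ⧸ heightGroup Γ)) (t + s)
  rw [sub_zero, e1] at e2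
  rw [← e2]
  refine intervalIntegral.integral_congr fun ρ _ => ?_
  rw [← QuotientAddGroup.mk_add, add_sub_assoc]

/-- Integrating `ρ` over a full period erases the phase, and the profile has total mass `1`. -/
theorem IsLatticeData.integral_profileMean (h : IsLatticeData Γ τ a b)
    {φ : C(ℝ ⧸ heightGroup Γ, ℝ)} {B : ℝ} (hB : ∀ y, |φ y| ≤ B) (y : ℝ ⧸ heightGroup Γ) :
    ∫ ρ in (0 : ℝ)..τ, profileMean φ y ρ = ∫ r in (0 : ℝ)..τ, φ (r : ℝ ⧸ heightGroup Γ) := by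
  have hc : Continuous fun s : ℝ => (s : ℝ ⧸ heightGroup Γ) := continuous_coe
  have hfin : IsFiniteMeasure (volume.restrict (Set.uIoc 0 τ)) :=
    ⟨by rw [Measure.restrict_apply_univ]; exact measure_Ioc_lt_top⟩
  simp only [profileMean]
  rw [intervalIntegral_integral_swap]
  · simp only [intervalIntegral.integral_const_mul, h.integral_translate]
    rw [integral_mul_const, integral_solvProfile, one_mul]
  · exact (integrable_solvProfile.comp_snd (volume.restrict (Set.uIoc 0 τ))).mul_bdd (c := B)
      (by fun_prop : Continuous fun p : ℝ × ℝ =>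
        φ (y + ((p.2 - p.1 : ℝ) : ℝ ⧸ heightGroup Γ))).aestronglyMeasurable
      (.of_forall fun p => hB _)

section

variable {ν : Measure (SolvQuotient Γ)}

theorem continuous_integral_diskMeasure [CompactSpace (SolvQuotient Γ)] {f : SolvQuotient Γ → ℝ}
    (hf : Continuous f) (ρ : ℝ) : Continuous fun z => ∫ y, f y ∂(diskMeasure Γ ρ z) := by
  obtain ⟨B, hB⟩ := exists_bound hf
  simp only [integral_diskMeasure hf]
  refine continuous_const.mul (continuous_of_dominated (bound := fun _ => B) (fun z => ?_)
    (fun z => .of_forall fun w => hB _) ?_ (.of_forall fun w => ?_))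
  · exact (hf.comp (continuous_leafMap Γ z)).aestronglyMeasurable
  · exact integrableOn_const ((measure_mono Metric.ball_subset_closedBall).trans_lt
      (isCompact_closedBall _ _).measure_lt_top).ne
  · exact hf.comp (continuous_leafMap_uncurry.comp (continuous_id.prodMk continuous_const))

theorem abs_integral_diskMeasure_le {f : SolvQuotient Γ → ℝ} {B : ℝ} (hB : ∀ z, |f z| ≤ B)
    {ρ : ℝ} (hρ : 0 < ρ) (z : SolvQuotient Γ) : |∫ y, f y ∂(diskMeasure Γ ρ z)| ≤ B := by
  have := isProbabilityMeasure_diskMeasure Γ hρ z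
  have h := norm_integral_le_of_norm_le_const (μ := diskMeasure Γ ρ z) (f := f) (C := B)
    (.of_forall hB)
  simpa using h

variable [CompactSpace (SolvQuotient Γ)] [IsProbabilityMeasure ν]

/-- By Fubini the left side is the mean of `leafMean ν f` over a disk around `i`, to which the mean
value property applies. -/
theorem integral_integral_diskMeasure {f : SolvQuotient Γ → ℝ} (hf : Continuous f)
    (H : IsRadiallyOrthogonal (leafMean ν f)) (H1 : IsRadiallyOrthogonal fun _ => 1) {ρ : ℝ}
    (hρ : 0 < ρ) : ∫ z, (∫ y, f y ∂(diskMeasure Γ ρ z)) ∂ν = ∫ z, f z ∂ν := by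
  have hm := Metric.isOpen_ball.measurableSet (s := Metric.ball UpperHalfPlane.I ρ)
  have e : ∀ v : ℍ → ℝ, ∫ w in Metric.ball UpperHalfPlane.I ρ, v w =
      ∫ w, (Metric.ball UpperHalfPlane.I ρ).indicator 1 w * v w := by
    intro v
    rw [← integral_indicator hm]
    refine integral_congr_ae (.of_forall fun w => ?_)
    by_cases hw : w ∈ Metric.ball UpperHalfPlane.I ρ <;> simp [hw]
  have hi : Integrable ((Metric.ball UpperHalfPlane.I ρ).indicator (1 : ℍ → ℝ)) :=
    (integrable_indicator_iff hm).2 (integrableOn_const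
      ((measure_mono Metric.ball_subset_closedBall).trans_lt
        (isCompact_closedBall _ _).measure_lt_top).ne)
  simp only [integral_diskMeasure hf]
  rw [integral_const_mul]
  simp only [e (fun w => f (leafMap Γ _ w))]
  rw [integral_integral_leafMap hf hi, ← e, H.mean_value H1 (continuous_leafMean hf) hρ, leafMean_I]

/-- The `ν`-averages of disk means equal `∫ f dν` for all radii and are asymptotic to the
`τ`-periodic function `G`; so `G` is constant. Its integral over a period involves `fb` only and not
`ν`. -/
theorem integral_eq_of_isRadiallyOrthogonal (h : IsLatticeData Γ τ a b)
    {f : C(SolvQuotient Γ, ℝ)} {fb : C(ℝ ⧸ heightGroup Γ, ℝ)} (hfb : IsFiberMean f fb)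
    (H : IsRadiallyOrthogonal (leafMean ν f)) (H1 : IsRadiallyOrthogonal fun _ => 1) :
    τ * ∫ z, f z ∂ν = ∫ r in (0 : ℝ)..τ, fb (r : ℝ ⧸ heightGroup Γ) := by
  obtain ⟨B, hB⟩ := exists_bound f.continuous
  have hfbB := hfb.abs_le hB
  have hp := continuous_baseProj (Γ := Γ)
  have hP := continuous_profileMean hfbB
  have hPz : ∀ ρ, Continuous fun z => profileMean fb (baseProj Γ z) ρ := fun ρ =>
    hP.comp (hp.prodMk continuous_const)
  have hD : ∀ ρ, Continuous fun z => ∫ y, f y ∂(diskMeasure Γ ρ z) :=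
    continuous_integral_diskMeasure f.continuous
  set G : ℝ → ℝ := fun ρ => ∫ z, profileMean fb (baseProj Γ z) ρ ∂ν with hG
  have hdiff : Tendsto (fun ρ => ∫ z, ((∫ y, f y ∂(diskMeasure Γ ρ z)) -
      profileMean fb (baseProj Γ z) ρ) ∂ν) atTop (𝓝 (∫ _ : SolvQuotient Γ, (0 : ℝ) ∂ν)) := by
    refine tendsto_integral_filter_of_dominated_convergence (fun _ => B + B)
      (.of_forall fun ρ => ((hD ρ).sub (hPz ρ)).aestronglyMeasurable) ?_ (integrable_const _)
      (.of_forall fun z => hfb.tendsto_integral_diskMeasure fun _ => z)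
    filter_upwards [eventually_gt_atTop 0] with ρ hρ
    exact .of_forall fun z => (norm_sub_le _ _).trans
      (add_le_add (abs_integral_diskMeasure_le hB hρ z) (abs_profileMean_le hfbB _ _))
  have hlim : Tendsto G atTop (𝓝 (∫ z, f z ∂ν)) := by
    have h1 := hdiff.const_sub (∫ z, f z ∂ν)
    rw [integral_zero, sub_zero] at h1
    refine h1.congr' ?_
    filter_upwards [eventually_gt_atTop 0] with ρ hρ
    rw [integral_sub (integrable_of_continuous (hD ρ)) (integrable_of_continuous (hPz ρ)),
      integral_integral_diskMeasure f.continuous H H1 hρ, sub_sub_cancel]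
  have hper : Function.Periodic G τ := fun ρ => by
    simp only [hG, h.profileMean_add_period]
  have hconst : ∀ ρ, G ρ = ∫ z, f z ∂ν := by
    intro ρ
    have ht : Tendsto (fun n : ℕ => ρ + n * τ) atTop atTop :=
      tendsto_atTop_add_const_left _ _ (tendsto_natCast_atTop_atTop.atTop_mul_const h.pos)
    refine tendsto_nhds_unique ?_ (hlim.comp ht)
    refine tendsto_const_nhds.congr fun n => ?_
    exact (hper.nat_mul n ρ).symm
  have e1 : τ * ∫ z, f z ∂ν = ∫ ρ in (0 : ℝ)..τ, G ρ := by
    simp only [hconst, intervalIntegral.integral_const, sub_zero, smul_eq_mul]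
  have e2 := integral_interval_swap (m := ν) (f := fun ρ z => profileMean fb (baseProj Γ z) ρ)
    (hP.comp ((hp.comp continuous_snd).prodMk continuous_fst)) 0 τ
  rw [e1, e2]
  simp [h.integral_profileMean hfbB]

end

theorem transAvg_one {χ : ℝ → ℝ} (hχ : ∫ y, χ y = 1) (z : SolvQuotient Γ) :
    transAvg (1 : C(SolvQuotient Γ, ℝ)) χ z = 1 := by
  simp [transAvg, hχ]

theorem IsHarmonic.integral_transAvg_eq (h : IsLatticeData Γ τ a b) {ν m : Measure (SolvQuotient Γ)}
    [IsProbabilityMeasure ν] [IsProbabilityMeasure m] (hν : IsHarmonic Γ ν) (hm : IsHarmonic Γ m)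
    (F : C(SolvQuotient Γ, ℝ)) {χ : ℝ → ℝ} (hχ : ContDiff ℝ 2 χ) {r : ℝ}
    (hχr : ∀ y, r < |y| → χ y = 0) (hχ1 : ∫ y, χ y = 1) :
    ∫ z, transAvg F χ z ∂ν = ∫ z, transAvg F χ z ∂m := by
  have := h.compactSpace
  have hχi : Integrable χ := by
    by_contra hne
    rw [integral_undef hne] at hχ1
    exact zero_ne_one hχ1
  set f : C(SolvQuotient Γ, ℝ) := ⟨transAvg F χ, continuous_transAvg F hχi hχ.continuous⟩ with hf
  obtain ⟨fb, hfb⟩ := h.exists_fiberMean f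
  -- The constant function is its own transverse average, so its orthogonality is a special case of
  -- that for `ν`.
  have H1 : IsRadiallyOrthogonal fun _ => 1 := by
    have := hν.isRadiallyOrthogonal h (1 : C(SolvQuotient Γ, ℝ)) hχ hχr
    have e : leafMean ν (transAvg (1 : C(SolvQuotient Γ, ℝ)) χ) = fun _ => 1 := by
      funext w
      simp [leafMean, transAvg_one hχ1]
    rwa [e] at this
  have e1 := integral_eq_of_isRadiallyOrthogonal h hfb (hν.isRadiallyOrthogonal h F hχ hχr) H1
  have e2 := integral_eq_of_isRadiallyOrthogonal h hfb (hm.isRadiallyOrthogonal h F hχ hχr) H1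
  exact mul_left_cancel₀ h.pos.ne' (e1.trans e2.symm)

/-- A sequence of smooth approximate identities on the line. -/
noncomputable def lineBump (n : ℕ) : ContDiffBump (0 : ℝ) where
  rIn := 1 / (2 * (n + 1))
  rOut := 1 / (n + 1)
  rIn_pos := by positivity
  rIn_lt_rOut := by
    apply one_div_lt_one_div_of_lt <;> linarith [n.cast_nonneg (α := ℝ)]

theorem tendsto_transAvg (F : C(SolvQuotient Γ, ℝ)) (z : SolvQuotient Γ) :
    Tendsto (fun n => transAvg F ((lineBump n).normed volume) z) atTop (𝓝 (F z)) := by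
  have ht := continuous_trans
  have hg : Continuous fun y : ℝ => F (rmul z (trans (-y))) := by fun_prop
  have h := ContDiffBump.convolution_tendsto_right_of_continuous (μ := volume) (φ := lineBump)
    (l := atTop) tendsto_one_div_add_atTop_nhds_zero_nat hg 0
  have e : trans (-0) = 1 := by rw [neg_zero]; rfl
  rw [e, rmul_one] at h
  refine h.congr fun n => ?_
  simp [convolution_def, transAvg]

/-- Harmonic probability measures are unique. -/
theorem IsHarmonic.unique [DiscreteTopology Γ] (h : IsLatticeData Γ τ a b)
    {ν m : Measure (SolvQuotient Γ)} [IsProbabilityMeasure ν] [IsProbabilityMeasure m]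
    (hν : IsHarmonic Γ ν) (hm : IsHarmonic Γ m) : ν = m := by
  have := h.compactSpace
  refine ext_of_forall_integral_eq_of_IsFiniteMeasure fun F₀ => ?_
  set F : C(SolvQuotient Γ, ℝ) := F₀.toContinuousMap
  obtain ⟨B, hB⟩ := exists_bound F.continuous
  -- Every test function is a bounded pointwise limit of its transverse smoothings, for which the
  -- integrals are known to agree.
  have hlim : ∀ m : Measure (SolvQuotient Γ), IsProbabilityMeasure m →
      Tendsto (fun n => ∫ z, transAvg F ((lineBump n).normed volume) z ∂m) atTop
        (𝓝 (∫ z, F z ∂m)) := by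
    intro m _
    refine tendsto_integral_of_dominated_convergence (fun _ => B) (fun n => ?_)
      (integrable_const B) (fun n => .of_forall fun z => ?_) (.of_forall (tendsto_transAvg F))
    · exact (continuous_transAvg F (lineBump n).integrable_normed
        (lineBump n).continuous_normed).aestronglyMeasurable
    · have h1 : ‖transAvg F ((lineBump n).normed volume) z‖ ≤
          ∫ y, (lineBump n).normed volume y * B := by
        refine norm_integral_le_of_norm_le ((lineBump n).integrable_normed.mul_const B)
          (.of_forall fun y => ?_)
        rw [norm_mul, Real.norm_eq_abs, abs_of_nonneg ((lineBump n).nonneg_normed y)]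
        exact mul_le_mul_of_nonneg_left (hB _) ((lineBump n).nonneg_normed y)
      rwa [integral_mul_const, (lineBump n).integral_normed, one_mul] at h1
  refine tendsto_nhds_unique (hlim ν inferInstance) ?_
  have e : ∀ n, ∫ z, transAvg F ((lineBump n).normed volume) z ∂ν =
      ∫ z, transAvg F ((lineBump n).normed volume) z ∂m := by
    intro n
    refine hν.integral_transAvg_eq h hm F (lineBump n).contDiff_normed (r := (lineBump n).rOut)
      (fun y hy => ?_) (lineBump n).integral_normed
    rw [← Function.notMem_support, (lineBump n).support_normed_eq]
    simpa using hy.le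
  simp only [e]
  exact hlim m inferInstance

end SolvQuotient

/-! ### The limit measure and its density -/

namespace SolvQuotient

open Solv

variable {Γ : Subgroup Solv} {τ a b : ℝ}

theorem IsLatticeData.exists_lift (h : IsLatticeData Γ τ a b) (φ : C(ℝ, ℝ))
    (hper : ∀ t, φ (t + τ) = φ t) :
    ∃ Φ : C(ℝ ⧸ heightGroup Γ, ℝ), ∀ t : ℝ, Φ (t : ℝ ⧸ heightGroup Γ) = φ t := by
  refine ⟨⟨Quotient.lift (s := QuotientAddGroup.leftRel (heightGroup Γ)) φ ?_,
    φ.continuous.quotient_lift _⟩, fun t => rfl⟩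
  intro s t hst
  have hmem := QuotientAddGroup.leftRel_apply.1 hst
  rw [h.heightGroup_eq] at hmem
  obtain ⟨k, hk⟩ := hmem
  have hp : Function.Periodic φ τ := hper
  have hk' : k * τ = -s + t := by simpa using hk
  rw [show t = s + k * τ by linarith, hp.int_mul k s]

theorem integral_withDensity_baseProj {m : Measure (SolvQuotient Γ)}
    {Φ : C(ℝ ⧸ heightGroup Γ, ℝ)} (hΦ : ∀ y, 0 ≤ Φ y) (f : SolvQuotient Γ → ℝ) :
    ∫ z, f z ∂(m.withDensity fun y => ENNReal.ofReal (Φ (baseProj Γ y))) =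
      ∫ z, Φ (baseProj Γ z) * f z ∂m := by
  have hc : Continuous fun z => Φ (baseProj Γ z) := Φ.continuous.comp continuous_baseProj
  rw [integral_withDensity_eq_integral_toReal_smul hc.measurable.ennreal_ofReal
    (.of_forall fun _ => ENNReal.ofReal_lt_top)]
  simp only [ENNReal.toReal_ofReal (hΦ _), smul_eq_mul]

section Profile

variable {m : Measure (SolvQuotient Γ)} [IsProbabilityMeasure m]
  {Φ : C(ℝ ⧸ heightGroup Γ, ℝ)}

/-- Multiplied by `τ`, both sides are the integral of `periodProfile τ` times `φ` over one period.
-/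
theorem IsLatticeData.integral_density_mul (h : IsLatticeData Γ τ a b) (hm : IsRightInvariant m)
    (hΦ : ∀ t : ℝ, Φ (t : ℝ ⧸ heightGroup Γ) = periodProfile τ t)
    (φ : C(ℝ ⧸ heightGroup Γ, ℝ)) :
    ∫ z, Φ (baseProj Γ z) * φ (baseProj Γ z) ∂m =
      ∫ s, solvProfile s * φ (s : ℝ ⧸ heightGroup Γ) := by
  have e1 := h.integral_baseProj hm (Φ * φ)
  have e2 := integral_solvProfile_mul h.pos (φ := fun s : ℝ => φ (s : ℝ ⧸ heightGroup Γ))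
    (φ.continuous.comp continuous_coe) (fun t => by simp only [h.coe_add_period])
  simp only [ContinuousMap.mul_apply, hΦ] at e1
  exact mul_left_cancel₀ h.pos.ne' (e1.trans e2.symm)

theorem density_nonneg (hτ : 0 < τ)
    (hΦ : ∀ t : ℝ, Φ (t : ℝ ⧸ heightGroup Γ) = periodProfile τ t) (y : ℝ ⧸ heightGroup Γ) :
    0 ≤ Φ y := by
  obtain ⟨t, rfl⟩ := QuotientAddGroup.mk_surjective y
  exact (periodProfile_nonneg hτ t).trans_eq (hΦ t).symm

theorem IsLatticeData.isProbabilityMeasure_withDensity (h : IsLatticeData Γ τ a b)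
    (hm : IsRightInvariant m) (hΦ : ∀ t : ℝ, Φ (t : ℝ ⧸ heightGroup Γ) = periodProfile τ t) :
    IsProbabilityMeasure (m.withDensity fun y => ENNReal.ofReal (Φ (baseProj Γ y))) := by
  have := h.compactSpace
  refine ⟨?_⟩
  have hc : Continuous fun z => Φ (baseProj Γ z) := Φ.continuous.comp continuous_baseProj
  rw [withDensity_apply _ MeasurableSet.univ, Measure.restrict_univ,
    ← ofReal_integral_eq_lintegral_ofReal (integrable_of_continuous hc)
      (.of_forall fun z => density_nonneg h.pos hΦ _)]
  have e := h.integral_density_mul hm hΦ 1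
  simp only [ContinuousMap.one_apply, mul_one, integral_solvProfile] at e
  rw [e, ENNReal.ofReal_one]

theorem IsLatticeData.withDensity_ne (h : IsLatticeData Γ τ a b) (hm : IsRightInvariant m)
    (hΦ : ∀ t : ℝ, Φ (t : ℝ ⧸ heightGroup Γ) = periodProfile τ t) :
    (m.withDensity fun y => ENNReal.ofReal (Φ (baseProj Γ y))) ≠ m := by
  intro he
  have := h.compactSpace
  have hp := continuous_baseProj (Γ := Γ)
  -- Testing the supposed equality with `Φ - 1` gives `∫ (Φ - 1) ^ 2 = 0`, hence `Φ = 1` everywhere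
  -- by continuity.
  set ψ : C(ℝ ⧸ heightGroup Γ, ℝ) := Φ - 1 with hψ
  have e1 := integral_withDensity_baseProj (m := m) (density_nonneg h.pos hΦ)
    fun z => ψ (baseProj Γ z)
  rw [he] at e1
  have e2 : ∫ z, (ψ * ψ) (baseProj Γ z) ∂m = 0 := by
    have e3 : ∀ z, (ψ * ψ) (baseProj Γ z) =
        Φ (baseProj Γ z) * ψ (baseProj Γ z) - ψ (baseProj Γ z) := fun z => by
      simp [hψ]; ring
    simp only [e3]
    rw [integral_sub (integrable_of_continuous (by fun_prop))
      (integrable_of_continuous (by fun_prop)), ← e1, sub_self]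
  have e4 := h.integral_baseProj hm (ψ * ψ)
  rw [e2, mul_zero] at e4
  refine periodProfile_not_const h.pos 1 fun t => ?_
  by_contra hne
  have hper : Function.Periodic (periodProfile τ) τ := periodProfile_add_period h.pos
  obtain ⟨y, hy, hty⟩ := hper.exists_mem_Ico₀ h.pos t
  have hpos := intervalIntegral.integral_pos h.pos
    (f := fun s : ℝ => (ψ * ψ) (s : ℝ ⧸ heightGroup Γ))
    ((ψ * ψ).continuous.comp continuous_coe).continuousOn
    (fun s _ => mul_self_nonneg _) ⟨y, ⟨hy.1, hy.2.le⟩, by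
      refine mul_self_pos.2 ?_
      rw [hψ, ContinuousMap.sub_apply, hΦ, ← hty, ContinuousMap.one_apply]
      exact sub_ne_zero.2 hne⟩
  exact hpos.ne e4

/-- The base point of height `n` cancels the shift `-ρ` with `ρ = n`, so the asymptotic expression
no longer depends on `n`. -/
theorem IsLatticeData.tendsto_integral_diskMeasure_density (h : IsLatticeData Γ τ a b)
    (hm : IsRightInvariant m) (hΦ : ∀ t : ℝ, Φ (t : ℝ ⧸ heightGroup Γ) = periodProfile τ t)
    (f : C(SolvQuotient Γ, ℝ)) :
    Tendsto (fun n : ℕ => ∫ y, f y ∂(diskMeasure Γ n (proj Γ (geo n)))) atTop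
      (𝓝 (∫ y, f y ∂(m.withDensity fun y => ENNReal.ofReal (Φ (baseProj Γ y))))) := by
  have := h.compactSpace
  obtain ⟨fb, hfb⟩ := h.exists_fiberMean f
  have hfb' : IsFiberMean f fb := hfb
  have h1 := (hfb'.tendsto_integral_diskMeasure fun ρ => proj Γ (geo ρ)).comp
    (tendsto_natCast_atTop_atTop (R := ℝ))
  have e : ∀ s ρ : ℝ, baseProj Γ (proj Γ (geo ρ)) + ((s - ρ : ℝ) : ℝ ⧸ heightGroup Γ) =
      (s : ℝ ⧸ heightGroup Γ) := by
    intro s ρ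
    rw [baseProj_proj, ← QuotientAddGroup.mk_add]
    congr 1
    simp [geo]
  simp only [e] at h1
  rw [integral_withDensity_baseProj (density_nonneg h.pos hΦ),
    hfb'.integral_mul hm f.continuous, h.integral_density_mul hm hΦ]
  simpa [Function.comp_def] using h1.add_const (∫ s, solvProfile s * fb (s : ℝ ⧸ heightGroup Γ))

end Profile

end SolvQuotient

theorem theorem2p1 (Γ : Subgroup Solv) (hΓ : DiscreteTopology Γ)
    (F : Set Solv) (hF : IsFundamentalDomain Γ F (volume : Measure Solv))
    (hFfin : (volume : Measure Solv) F ≠ ⊤) :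
    -- `m` is a harmonic probability measure, and the only one
    (IsProbabilityMeasure (SolvQuotient.haarMeasure Γ F) ∧
      SolvQuotient.IsHarmonic Γ (SolvQuotient.haarMeasure Γ F) ∧
      ∀ ν : Measure (SolvQuotient Γ), IsProbabilityMeasure ν →
        SolvQuotient.IsHarmonic Γ ν → ν = SolvQuotient.haarMeasure Γ F) ∧
    -- the base of the fibration is a circle of length `τ`
    ∃ τ : ℝ, 0 < τ ∧ SolvQuotient.heightGroup Γ = AddSubgroup.zmultiples τ ∧
    ∃ Φ : C(ℝ ⧸ SolvQuotient.heightGroup Γ, ℝ),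
      (∀ t : ℝ, HasSum (fun k : ℤ => τ * solvProfile (t + k * τ))
        (Φ (t : ℝ ⧸ SolvQuotient.heightGroup Γ))) ∧
      (¬ ∃ c : ℝ, ∀ s, Φ s = c) ∧
    ∃ (z : ℕ → SolvQuotient Γ) (μ : Measure (SolvQuotient Γ)),
      IsProbabilityMeasure μ ∧
      (∀ f : C(SolvQuotient Γ, ℝ),
        Tendsto (fun n : ℕ => ∫ y, f y ∂(SolvQuotient.diskMeasure Γ (n : ℝ) (z n))) atTop
          (𝓝 (∫ y, f y ∂μ))) ∧
      μ = (SolvQuotient.haarMeasure Γ F).withDensity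
        (fun y => ENNReal.ofReal (Φ (SolvQuotient.baseProj Γ y))) ∧
      μ ≠ SolvQuotient.haarMeasure Γ F ∧
      ¬ SolvQuotient.IsHarmonic Γ μ := by
  have hcount : Countable Γ := countable_of_Lindelof_of_discrete
  obtain ⟨τ, a, b, h⟩ := SolvQuotient.exists_isLatticeData hΓ hF hFfin
  have hprob := SolvQuotient.isProbabilityMeasure_haarMeasure hF hFfin
  have hinv : SolvQuotient.IsRightInvariant (SolvQuotient.haarMeasure Γ F) :=
    SolvQuotient.measurePreserving_rmul hF
  have hharm := hinv.isHarmonic h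
  have huniq : ∀ ν : Measure (SolvQuotient Γ), IsProbabilityMeasure ν →
      SolvQuotient.IsHarmonic Γ ν → ν = SolvQuotient.haarMeasure Γ F :=
    fun ν _ hν => hν.unique h hharm
  obtain ⟨Φ, hΦ⟩ := h.exists_lift (periodProfile τ) (periodProfile_add_period h.pos)
  have hμ := h.isProbabilityMeasure_withDensity hinv hΦ
  have hne := h.withDensity_ne hinv hΦ
  refine ⟨⟨hprob, hharm, huniq⟩, τ, h.pos, h.heightGroup_eq, Φ, fun t => ?_, ?_,
    fun n => SolvQuotient.proj Γ (Solv.geo n), _, hμ,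
    h.tendsto_integral_diskMeasure_density hinv hΦ, rfl, hne, fun hh => hne (huniq _ hμ hh)⟩
  · rw [hΦ]
    exact hasSum_periodProfile h.pos t
  · rintro ⟨c, hc⟩
    exact periodProfile_not_const h.pos c fun t => (hΦ t).symm.trans (hc _)
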